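/- Let $L\ge 1$ be a fixed integer, $\sigma^2>0$, and let $K=K(N)$ be positive integers with $K/N\to c>0$ as $N\to\infty$. For each $N$ let $s_{ik}=s_{ik}(N)$, $1\le i\le N$, $1\le k\le K$, be i.i.d. complex random variables whose common law does not depend on $N$, with $\mathbf E s_{11}=0$ and $\mathbf E|s_{11}|^2=1$, and suppose that one of the following holds: (a) the $s_{ik}(N)=s_{ik}$ are, for all $N$, the entries of a single doubly infinite array $\{s_{ik}: i,k=1,2,\dots\}$ of i.i.d. random variables, and $\mathbf E|s_{11}|^4<\infty$; or (b) no assumption is made on the dependence between the arrays for different $N$, and $\mathbf E|s_{11}|^6<\infty$. Put $\mathbf s_k=(s_{1k},\dots,s_{Nk})^T$. For each $N$ let $\gamma_k(\ell)=\gamma_k^N(\ell)\in\mathbb C$ and $T_k=T_k^N\ge 0$, $1\le k\le K$, $1\le \ell\le L$, be random variables that are jointly independent of $(\mathbf s_1,\dots,\mathbf s_K)$, put $\boldsymbol\alpha_k=\sqrt{T_k}\,(\gamma_k(1),\dots,\gamma_k(L))^T$, and assume that almost surely the empirical distribution $\frac1K\sum_{k=1}^K\delta_{\boldsymbol\alpha_k}$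 converges weakly, as $N\to\infty$, to a nonrandom probability distribution $H$ on $\mathbb C^L$. Let $\boldsymbol\beta_k=\sqrt{T_k}\,(\gamma_k(1)\mathbf s_k^T,\dots,\gamma_k(L)\mathbf s_k^T)^T\in\mathbb C^{NL}$ and $$C_k=\frac1N\Big(\sum_{j=1}^K\boldsymbol\beta_j\boldsymbol\beta_j^*-\boldsymbol\beta_k\boldsymbol\beta_k^*\Big),\qquad 1\le k\le K.$$ Let $I$ be the $NL\times NL$ identity matrix, and write $(C_k+\sigma^2I)^{-1}_{\ell\ell'}$ for the $\ell,\ell'$ block, of size $N\times N$, of $(C_k+\sigma^2 I)^{-1}$. Then there is exactly one Hermitian positive definite $L\times L$ matrix $A=(a_{\ell\ell'})$ satisfying $$A=\Big(c\,\mathbf E\,\frac{\boldsymbol\alpha\boldsymbol\alpha^*}{1+\boldsymbol\alpha^*A\boldsymbol\alpha}+\sigma^2I_L\Big)^{-1},$$ where $\boldsymbol\alpha\in\mathbb C^L$ has distribution $H$, and for all $\ell,\ell'\in\{1,\dots,L\}$, $$\max_{k\le K}\big|N^{-1}\mathbf s_k^*(C_k+\sigma^2I)^{-1}_{\ell\ell'}\mathbf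 s_k-a_{\ell\ell'}\big|\to0\quad\text{almost surely as }N\to\infty.$$ -/

import Mathlib

open MeasureTheory ProbabilityTheory Filter Topology
open scoped ComplexOrder Matrix BoundedContinuousFunction ENNReal

namespace CDMA

noncomputable section

/-- A standardized law on `ℂ`: `E X = 0` and `E |X|² = 1`. -/
structure IsStandardized (ν : Measure ℂ) : Prop where
  isProbabilityMeasure : IsProbabilityMeasure ν
  memLp_two : MemLp (fun z : ℂ => z) 2 ν
  mean_zero : ∫ z, z ∂ν = 0
  second_moment : ∫ z, ‖z‖ ^ 2 ∂ν = 1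

/-- The family `X` of complex random variables is i.i.d. with common law `ν`. -/
structure IsIID {Ω : Type*} [MeasurableSpace Ω] {ι : Type*} (X : ι → Ω → ℂ) (ν : Measure ℂ)
    (P : Measure Ω) : Prop where
  measurable : ∀ i, Measurable (X i)
  indep : iIndepFun X P
  law : ∀ i, P.map (X i) = ν

/-- For every `N` the `N × K(N)` array `s N` is the upper left corner of one and the same doubly
infinite array of i.i.d. random variables with law `ν`. -/
def FromDoubleArray {Ω : Type*} [MeasurableSpace Ω] {K : ℕ → ℕ}
    (s : (N : ℕ) → Fin N → Fin (K N) → Ω → ℂ) (ν : Measure ℂ) (P : Measure Ω) : Prop :=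
  ∃ x : ℕ → ℕ → Ω → ℂ, IsIID (fun p : ℕ × ℕ => x p.1 p.2) ν P ∧
    ∀ (N : ℕ) (i : Fin N) (k : Fin (K N)), s N i k = x i k

/-- For every `N` separately, the entries of the `N × K(N)` array `s N` are i.i.d. with law `ν`
(the same law for all `N`); nothing is assumed on the joint law of the arrays for different
`N`. -/
def RowwiseIID {Ω : Type*} [MeasurableSpace Ω] {K : ℕ → ℕ}
    (s : (N : ℕ) → Fin N → Fin (K N) → Ω → ℂ) (ν : Measure ℂ) (P : Measure Ω) : Prop :=
  ∀ N : ℕ, IsIID (fun p : Fin N × Fin (K N) => s N p.1 p.2) ν P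

/-- The empirical distribution `n⁻¹ ∑ₖ δ_{xₖ}` of `x₁, …, xₙ` (the zero measure if `n = 0`). -/
def empiricalMeasure {E : Type*} [MeasurableSpace E] {n : ℕ} (x : Fin n → E) : Measure E :=
  (n : ℝ≥0∞)⁻¹ • ∑ k, Measure.dirac (x k)

/-- Weak convergence of a sequence of measures, tested on bounded continuous functions. -/
def WeaklyConverges {E : Type*} [TopologicalSpace E] [MeasurableSpace E]
    (μ : ℕ → Measure E) (H : Measure E) : Prop :=
  ∀ f : E →ᵇ ℝ, Tendsto (fun n => ∫ z, f z ∂(μ n)) atTop (𝓝 (∫ z, f z ∂H))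

variable {L N K : ℕ}

/-- `α = √t (g(1), …, g(L))ᵀ`: transmit power `t`, fading gains `g`. -/
def gain (t : ℝ) (g : Fin L → ℂ) : Fin L → ℂ := fun l => ((√t : ℝ) : ℂ) * g l

/-- The stacked vector `β = (a(1) vᵀ, …, a(L) vᵀ)ᵀ ∈ ℂ^{NL}`; the index `(l, i)` is the `i`-th
entry of the `l`-th block. -/
def stack (a : Fin L → ℂ) (v : Fin N → ℂ) : Fin L × Fin N → ℂ := fun p => a p.1 * v p.2

/-- `C_k = N⁻¹ (∑ⱼ βⱼ βⱼ* - β_k β_k*)`, where `βⱼ` is built from `a j` and from the `j`-th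
column of `s`. -/
def interference (a : Fin K → Fin L → ℂ) (s : Fin N → Fin K → ℂ) (k : Fin K) :
    Matrix (Fin L × Fin N) (Fin L × Fin N) ℂ :=
  (N : ℂ)⁻¹ •
    ((∑ j, Matrix.vecMulVec (stack (a j) (fun i => s i j)) (star (stack (a j) (fun i => s i j))))
      - Matrix.vecMulVec (stack (a k) (fun i => s i k)) (star (stack (a k) (fun i => s i k))))

/-- The `N × N` block of an `NL × NL` matrix at position `l, l'`. -/
def block (M : Matrix (Fin L × Fin N) (Fin L × Fin N) ℂ) (l l' : Fin L) :
    Matrix (Fin N) (Fin N) ℂ :=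
  Matrix.of fun i j => M (l, i) (l', j)

/-- `N⁻¹ s_k* (C_k + σ² I)⁻¹_{l l'} s_k`. -/
def userForm (σ : ℝ) (a : Fin K → Fin L → ℂ) (s : Fin N → Fin K → ℂ) (k : Fin K)
    (l l' : Fin L) : ℂ :=
  (N : ℂ)⁻¹ * (star (fun i => s i k) ⬝ᵥ
    (block (interference a s k + ((σ : ℂ) ^ 2) • 1)⁻¹ l l' *ᵥ fun i => s i k))

/-- The matrix `E [α α* / (1 + α* A α)]`, entry by entry, where `α` has law `H`. -/
def expectedMatrix (H : Measure (Fin L → ℂ)) (A : Matrix (Fin L) (Fin L) ℂ) :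
    Matrix (Fin L) (Fin L) ℂ :=
  Matrix.of fun l l' => ∫ z, z l * star (z l') / (1 + star z ⬝ᵥ (A *ᵥ z)) ∂H

/-- The equation `A = (c E [α α* / (1 + α* A α)] + σ² I_L)⁻¹`, where `α` has law `H`. -/
def FixedPoint (c σ : ℝ) (H : Measure (Fin L → ℂ)) (A : Matrix (Fin L) (Fin L) ℂ) : Prop :=
  A = ((c : ℂ) • expectedMatrix H A + ((σ : ℂ) ^ 2) • 1)⁻¹

end

end CDMA

/-! Let `R` be the resolvent at `-σ²` of the full matrix `N⁻¹ ∑ⱼ βⱼ βⱼ*`, and let `traceMatrix`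
collect the normalized traces of its blocks. The column `s_k` is independent of `C_k`, so the
quadratic forms of user `k` concentrate around the normalized block traces of `(C_k + σ² I)⁻¹`.
Restoring the missing user changes these traces by `O(1/N)` only. Hence the matrices of all users
are uniformly close to one `L × L` matrix, `traceMatrix`, and its limit has to be identified.

The Sherman–Morrison formula turns `R R⁻¹ = I` into an exact equation
(`blockTrace_resolvent_identity`), which becomes the fixed point equation once every user matrix is
replaced by a common limit `A`. As `H` need not have moments, this passage needs `A` positive
definite: then `α α* / (1 + α* A α)` is bounded. The lower bound `sqNorm_div_le_quadForm_blockTrace`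
supplies this by discarding the at most `N / 2` directions spanned by the columns of users with
large gain. The entries of `traceMatrix` are bounded by `σ⁻²`, so limit points exist;
`fixedPoint_of_tendsto` shows that each solves the equation, and a scaling argument
(`quadForm_le_of_fixedPoint`) that the solution is unique. Compactness and uniqueness yield
existence and convergence together.

The probabilistic part is an exponential bound for quadratic forms of bounded independent variables
(`IsBoundedCentered.measure_norm_quadratic_ge_le`), obtained by decoupling. It is applied to
truncated columns. The truncation error is controlled by `ae_eventually_sum_tailSq_le`, which needs
a fourth moment and entries that are eventually `o(√N)`. This last fact (`EntriesSmall`) is where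
the hypotheses (a) and (b) are used differently. -/

namespace CDMA

/-! ### Quadratic forms, Loewner comparison of inverses, rank-one perturbations. -/

section LinearAlgebra

lemma posDef_add_smul_one {ι : Type*} [DecidableEq ι] {C : Matrix ι ι ℂ} {σ : ℝ}
    (hC : C.PosSemidef) (hσ : 0 < σ) :
    (C + ((σ : ℂ) ^ 2) • 1).PosDef := by
  refine Matrix.PosDef.posSemidef_add hC (Matrix.PosDef.one.smul ?_)
  exact_mod_cast pow_pos hσ 2

variable {ι : Type*} [Fintype ι]

/-- The squared Euclidean norm of a complex vector. -/
noncomputable def sqNorm (x : ι → ℂ) : ℝ := ∑ i, ‖x i‖ ^ 2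

/-- The real part of the sesquilinear form `x* M x`. -/
noncomputable def quadForm (M : Matrix ι ι ℂ) (x : ι → ℂ) : ℝ := (star x ⬝ᵥ (M *ᵥ x)).re

lemma sqNorm_nonneg (x : ι → ℂ) : 0 ≤ sqNorm x := Finset.sum_nonneg fun _ _ => by positivity

lemma sq_norm_apply_le_sqNorm (x : ι → ℂ) (i : ι) : ‖x i‖ ^ 2 ≤ sqNorm x :=
  Finset.single_le_sum (f := fun i => ‖x i‖ ^ 2) (fun _ _ => by positivity) (Finset.mem_univ i)

lemma sqNorm_smul (c : ℂ) (x : ι → ℂ) : sqNorm (c • x) = ‖c‖ ^ 2 * sqNorm x := by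
  simp [sqNorm, mul_pow, Finset.mul_sum]

lemma star_dotProduct_self (x : ι → ℂ) : star x ⬝ᵥ x = (sqNorm x : ℂ) := by
  simp only [dotProduct, sqNorm, Pi.star_apply, Complex.ofReal_sum]
  refine Finset.sum_congr rfl fun i _ => ?_
  rw [RCLike.star_def, Complex.conj_mul']
  push_cast; rfl

lemma sqNorm_eq_norm_sq (x : ι → ℂ) : sqNorm x = ‖WithLp.toLp 2 x‖ ^ 2 := by
  rw [EuclideanSpace.norm_sq_eq]; rfl

lemma norm_star_dotProduct_sq_le (x y : ι → ℂ) :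
    ‖star x ⬝ᵥ y‖ ^ 2 ≤ sqNorm x * sqNorm y := by
  have h := norm_inner_le_norm (𝕜 := ℂ) (WithLp.toLp 2 x : EuclideanSpace ℂ ι) (WithLp.toLp 2 y)
  rw [EuclideanSpace.inner_eq_star_dotProduct] at h
  rw [sqNorm_eq_norm_sq, sqNorm_eq_norm_sq, ← mul_pow, dotProduct_comm]
  exact pow_le_pow_left₀ (norm_nonneg _) h 2

lemma norm_star_dotProduct_le (x y : ι → ℂ) :
    ‖star x ⬝ᵥ y‖ ≤ √(sqNorm x) * √(sqNorm y) := by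
  rw [← Real.sqrt_mul (sqNorm_nonneg x)]
  exact Real.le_sqrt_of_sq_le (norm_star_dotProduct_sq_le x y)

lemma sqNorm_eq_zero {x : ι → ℂ} : sqNorm x = 0 ↔ x = 0 := by
  rw [sqNorm_eq_norm_sq]; simp

lemma sqNorm_pos {x : ι → ℂ} (hx : x ≠ 0) : 0 < sqNorm x :=
  lt_of_le_of_ne (sqNorm_nonneg x) fun h => hx (sqNorm_eq_zero.1 h.symm)

lemma star_dotProduct_comm (x y : ι → ℂ) : star x ⬝ᵥ y = star (star y ⬝ᵥ x) := by
  rw [← Matrix.star_dotProduct_star, star_star, dotProduct_comm]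

lemma star_dotProduct_mulVec_comm {M : Matrix ι ι ℂ} (hM : M.IsHermitian) (x y : ι → ℂ) :
    star x ⬝ᵥ (M *ᵥ y) = star (star y ⬝ᵥ (M *ᵥ x)) := by
  rw [star_dotProduct_comm, Matrix.star_mulVec, hM.eq, ← Matrix.dotProduct_mulVec]

lemma ofReal_quadForm {M : Matrix ι ι ℂ} (hM : M.IsHermitian) (x : ι → ℂ) :
    (quadForm M x : ℂ) = star x ⬝ᵥ (M *ᵥ x) := by
  have h := star_dotProduct_mulVec_comm hM x x
  exact Complex.conj_eq_iff_re.1 h.symm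

lemma quadForm_nonneg {M : Matrix ι ι ℂ} (hM : M.PosSemidef) (x : ι → ℂ) : 0 ≤ quadForm M x :=
  (Complex.le_def.1 (hM.dotProduct_mulVec_nonneg x)).1

lemma quadForm_add (M M' : Matrix ι ι ℂ) (x : ι → ℂ) :
    quadForm (M + M') x = quadForm M x + quadForm M' x := by
  simp [quadForm, Matrix.add_mulVec]

lemma quadForm_ofReal_smul (t : ℝ) (M : Matrix ι ι ℂ) (x : ι → ℂ) :
    quadForm ((t : ℂ) • M) x = t * quadForm M x := by
  simp [quadForm, Matrix.smul_mulVec]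

lemma posSemidef_of_quadForm {M : Matrix ι ι ℂ} (hM : M.IsHermitian)
    (h : ∀ x, 0 ≤ quadForm M x) : M.PosSemidef :=
  .of_dotProduct_mulVec_nonneg hM fun x => by
    rw [← ofReal_quadForm hM]; exact_mod_cast h x

lemma posDef_of_quadForm {M : Matrix ι ι ℂ} (hM : M.IsHermitian)
    (h : ∀ x, x ≠ 0 → 0 < quadForm M x) : M.PosDef :=
  .of_dotProduct_mulVec_pos hM fun x hx => by
    rw [← ofReal_quadForm hM]; exact_mod_cast h x hx

lemma quadForm_sub_smul {M : Matrix ι ι ℂ} (hM : M.IsHermitian) (x y : ι → ℂ) (s : ℝ) :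
    quadForm M (x - (s : ℂ) • y)
      = quadForm M x - 2 * s * (star x ⬝ᵥ (M *ᵥ y)).re + s ^ 2 * quadForm M y := by
  have h := congrArg Complex.re (star_dotProduct_mulVec_comm hM x y)
  simp only [RCLike.star_def, Complex.conj_re] at h
  simp only [quadForm, Matrix.mulVec_sub, Matrix.mulVec_smul, star_sub, star_smul,
    sub_dotProduct, dotProduct_sub, smul_dotProduct, dotProduct_smul, smul_eq_mul,
    RCLike.star_def, Complex.conj_ofReal, Complex.sub_re, Complex.re_ofReal_mul]
  rw [← h]; ring

lemma quadForm_vecMulVec_star (b x : ι → ℂ) :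
    quadForm (Matrix.vecMulVec b (star b)) x = ‖star b ⬝ᵥ x‖ ^ 2 := by
  have h := star_dotProduct_comm x b
  have h2 : (Matrix.vecMulVec b (star b)) *ᵥ x = (star b ⬝ᵥ x) • b := by
    rw [Matrix.vecMulVec_mulVec]; ext i; simp [mul_comm]
  rw [quadForm, h2, dotProduct_smul, h, smul_eq_mul, RCLike.star_def, Complex.mul_conj',
    ← Complex.ofReal_pow, Complex.ofReal_re]

section Resolvent

variable [DecidableEq ι]

lemma inv_mulVec_mulVec {Q : Matrix ι ι ℂ} (hQ : Q.PosDef) (x : ι → ℂ) :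
    Q⁻¹ *ᵥ (Q *ᵥ x) = x := by
  rw [Matrix.mulVec_mulVec, Matrix.nonsing_inv_mul _ ((Matrix.isUnit_iff_isUnit_det _).1 hQ.isUnit),
    Matrix.one_mulVec]

lemma mulVec_inv_mulVec {Q : Matrix ι ι ℂ} (hQ : Q.PosDef) (x : ι → ℂ) :
    Q *ᵥ (Q⁻¹ *ᵥ x) = x := by
  rw [Matrix.mulVec_mulVec, Matrix.mul_nonsing_inv _ ((Matrix.isUnit_iff_isUnit_det _).1 hQ.isUnit),
    Matrix.one_mulVec]

lemma quadForm_inv {Q : Matrix ι ι ℂ} (hQ : Q.PosDef) (x : ι → ℂ) :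
    quadForm Q (Q⁻¹ *ᵥ x) = quadForm Q⁻¹ x := by
  rw [quadForm, mulVec_inv_mulVec hQ, quadForm, star_dotProduct_comm]
  simp

/-- The variational lower bound for the quadratic form of an inverse. -/
lemma le_quadForm_inv {Q : Matrix ι ι ℂ} (hQ : Q.PosDef) (x : ι → ℂ) (t : ℝ) :
    2 * t * sqNorm x - t ^ 2 * quadForm Q x ≤ quadForm Q⁻¹ x := by
  -- Expand the nonnegative `Q`-form of `Q⁻¹ x - t x`; the cross term collapses to `‖x‖²`.
  have h := quadForm_nonneg hQ.posSemidef (Q⁻¹ *ᵥ x - (t : ℂ) • x)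
  rw [quadForm_sub_smul hQ.isHermitian, quadForm_inv hQ,
    star_dotProduct_mulVec_comm hQ.isHermitian, mulVec_inv_mulVec hQ, star_dotProduct_self] at h
  simp only [RCLike.star_def, Complex.conj_ofReal, Complex.ofReal_re] at h
  linarith

/-- Inversion reverses a scaled Loewner inequality. -/
lemma quadForm_inv_le {F G : Matrix ι ι ℂ} (hF : F.PosDef) (hG : G.PosDef) {s : ℝ} (hs : 0 < s)
    (h : ∀ x, s * quadForm F x ≤ quadForm G x) (x : ι → ℂ) :
    s * quadForm G⁻¹ x ≤ quadForm F⁻¹ x := by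
  -- Nonnegativity of the `F`-form of `F⁻¹ x - s G⁻¹ x`; its last term is at most `s² F(G⁻¹ x) ≤ s
  -- G(G⁻¹ x) = s G⁻¹(x)`.
  have h0 := quadForm_nonneg hF.posSemidef (F⁻¹ *ᵥ x - (s : ℂ) • (G⁻¹ *ᵥ x))
  rw [quadForm_sub_smul hF.isHermitian, quadForm_inv hF,
    star_dotProduct_mulVec_comm hF.isHermitian, mulVec_inv_mulVec hF] at h0
  have h1 := h (G⁻¹ *ᵥ x)
  rw [quadForm_inv hG] at h1
  have h2 : (star (star (G⁻¹ *ᵥ x) ⬝ᵥ x)).re = quadForm G⁻¹ x := by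
    rw [quadForm, star_dotProduct_comm x]
  rw [h2] at h0
  nlinarith

variable {C : Matrix ι ι ℂ} {σ : ℝ}

lemma quadForm_add_smul_one (C : Matrix ι ι ℂ) (σ : ℝ) (x : ι → ℂ) :
    quadForm (C + ((σ : ℂ) ^ 2) • 1) x = quadForm C x + σ ^ 2 * sqNorm x := by
  rw [quadForm_add, ← Complex.ofReal_pow, quadForm_ofReal_smul]
  congr 2
  rw [quadForm, Matrix.one_mulVec, star_dotProduct_self, Complex.ofReal_re]

lemma sqNorm_resolvent_mulVec_le (hC : C.PosSemidef) (hσ : 0 < σ) (x : ι → ℂ) :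
    σ ^ 2 * sqNorm ((C + ((σ : ℂ) ^ 2) • 1)⁻¹ *ᵥ x)
      ≤ quadForm (C + ((σ : ℂ) ^ 2) • 1)⁻¹ x := by
  rw [← quadForm_inv (posDef_add_smul_one hC hσ), quadForm_add_smul_one]
  linarith [quadForm_nonneg hC ((C + ((σ : ℂ) ^ 2) • 1)⁻¹ *ᵥ x)]

/-- The operator norm bound `σ⁻²`: combine `σ² ‖R x‖² ≤ x* R x` with Cauchy–Schwarz and cancel one
factor `‖R x‖`. -/
lemma sqNorm_resolvent_mulVec_le' (hC : C.PosSemidef) (hσ : 0 < σ) (x : ι → ℂ) :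
    sqNorm ((C + ((σ : ℂ) ^ 2) • 1)⁻¹ *ᵥ x) ≤ (σ⁻¹ ^ 2) ^ 2 * sqNorm x := by
  set R := (C + ((σ : ℂ) ^ 2) • 1)⁻¹
  have h1 := sqNorm_resolvent_mulVec_le hC hσ x
  have h2 : quadForm R x ^ 2 ≤ sqNorm x * sqNorm (R *ᵥ x) := by
    refine le_trans ?_ (norm_star_dotProduct_sq_le x (R *ᵥ x))
    rw [← sq_abs]
    exact pow_le_pow_left₀ (abs_nonneg _) (Complex.abs_re_le_norm _) 2
  have h3 := sqNorm_nonneg (R *ᵥ x)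
  have h4 := sqNorm_nonneg x
  have hs : 0 < σ ^ 2 := by positivity
  have h5 : (σ ^ 2 * sqNorm (R *ᵥ x)) ^ 2 ≤ sqNorm x * sqNorm (R *ᵥ x) :=
    le_trans (pow_le_pow_left₀ (by positivity) h1 2) h2
  rcases h3.eq_or_lt with h0 | h0
  · rw [← h0]; positivity
  · have : (σ ^ 2) ^ 2 * sqNorm (R *ᵥ x) ≤ sqNorm x := by
      refine le_of_mul_le_mul_right ?_ h0
      calc _ = (σ ^ 2 * sqNorm (R *ᵥ x)) ^ 2 := by ring
        _ ≤ _ := h5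
    rw [inv_pow, inv_pow, inv_mul_eq_div, le_div_iff₀ (by positivity)]
    linarith

/-- The Sherman–Morrison formula, applied to the perturbing vector. -/
lemma inv_add_rankOne_mulVec {Q : Matrix ι ι ℂ} (hQ : Q.PosDef) {t : ℝ} (ht : 0 ≤ t)
    (b : ι → ℂ) :
    (Q + (t : ℂ) • Matrix.vecMulVec b (star b))⁻¹ *ᵥ b
      = (1 + (t : ℂ) * (star b ⬝ᵥ (Q⁻¹ *ᵥ b)))⁻¹ • (Q⁻¹ *ᵥ b) := by
  set Q' := Q + (t : ℂ) • Matrix.vecMulVec b (star b) with hQ'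
  have hPD : Q'.PosDef := hQ.add_posSemidef
    ((Matrix.posSemidef_vecMulVec_self_star b).smul (by exact_mod_cast ht))
  set q := star b ⬝ᵥ (Q⁻¹ *ᵥ b) with hq
  have hq0 : q = (quadForm Q⁻¹ b : ℂ) := (ofReal_quadForm hQ.inv.isHermitian b).symm
  have hne : 1 + (t : ℂ) * q ≠ 0 := by
    have := mul_nonneg ht (quadForm_nonneg hQ.inv.posSemidef b)
    rw [hq0]; exact_mod_cast (by linarith : (0 : ℝ) < 1 + t * quadForm Q⁻¹ b).ne'
  have h1 : Q' *ᵥ (Q⁻¹ *ᵥ b) = (1 + (t : ℂ) * q) • b := by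
    rw [hQ', Matrix.add_mulVec, mulVec_inv_mulVec hQ, Matrix.smul_mulVec,
      Matrix.vecMulVec_mulVec, ← hq]
    ext i; simp; ring
  have h2 : Q⁻¹ *ᵥ b = (1 + (t : ℂ) * q) • (Q'⁻¹ *ᵥ b) := by
    rw [← Matrix.mulVec_smul, ← h1, inv_mulVec_mulVec hPD]
  rw [h2, smul_smul, inv_mul_cancel₀ hne, one_smul]

/-- By `Q⁻¹ - Q'⁻¹ = Q'⁻¹ (Q' - Q) Q⁻¹` and Sherman–Morrison the difference has rank one, so its
partial traces are controlled by a single vector. -/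
lemma inv_sub_inv_add_rankOne {Q : Matrix ι ι ℂ} (hQ : Q.PosDef) {t : ℝ} (ht : 0 ≤ t)
    (b : ι → ℂ) :
    Q⁻¹ - (Q + (t : ℂ) • Matrix.vecMulVec b (star b))⁻¹
      = ((t : ℂ) * (1 + (t : ℂ) * (star b ⬝ᵥ (Q⁻¹ *ᵥ b)))⁻¹) •
        Matrix.vecMulVec (Q⁻¹ *ᵥ b) (star (Q⁻¹ *ᵥ b)) := by
  set Q' := Q + (t : ℂ) • Matrix.vecMulVec b (star b) with hQ'
  have hPD : Q'.PosDef := hQ.add_posSemidef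
    ((Matrix.posSemidef_vecMulVec_self_star b).smul (by exact_mod_cast ht))
  have hU := (Matrix.isUnit_iff_isUnit_det _).1 hQ.isUnit
  have hU' := (Matrix.isUnit_iff_isUnit_det _).1 hPD.isUnit
  have h1 : Q⁻¹ - Q'⁻¹ = Q'⁻¹ * (Q' - Q) * Q⁻¹ := by
    rw [mul_sub, sub_mul, Matrix.nonsing_inv_mul _ hU', one_mul, mul_assoc,
      Matrix.mul_nonsing_inv _ hU, mul_one]
  have h2 : Q' - Q = (t : ℂ) • Matrix.vecMulVec b (star b) := by rw [hQ']; abel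
  rw [h1, h2, Matrix.mul_smul, Matrix.smul_mul, Matrix.mul_vecMulVec, Matrix.vecMulVec_mul,
    inv_add_rankOne_mulVec hQ ht, Matrix.star_mulVec, hQ.inv.isHermitian.eq,
    Matrix.smul_vecMulVec, smul_smul]

end Resolvent

end LinearAlgebra

/-! ### The exact trace equation and deterministic bounds for the resolvent. -/

section Model

variable {L N K : ℕ}

/-- `N⁻¹ ∑ⱼ βⱼ βⱼ*`. -/
noncomputable def totalMatrix (a : Fin K → Fin L → ℂ) (s : Fin N → Fin K → ℂ) :
    Matrix (Fin L × Fin N) (Fin L × Fin N) ℂ :=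
  (N : ℂ)⁻¹ • ∑ j, Matrix.vecMulVec (stack (a j) (fun i => s i j))
    (star (stack (a j) (fun i => s i j)))

/-- The `L × L` matrix of the normalized traces of the blocks of `M`. -/
noncomputable def blockTrace (M : Matrix (Fin L × Fin N) (Fin L × Fin N) ℂ) :
    Matrix (Fin L) (Fin L) ℂ :=
  Matrix.of fun l l' => (N : ℂ)⁻¹ * ∑ i, M (l, i) (l', i)

/-- The matrix with entries `userForm σ a s k l l'`. -/
noncomputable def userMatrix (σ : ℝ) (a : Fin K → Fin L → ℂ) (s : Fin N → Fin K → ℂ) (k : Fin K) :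
    Matrix (Fin L) (Fin L) ℂ :=
  Matrix.of fun l l' => userForm σ a s k l l'

lemma interference_eq_sum_erase (a : Fin K → Fin L → ℂ) (s : Fin N → Fin K → ℂ) (k : Fin K) :
    interference a s k = (N : ℂ)⁻¹ • ∑ j ∈ Finset.univ.erase k,
      Matrix.vecMulVec (stack (a j) (fun i => s i j)) (star (stack (a j) (fun i => s i j))) := by
  rw [interference, Finset.sum_erase_eq_sub (Finset.mem_univ k)]

lemma posSemidef_smul_sum_vecMulVec (S : Finset (Fin K)) (b : Fin K → Fin L × Fin N → ℂ) :
    ((N : ℂ)⁻¹ • ∑ j ∈ S, Matrix.vecMulVec (b j) (star (b j))).PosSemidef := by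
  refine (Matrix.posSemidef_sum S fun j _ => Matrix.posSemidef_vecMulVec_self_star (b j)).smul ?_
  simp

lemma interference_posSemidef (a : Fin K → Fin L → ℂ) (s : Fin N → Fin K → ℂ) (k : Fin K) :
    (interference a s k).PosSemidef := by
  rw [interference_eq_sum_erase]; exact posSemidef_smul_sum_vecMulVec _ _

lemma totalMatrix_posSemidef (a : Fin K → Fin L → ℂ) (s : Fin N → Fin K → ℂ) :
    (totalMatrix a s).PosSemidef := posSemidef_smul_sum_vecMulVec _ _

lemma totalMatrix_add_smul_one (σ : ℝ) (a : Fin K → Fin L → ℂ) (s : Fin N → Fin K → ℂ)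
    (k : Fin K) :
    totalMatrix a s + ((σ : ℂ) ^ 2) • 1 = interference a s k + ((σ : ℂ) ^ 2) • 1 +
      (((N : ℝ)⁻¹ : ℝ) : ℂ) • Matrix.vecMulVec (stack (a k) (fun i => s i k))
        (star (stack (a k) (fun i => s i k))) := by
  rw [totalMatrix, interference, smul_sub, Complex.ofReal_inv, Complex.ofReal_natCast]
  abel

lemma star_stack_dotProduct_stack (a x : Fin L → ℂ) (v y : Fin N → ℂ) :
    star (stack a v) ⬝ᵥ stack x y = (star a ⬝ᵥ x) * (star v ⬝ᵥ y) := by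
  simp only [dotProduct, stack, Pi.star_apply, Fintype.sum_prod_type, Finset.sum_mul_sum,
    star_mul']
  exact Finset.sum_congr rfl fun _ _ => Finset.sum_congr rfl fun _ _ => by ring

lemma sqNorm_stack (x : Fin L → ℂ) (y : Fin N → ℂ) :
    sqNorm (stack x y) = sqNorm x * sqNorm y := by
  simp only [sqNorm, stack, Fintype.sum_prod_type, Finset.sum_mul_sum, norm_mul, mul_pow]

/-- The quadratic form of a stacked vector, through the blocks. -/
lemma star_stack_dotProduct_mulVec (M : Matrix (Fin L × Fin N) (Fin L × Fin N) ℂ)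
    (x z : Fin L → ℂ) (v : Fin N → ℂ) :
    star (stack x v) ⬝ᵥ (M *ᵥ stack z v) =
      ∑ l, ∑ l', star (x l) * (star v ⬝ᵥ (block M l l' *ᵥ v)) * z l' := by
  simp only [dotProduct, Matrix.mulVec, stack, block, Matrix.of_apply, Pi.star_apply,
    Fintype.sum_prod_type, star_mul', Finset.mul_sum, Finset.sum_mul]
  refine Finset.sum_congr rfl fun l _ => ?_
  rw [Finset.sum_comm]
  exact Finset.sum_congr rfl fun l' _ => Finset.sum_congr rfl fun i _ =>
    Finset.sum_congr rfl fun j _ => by ring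

/-- With `x = z = a k` this is the quantity in the Sherman–Morrison denominator for user `k`, which
is how `1 + α* A α` enters the limit equation. -/
lemma inv_mul_star_stack_resolvent (σ : ℝ) (a : Fin K → Fin L → ℂ) (s : Fin N → Fin K → ℂ)
    (k : Fin K) (x z : Fin L → ℂ) :
    (N : ℂ)⁻¹ * (star (stack x (fun i => s i k)) ⬝ᵥ
      ((interference a s k + ((σ : ℂ) ^ 2) • 1)⁻¹ *ᵥ stack z (fun i => s i k)))
      = star x ⬝ᵥ (userMatrix σ a s k *ᵥ z) := by
  rw [star_stack_dotProduct_mulVec]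
  simp only [dotProduct, Matrix.mulVec, userMatrix, userForm, Matrix.of_apply, Finset.mul_sum,
    Pi.star_apply, Finset.sum_mul]
  exact Finset.sum_congr rfl fun l _ => Finset.sum_congr rfl fun l' _ =>
    Finset.sum_congr rfl fun i _ => Finset.sum_congr rfl fun j _ => by ring

/-- Removing one user changes the normalized block traces of the resolvent by `O(1/N)`. -/
lemma norm_blockTrace_sub_le {σ : ℝ} (hσ : 0 < σ) (a : Fin K → Fin L → ℂ)
    (s : Fin N → Fin K → ℂ) (k : Fin K) (l l' : Fin L) :
    ‖blockTrace (interference a s k + ((σ : ℂ) ^ 2) • 1)⁻¹ l l'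
      - blockTrace (totalMatrix a s + ((σ : ℂ) ^ 2) • 1)⁻¹ l l'‖ ≤ (σ ^ 2)⁻¹ / N := by
  have hPD := posDef_add_smul_one (interference_posSemidef a s k) hσ
  set b := stack (a k) (fun i => s i k) with hb
  rw [totalMatrix_add_smul_one σ a s k, ← hb]
  set Q := interference a s k + ((σ : ℂ) ^ 2) • 1 with hQ
  set t : ℝ := (N : ℝ)⁻¹ with ht
  have ht0 : 0 ≤ t := by positivity
  set w := Q⁻¹ *ᵥ b with hw
  set q := quadForm Q⁻¹ b with hq
  have hq0 : 0 ≤ q := quadForm_nonneg hPD.inv.posSemidef b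
  have h := inv_sub_inv_add_rankOne hPD ht0 b
  rw [← ofReal_quadForm hPD.inv.isHermitian b, ← hq, ← hw] at h
  have hsum : blockTrace Q⁻¹ l l' -
      blockTrace (Q + (t : ℂ) • Matrix.vecMulVec b (star b))⁻¹ l l'
      = (t : ℂ) * ((t : ℂ) * (1 + (t : ℂ) * q)⁻¹) * ∑ i, w (l, i) * star (w (l', i)) := by
    have ht' : (N : ℂ)⁻¹ = (t : ℂ) := by simp [ht]
    simp only [blockTrace, Matrix.of_apply, ht']
    have hi : ∀ i, Q⁻¹ (l, i) (l', i)
        - (Q + (t : ℂ) • Matrix.vecMulVec b (star b))⁻¹ (l, i) (l', i)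
        = ((t : ℂ) * (1 + (t : ℂ) * q)⁻¹) * (w (l, i) * star (w (l', i))) := fun i => by
      rw [← Matrix.sub_apply, h]
      simp [Matrix.vecMulVec_apply]
    rw [← mul_sub, ← Finset.sum_sub_distrib, Finset.sum_congr rfl fun i _ => hi i,
      ← Finset.mul_sum, ← mul_assoc]
  have hpart : ∀ m : Fin L, ∑ i, ‖w (m, i)‖ ^ 2 ≤ sqNorm w := fun m => by
    rw [sqNorm, Fintype.sum_prod_type]
    exact Finset.single_le_sum (f := fun m => ∑ i, ‖w (m, i)‖ ^ 2)
      (fun _ _ => by positivity) (Finset.mem_univ m)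
  have h1 : ‖∑ i, w (l, i) * star (w (l', i))‖ ≤ sqNorm w := by
    refine (norm_sum_le _ _).trans ?_
    have : ∀ i, ‖w (l, i) * star (w (l', i))‖ ≤ (‖w (l, i)‖ ^ 2 + ‖w (l', i)‖ ^ 2) / 2 := by
      intro i
      rw [norm_mul, norm_star]
      nlinarith [sq_nonneg (‖w (l, i)‖ - ‖w (l', i)‖)]
    refine (Finset.sum_le_sum fun i _ => this i).trans ?_
    rw [← Finset.sum_div, Finset.sum_add_distrib]
    linarith [hpart l, hpart l']
  have h2 : sqNorm w ≤ (σ ^ 2)⁻¹ * q := by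
    have := sqNorm_resolvent_mulVec_le (interference_posSemidef a s k) hσ b
    rw [inv_mul_eq_div, le_div_iff₀ (by positivity)]
    linarith
  have h3 : (0 : ℝ) < 1 + t * q := by positivity
  have h4 : ‖(1 + (t : ℂ) * q)⁻¹‖ = (1 + t * q)⁻¹ := by
    rw [norm_inv]
    congr 1
    rw [← Complex.ofReal_mul, ← Complex.ofReal_one, ← Complex.ofReal_add, Complex.norm_real,
      Real.norm_of_nonneg h3.le]
  rw [hsum, norm_mul, norm_mul, norm_mul, h4, Complex.norm_real, Real.norm_of_nonneg ht0]
  -- The size of `b` enters only through `tq / (1 + tq) ≤ 1`, so the bound is uniform in gains and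
  -- columns; the factor `t = 1/N` left over is that of the normalized trace.
  calc t * (t * (1 + t * q)⁻¹) * ‖∑ i, w (l, i) * star (w (l', i))‖
      ≤ t * (t * (1 + t * q)⁻¹) * ((σ ^ 2)⁻¹ * q) := by
        gcongr; exact h1.trans h2
    _ = t * (σ ^ 2)⁻¹ * ((t * q) * (1 + t * q)⁻¹) := by ring
    _ ≤ t * (σ ^ 2)⁻¹ * 1 := by
        gcongr
        rw [← div_eq_mul_inv, div_le_one h3]; linarith
    _ = (σ ^ 2)⁻¹ / N := by rw [ht]; ring

/-- The exact equation satisfied by the normalized block traces of the resolvent. -/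
lemma blockTrace_resolvent_identity {σ : ℝ} (hσ : 0 < σ) (hN : 0 < N) (a : Fin K → Fin L → ℂ)
    (s : Fin N → Fin K → ℂ) (l l' : Fin L) :
    (σ : ℂ) ^ 2 * blockTrace (totalMatrix a s + ((σ : ℂ) ^ 2) • 1)⁻¹ l l'
      + (N : ℂ)⁻¹ * ∑ k, (userMatrix σ a s k *ᵥ a k) l * star (a k l') /
          (1 + star (a k) ⬝ᵥ (userMatrix σ a s k *ᵥ a k)) = (1 : Matrix (Fin L) (Fin L) ℂ) l l' := by
  have hN' : (N : ℂ) ≠ 0 := by exact_mod_cast hN.ne'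
  set Q := totalMatrix a s + ((σ : ℂ) ^ 2) • 1 with hQ
  have hPD : Q.PosDef := posDef_add_smul_one (totalMatrix_posSemidef a s) hσ
  have hU := (Matrix.isUnit_iff_isUnit_det _).1 hPD.isUnit
  -- The diagonal entries of block `(l, l')` of `Q⁻¹ Q = 1`, to be averaged over `i`.
  have h1 : ∀ i, (σ : ℂ) ^ 2 * Q⁻¹ (l, i) (l', i) + (N : ℂ)⁻¹ * ∑ k,
      (Q⁻¹ *ᵥ stack (a k) (fun i => s i k)) (l, i) * star (a k l' * s i k)
      = (1 : Matrix (Fin L) (Fin L) ℂ) l l' := by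
    intro i
    have h := congrFun (congrFun (Matrix.nonsing_inv_mul _ hU) (l, i)) (l', i)
    rw [hQ, mul_add, ← hQ, totalMatrix, Matrix.mul_smul, Matrix.mul_smul, mul_one,
      Finset.mul_sum] at h
    simp only [Matrix.add_apply, Matrix.smul_apply, Matrix.sum_apply, Matrix.mul_vecMulVec,
      Matrix.vecMulVec_apply, smul_eq_mul, Pi.star_apply, stack] at h
    rw [add_comm, h]
    simp [Matrix.one_apply]
  -- Sherman–Morrison trades the full resolvent for the one without user `k`, at the price of the
  -- denominator.
  have h2 : ∀ k, Q⁻¹ *ᵥ stack (a k) (fun i => s i k) =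
      (1 + star (a k) ⬝ᵥ (userMatrix σ a s k *ᵥ a k))⁻¹ •
        ((interference a s k + ((σ : ℂ) ^ 2) • 1)⁻¹ *ᵥ stack (a k) (fun i => s i k)) := by
    intro k
    rw [hQ, totalMatrix_add_smul_one σ a s k,
      inv_add_rankOne_mulVec (posDef_add_smul_one (interference_posSemidef a s k) hσ)
        (by positivity), ← inv_mul_star_stack_resolvent]
    simp
  have h3 : ∀ k, (N : ℂ)⁻¹ * ∑ i, ((interference a s k + ((σ : ℂ) ^ 2) • 1)⁻¹ *ᵥ
      stack (a k) (fun i => s i k)) (l, i) * star (s i k) = (userMatrix σ a s k *ᵥ a k) l := by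
    intro k
    have h := inv_mul_star_stack_resolvent σ a s k (Pi.single l 1) (a k)
    have h' : star (Pi.single l 1 : Fin L → ℂ) = Pi.single l 1 := by
      ext m; by_cases hm : m = l <;> simp [hm]
    rw [h', single_one_dotProduct] at h
    rw [← h]
    congr 1
    simp only [dotProduct, Fintype.sum_prod_type, Pi.star_apply, stack]
    rw [Finset.sum_eq_single l (fun m _ hm => by simp [hm]) (by simp)]
    simp [mul_comm]
  have h4 : ∑ i : Fin N, ((σ : ℂ) ^ 2 * Q⁻¹ (l, i) (l', i) + (N : ℂ)⁻¹ * ∑ k,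
      (Q⁻¹ *ᵥ stack (a k) (fun i => s i k)) (l, i) * star (a k l' * s i k))
      = N * (1 : Matrix (Fin L) (Fin L) ℂ) l l' := by
    rw [Finset.sum_congr rfl fun i _ => h1 i]; simp
  rw [Finset.sum_add_distrib, ← Finset.mul_sum, ← Finset.mul_sum, Finset.sum_comm] at h4
  have h5 : ∀ k, ∑ i, (Q⁻¹ *ᵥ stack (a k) (fun i => s i k)) (l, i) * star (a k l' * s i k)
      = N * ((userMatrix σ a s k *ᵥ a k) l * star (a k l') /
          (1 + star (a k) ⬝ᵥ (userMatrix σ a s k *ᵥ a k))) := by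
    intro k
    rw [← h3 k, h2 k, div_eq_mul_inv]
    simp only [Pi.smul_apply, smul_eq_mul, star_mul', Finset.mul_sum, Finset.sum_mul]
    refine Finset.sum_congr rfl fun i _ => ?_
    field_simp
  rw [Finset.sum_congr rfl fun k _ => h5 k, ← Finset.mul_sum] at h4
  simp only [blockTrace, Matrix.of_apply]
  field_simp
  field_simp at h4
  linear_combination h4

/-- Every entry of the resolvent is bounded by its operator norm. This provides the compactness used
to extract limit points. -/
lemma norm_blockTrace_resolvent_le {σ : ℝ} (hσ : 0 < σ) (a : Fin K → Fin L → ℂ)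
    (s : Fin N → Fin K → ℂ) (l l' : Fin L) :
    ‖blockTrace (totalMatrix a s + ((σ : ℂ) ^ 2) • 1)⁻¹ l l'‖ ≤ σ⁻¹ ^ 2 := by
  set R := (totalMatrix a s + ((σ : ℂ) ^ 2) • 1)⁻¹ with hR
  have h : ∀ p q, ‖R p q‖ ≤ σ⁻¹ ^ 2 := by
    intro p q
    have h1 := sqNorm_resolvent_mulVec_le' (totalMatrix_posSemidef a s) hσ (Pi.single q 1)
    have h2 := (sq_norm_apply_le_sqNorm _ p).trans h1
    have h3 : sqNorm (Pi.single q 1 : Fin L × Fin N → ℂ) = 1 := by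
      simp [sqNorm, Pi.single_apply, apply_ite]
    rw [h3, mul_one, ← hR, Matrix.mulVec_single_one] at h2
    exact le_of_sq_le_sq h2 (by positivity)
  simp only [blockTrace, Matrix.of_apply, norm_mul, norm_inv, Complex.norm_natCast]
  rcases Nat.eq_zero_or_pos N with h0 | h0
  · subst h0; simp; positivity
  · rw [inv_mul_le_iff₀ (by exact_mod_cast h0)]
    refine (norm_sum_le _ _).trans ?_
    refine (Finset.sum_le_sum fun i _ => h _ _).trans ?_
    simp

open scoped MatrixOrder in
/-- Bessel's inequality for the trace of a positive semidefinite matrix. -/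
lemma sum_quadForm_le_trace {n r : ℕ} {M : Matrix (Fin n) (Fin n) ℂ} (hM : M.PosSemidef)
    {y : Fin r → EuclideanSpace ℂ (Fin n)} (hy : Orthonormal ℂ y) :
    ∑ i, quadForm M (y i) ≤ M.trace.re := by
  -- With `M = B* B` both sides are sums over the rows of `B`, and Bessel's inequality applies to
  -- each row separately.
  obtain ⟨B, rfl⟩ := CStarAlgebra.nonneg_iff_eq_star_mul_self.mp hM.nonneg
  rw [Matrix.star_eq_conjTranspose]
  have h1 : ∀ i, quadForm (Bᴴ * B) (y i) = ∑ j, ‖inner ℂ (y i) (WithLp.toLp 2 (star (B j)))‖ ^ 2 := by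
    intro i
    rw [quadForm, ← Matrix.mulVec_mulVec, Matrix.dotProduct_mulVec, ← Matrix.star_mulVec,
      star_dotProduct_self, Complex.ofReal_re, sqNorm]
    refine Finset.sum_congr rfl fun j _ => ?_
    rw [EuclideanSpace.inner_eq_star_dotProduct, Matrix.mulVec, ← norm_star (star (B j) ⬝ᵥ _),
      ← Matrix.star_dotProduct_star, star_star, star_star, dotProduct_comm]
  have h2 : (Bᴴ * B).trace.re = ∑ j, ‖(WithLp.toLp 2 (star (B j)) : EuclideanSpace ℂ (Fin n))‖ ^ 2 := by
    rw [Matrix.trace_mul_comm, Matrix.trace, Complex.re_sum]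
    refine Finset.sum_congr rfl fun j _ => ?_
    rw [EuclideanSpace.norm_sq_eq, Matrix.diag_apply, Matrix.mul_apply, Complex.re_sum]
    refine Finset.sum_congr rfl fun i _ => ?_
    simp only [Matrix.conjTranspose_apply, Pi.star_apply, norm_star]
    rw [RCLike.star_def, Complex.mul_conj', ← Complex.ofReal_pow, Complex.ofReal_re]
  rw [h2, Finset.sum_congr rfl fun i _ => h1 i, Finset.sum_comm]
  exact Finset.sum_le_sum fun j _ => hy.sum_inner_products_le _

/-- The matrix `y ↦ x ⊗ y`. -/
def stackMatrix (N : ℕ) (x : Fin L → ℂ) : Matrix (Fin L × Fin N) (Fin N) ℂ :=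
  Matrix.of fun p j => if p.2 = j then x p.1 else 0

lemma stackMatrix_mulVec (x : Fin L → ℂ) (y : Fin N → ℂ) :
    stackMatrix N x *ᵥ y = stack x y := by
  ext p; simp [stackMatrix, Matrix.mulVec, dotProduct, stack]

lemma quadForm_conjTranspose_mul_mul (M : Matrix (Fin L × Fin N) (Fin L × Fin N) ℂ)
    (x : Fin L → ℂ) (y : Fin N → ℂ) :
    quadForm ((stackMatrix N x)ᴴ * M * stackMatrix N x) y = quadForm M (stack x y) := by
  rw [quadForm, quadForm, ← stackMatrix_mulVec, ← Matrix.mulVec_mulVec, ← Matrix.mulVec_mulVec,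
    Matrix.dotProduct_mulVec, Matrix.star_mulVec]

/-- The form of `blockTrace M` at `x` is the normalized trace of `M` compressed to `x ⊗ ℂ^N`.
Positivity and lower bounds for `blockTrace M` are therefore read off the compression. -/
lemma trace_conjTranspose_mul_mul (hN : 0 < N) (M : Matrix (Fin L × Fin N) (Fin L × Fin N) ℂ)
    (x : Fin L → ℂ) :
    ((stackMatrix N x)ᴴ * M * stackMatrix N x).trace = N * (star x ⬝ᵥ (blockTrace M *ᵥ x)) := by
  have hN' : (N : ℂ) ≠ 0 := by exact_mod_cast hN.ne'
  have h : ∀ i, ((stackMatrix N x)ᴴ * M * stackMatrix N x) i i =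
      ∑ l, ∑ l', star (x l) * M (l, i) (l', i) * x l' := fun i => by
    simp only [Matrix.mul_apply, stackMatrix, Matrix.conjTranspose_apply, Matrix.of_apply,
      Fintype.sum_prod_type, apply_ite star, star_zero, ite_mul, zero_mul, mul_ite, mul_zero,
      Finset.sum_ite_eq', Finset.mem_univ, if_true, Finset.sum_mul]
    exact Finset.sum_comm
  simp only [Matrix.trace, Matrix.diag_apply, h, dotProduct, Matrix.mulVec, blockTrace,
    Matrix.of_apply, Pi.star_apply, Finset.mul_sum, Finset.sum_mul]
  rw [Finset.sum_comm]
  refine Finset.sum_congr rfl fun l _ => ?_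
  rw [Finset.sum_comm]
  refine Finset.sum_congr rfl fun l' _ => Finset.sum_congr rfl fun i _ => ?_
  field_simp

lemma blockTrace_posSemidef (hN : 0 < N) {M : Matrix (Fin L × Fin N) (Fin L × Fin N) ℂ}
    (hM : M.PosSemidef) : (blockTrace M).PosSemidef := by
  refine posSemidef_of_quadForm ?_ fun x => ?_
  · ext l l'
    have h : ∀ p q, star (M p q) = M q p := fun p q => hM.isHermitian.apply q p
    simp only [Matrix.conjTranspose_apply, blockTrace, Matrix.of_apply, star_mul', star_sum, h]
    simp
  · have h := (Complex.le_def.1 (hM.conjTranspose_mul_mul_same (stackMatrix N x)).trace_nonneg).1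
    rw [trace_conjTranspose_mul_mul hN, ← Complex.ofReal_natCast, Complex.re_ofReal_mul] at h
    exact nonneg_of_mul_nonneg_right h (by exact_mod_cast hN)

/-- The normalized block traces of the resolvent are bounded below, if all but at most `N / 2` of
the gains are bounded. -/
lemma sqNorm_div_le_quadForm_blockTrace {σ B m : ℝ} (hσ : 0 < σ) (hB : 0 ≤ B) (hm : 0 ≤ m)
    (hN : 0 < N) (a : Fin K → Fin L → ℂ) (s : Fin N → Fin K → ℂ)
    (hs : ∀ k, sqNorm (fun i => s i k) ≤ B * N)
    (ha : 2 * (Finset.univ.filter fun k => m < sqNorm (a k)).card ≤ N) (x : Fin L → ℂ) :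
    sqNorm x / (4 * (σ ^ 2 + m * B * (K / N)))
      ≤ quadForm (blockTrace (totalMatrix a s + ((σ : ℂ) ^ 2) • 1)⁻¹) x := by
  classical
  set Q := totalMatrix a s + ((σ : ℂ) ^ 2) • 1 with hQ
  have hPD : Q.PosDef := posDef_add_smul_one (totalMatrix_posSemidef a s) hσ
  have hN' : (0 : ℝ) < N := by exact_mod_cast hN
  set bad := Finset.univ.filter fun k => m < sqNorm (a k) with hbad
  let col : Fin K → EuclideanSpace ℂ (Fin N) := fun k => WithLp.toLp 2 fun i => s i k
  -- Test vectors `x ⊗ y` with `y` orthogonal to the columns of the users with large gain do not see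
  -- these users, however large their gains. The orthogonal complement still has dimension `r ≥ N /
  -- 2`.
  let U : Submodule ℂ (EuclideanSpace ℂ (Fin N)) :=
    Submodule.span ℂ ((bad.image col : Finset _) : Set (EuclideanSpace ℂ (Fin N)))
  set r := Module.finrank ℂ Uᗮ with hr
  let e := stdOrthonormalBasis ℂ Uᗮ
  let y : Fin r → EuclideanSpace ℂ (Fin N) := fun i => (e i : EuclideanSpace ℂ (Fin N))
  have hy : Orthonormal ℂ y := e.orthonormal.comp_linearIsometry Uᗮ.subtypeₗᵢ
  have hr2 : (N : ℝ) / 2 ≤ r := by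
    have h1 := U.finrank_add_finrank_orthogonal
    rw [finrank_euclideanSpace_fin] at h1
    have h2 : Module.finrank ℂ U ≤ bad.card :=
      (finrank_span_finset_le_card _).trans Finset.card_image_le
    have h3 : N ≤ 2 * r := by omega
    have : (N : ℝ) ≤ 2 * r := by exact_mod_cast h3
    linarith
  have hbad0 : ∀ k ∈ bad, ∀ i, star (fun i => s i k) ⬝ᵥ (y i : Fin N → ℂ) = 0 := by
    intro k hk i
    have h1 : col k ∈ U := Submodule.subset_span (by
      simpa using ⟨k, hk, rfl⟩)
    have h2 := (Submodule.mem_orthogonal U _).1 (e i).2 (col k) h1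
    rw [EuclideanSpace.inner_eq_star_dotProduct, dotProduct_comm] at h2
    exact h2
  set q := σ ^ 2 + m * B * (K / N) with hq
  have hq0 : 0 < q := by positivity
  -- Parameter of the variational bound `le_quadForm_inv`, chosen to make `t q = 1/2`; the total is
  -- then at least `N t / 2 = N / (4 q)` times `‖x‖²`.
  set t := (2 * q)⁻¹ with ht
  have ht0 : 0 < t := by positivity
  have hysq : ∀ i, sqNorm (y i) = 1 := fun i => by
    rw [sqNorm_eq_norm_sq, WithLp.toLp_ofLp, hy.1 i, one_pow]
  have hform : ∀ i, quadForm Q (stack x (y i)) = (N : ℝ)⁻¹ *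
      ∑ k, ‖star (a k) ⬝ᵥ x‖ ^ 2 * ‖star (fun i => s i k) ⬝ᵥ (y i : Fin N → ℂ)‖ ^ 2
      + σ ^ 2 * sqNorm x := by
    intro i
    rw [hQ, quadForm_add_smul_one, sqNorm_stack, hysq, mul_one, totalMatrix,
      ← Complex.ofReal_natCast, ← Complex.ofReal_inv, quadForm_ofReal_smul]
    congr 2
    rw [quadForm, Matrix.sum_mulVec, dotProduct_sum, Complex.re_sum]
    refine Finset.sum_congr rfl fun k _ => ?_
    have := quadForm_vecMulVec_star (stack (a k) (fun i => s i k)) (stack x (y i))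
    rw [quadForm] at this
    rw [this, star_stack_dotProduct_stack, norm_mul, mul_pow]
  -- Each remaining user contributes at most `m ‖x‖² · B N` by Cauchy–Schwarz in the gains and
  -- Bessel in the columns.
  have hsum : ∑ i, quadForm Q (stack x (y i)) ≤ sqNorm x * (m * B * K + r * σ ^ 2) := by
    rw [Finset.sum_congr rfl fun i _ => hform i, Finset.sum_add_distrib, ← Finset.mul_sum,
      Finset.sum_comm]
    have h1 : ∀ k, ∑ i, ‖star (a k) ⬝ᵥ x‖ ^ 2 * ‖star (fun i => s i k) ⬝ᵥ (y i : Fin N → ℂ)‖ ^ 2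
        ≤ sqNorm x * (m * B * N) := by
      intro k
      by_cases hk : k ∈ bad
      · rw [Finset.sum_eq_zero fun i _ => by rw [hbad0 k hk i]; simp]
        have := sqNorm_nonneg x; positivity
      · have h2 : sqNorm (a k) ≤ m := by simpa [hbad] using hk
        have h3 := hy.sum_inner_products_le (col k) (s := Finset.univ)
        have h4 : ∀ i, ‖inner ℂ (y i) (col k)‖ = ‖star (fun i => s i k) ⬝ᵥ (y i : Fin N → ℂ)‖ := by
          intro i
          rw [norm_inner_symm, EuclideanSpace.inner_eq_star_dotProduct, dotProduct_comm]
        simp only [h4] at h3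
        have h5 : ‖col k‖ ^ 2 = sqNorm (fun i => s i k) := (sqNorm_eq_norm_sq _).symm
        rw [← Finset.mul_sum]
        calc _ ≤ (m * sqNorm x) * (B * N) := by
              refine mul_le_mul ?_ (h3.trans (h5.le.trans (hs k))) (by positivity)
                (mul_nonneg hm (sqNorm_nonneg x))
              exact (norm_star_dotProduct_sq_le _ _).trans
                (mul_le_mul_of_nonneg_right h2 (sqNorm_nonneg x))
          _ = _ := by ring
    have h2 := Finset.sum_le_sum fun k (_ : k ∈ Finset.univ) => h1 k
    simp only [Finset.sum_const, Finset.card_univ, Fintype.card_fin, nsmul_eq_mul] at h2 ⊢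
    have h3 := mul_le_mul_of_nonneg_left h2 (inv_nonneg.2 hN'.le)
    have h4 : (N : ℝ)⁻¹ * (K * (sqNorm x * (m * B * N))) = sqNorm x * (m * B * K) := by
      field_simp
    nlinarith
  have hlow : ∑ i, (2 * t * sqNorm (stack x (y i)) - t ^ 2 * quadForm Q (stack x (y i)))
      ≤ N * quadForm (blockTrace Q⁻¹) x := by
    refine (Finset.sum_le_sum fun i _ => le_quadForm_inv hPD (stack x (y i)) t).trans ?_
    have h1 := sum_quadForm_le_trace
      (hPD.inv.posSemidef.conjTranspose_mul_mul_same (stackMatrix N x)) hy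
    rw [trace_conjTranspose_mul_mul hN, ← Complex.ofReal_natCast, Complex.re_ofReal_mul] at h1
    simp only [quadForm_conjTranspose_mul_mul] at h1
    exact h1
  rw [Finset.sum_sub_distrib, ← Finset.mul_sum, ← Finset.mul_sum] at hlow
  simp only [sqNorm_stack, hysq, mul_one, Finset.sum_const, Finset.card_univ, Fintype.card_fin,
    nsmul_eq_mul] at hlow
  have hx0 := sqNorm_nonneg x
  have h6 : t * q = 1 / 2 := by rw [ht]; field_simp
  have h7 : t * σ ^ 2 ≤ 1 / 2 := by
    rw [← h6]; refine mul_le_mul_of_nonneg_left ?_ ht0.le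
    rw [hq]; linarith [show 0 ≤ m * B * ((K : ℝ) / N) by positivity]
  have h8 : m * B * K = (q - σ ^ 2) * N := by rw [hq]; field_simp; ring
  have h9 : N * (t / 2) ≤ 2 * t * r - t ^ 2 * (m * B * K + r * σ ^ 2) := by
    rw [h8]
    have e1 : 2 * t * r - t ^ 2 * ((q - σ ^ 2) * N + r * σ ^ 2)
        = t * (2 * r - (t * q) * N + (t * σ ^ 2) * (N - r)) := by ring
    rw [e1, h6]
    have h10 : 0 ≤ t * σ ^ 2 := by positivity
    have : (N : ℝ) * (1 / 2) ≤ 2 * r - 1 / 2 * N + t * σ ^ 2 * (N - r) := by nlinarith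
    nlinarith
  have h10 : N * (sqNorm x / (4 * q)) = sqNorm x * (N * (t / 2)) := by
    rw [ht]; field_simp; ring
  refine le_of_mul_le_mul_left ?_ hN'
  rw [h10]
  nlinarith [mul_le_mul_of_nonneg_left h9 hx0, mul_le_mul_of_nonneg_left hsum (sq_nonneg t)]

end Model

/-! ### The fixed point equation and uniqueness of its solution. -/

section FixedPointEquation

variable {L : ℕ}

/-- The sum of the absolute values of the entries. -/
noncomputable def entrySum (M : Matrix (Fin L) (Fin L) ℂ) : ℝ := ∑ l, ∑ l', ‖M l l'‖

lemma entrySum_nonneg (M : Matrix (Fin L) (Fin L) ℂ) : 0 ≤ entrySum M :=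
  Finset.sum_nonneg fun _ _ => Finset.sum_nonneg fun _ _ => norm_nonneg _

lemma norm_mul_norm_le_sqNorm (z : Fin L → ℂ) (l l' : Fin L) : ‖z l‖ * ‖z l'‖ ≤ sqNorm z := by
  nlinarith [sq_nonneg (‖z l‖ - ‖z l'‖), sq_norm_apply_le_sqNorm z l, sq_norm_apply_le_sqNorm z l']

lemma norm_mulVec_mul_norm_le (M : Matrix (Fin L) (Fin L) ℂ) (z : Fin L → ℂ) (l l' : Fin L) :
    ‖(M *ᵥ z) l‖ * ‖z l'‖ ≤ entrySum M * sqNorm z := by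
  have h1 : ‖(M *ᵥ z) l‖ ≤ ∑ m, ‖M l m‖ * ‖z m‖ := by
    rw [Matrix.mulVec, dotProduct]
    exact (norm_sum_le _ _).trans (Finset.sum_le_sum fun m _ => (norm_mul _ _).le)
  calc ‖(M *ᵥ z) l‖ * ‖z l'‖ ≤ (∑ m, ‖M l m‖ * ‖z m‖) * ‖z l'‖ := by gcongr
    _ = ∑ m, ‖M l m‖ * (‖z m‖ * ‖z l'‖) := by
        rw [Finset.sum_mul]; exact Finset.sum_congr rfl fun _ _ => by ring
    _ ≤ ∑ m, ‖M l m‖ * sqNorm z := by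
        gcongr; exact norm_mul_norm_le_sqNorm z _ _
    _ = (∑ m, ‖M l m‖) * sqNorm z := by rw [Finset.sum_mul]
    _ ≤ entrySum M * sqNorm z := by
        refine mul_le_mul_of_nonneg_right ?_ (sqNorm_nonneg z)
        exact Finset.single_le_sum (f := fun l => ∑ m, ‖M l m‖)
          (fun _ _ => Finset.sum_nonneg fun _ _ => norm_nonneg _) (Finset.mem_univ l)

lemma norm_star_dotProduct_mulVec_self_le (M : Matrix (Fin L) (Fin L) ℂ) (z : Fin L → ℂ) :
    ‖star z ⬝ᵥ (M *ᵥ z)‖ ≤ entrySum M * sqNorm z := by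
  simp only [dotProduct, Matrix.mulVec, entrySum, Finset.sum_mul, Finset.mul_sum]
  refine (norm_sum_le _ _).trans (Finset.sum_le_sum fun l _ => (norm_sum_le _ _).trans
    (Finset.sum_le_sum fun l' _ => ?_))
  rw [norm_mul, norm_mul, Pi.star_apply, norm_star]
  calc _ = ‖M l l'‖ * (‖z l‖ * ‖z l'‖) := by ring
    _ ≤ _ := by gcongr; exact norm_mul_norm_le_sqNorm z _ _

lemma quadForm_le (M : Matrix (Fin L) (Fin L) ℂ) (z : Fin L → ℂ) :
    quadForm M z ≤ entrySum M * sqNorm z :=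
  (Complex.re_le_norm _).trans (norm_star_dotProduct_mulVec_self_le M z)

/-- The variational bound for the inverse of `A⁻¹` at `t = 1/r`, where `r` dominates the form of
`A⁻¹`: the result is `2/r - 1/r = 1/r`. -/
lemma exists_le_quadForm {A : Matrix (Fin L) (Fin L) ℂ} (hA : A.PosDef) :
    ∃ δ > 0, ∀ x, δ * sqNorm x ≤ quadForm A x := by
  set r := entrySum A⁻¹ + 1 with hr
  have hr0 : 0 < r := by linarith [entrySum_nonneg A⁻¹]
  refine ⟨r⁻¹, by positivity, fun x => ?_⟩
  have h1 := le_quadForm_inv hA.inv x r⁻¹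
  rw [Matrix.nonsing_inv_nonsing_inv _ ((Matrix.isUnit_iff_isUnit_det _).1 hA.isUnit)] at h1
  have h2 : quadForm A⁻¹ x ≤ r * sqNorm x := (quadForm_le _ x).trans
    (mul_le_mul_of_nonneg_right (by linarith) (sqNorm_nonneg x))
  have h3 : r⁻¹ ^ 2 * quadForm A⁻¹ x ≤ r⁻¹ * sqNorm x := by
    calc _ ≤ r⁻¹ ^ 2 * (r * sqNorm x) := by gcongr
      _ = _ := by field_simp
  linarith

/-- The integrand of `expectedMatrix`. -/
noncomputable def gainKernel (A : Matrix (Fin L) (Fin L) ℂ) (l l' : Fin L) (z : Fin L → ℂ) : ℂ :=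
  z l * star (z l') / (1 + star z ⬝ᵥ (A *ᵥ z))

variable {A : Matrix (Fin L) (Fin L) ℂ}

lemma gainKernel_denom (hA : A.PosSemidef) (z : Fin L → ℂ) :
    1 + star z ⬝ᵥ (A *ᵥ z) = ((1 + quadForm A z : ℝ) : ℂ) := by
  rw [← ofReal_quadForm hA.isHermitian]; push_cast; rfl

lemma one_add_quadForm_pos (hA : A.PosSemidef) (z : Fin L → ℂ) : 0 < 1 + quadForm A z := by
  linarith [quadForm_nonneg hA z]

lemma continuous_gainKernel (hA : A.PosSemidef) (l l' : Fin L) :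
    Continuous (gainKernel A l l') := by
  unfold gainKernel
  refine Continuous.div (by fun_prop) ?_ fun z => ?_
  · simp only [dotProduct, Matrix.mulVec, Pi.star_apply]; fun_prop
  · rw [gainKernel_denom hA]; exact_mod_cast (one_add_quadForm_pos hA z).ne'

/-- The numerator is at most `‖z‖²` and the denominator at least `δ ‖z‖²`. Coercivity of `A` thus
replaces any moment condition on `H`. -/
lemma norm_gainKernel_le (hA : A.PosSemidef) {δ : ℝ} (hδ : 0 < δ)
    (h : ∀ x, δ * sqNorm x ≤ quadForm A x) (l l' : Fin L) (z : Fin L → ℂ) :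
    ‖gainKernel A l l' z‖ ≤ δ⁻¹ := by
  have hp := one_add_quadForm_pos hA z
  rw [gainKernel, gainKernel_denom hA, norm_div, norm_mul, norm_star, Complex.norm_real,
    Real.norm_of_nonneg hp.le, div_le_iff₀ hp, inv_mul_eq_div, le_div_iff₀ hδ]
  nlinarith [norm_mul_norm_le_sqNorm z l l', h z]

lemma integrable_gainKernel (hA : A.PosDef) (l l' : Fin L) (H : Measure (Fin L → ℂ))
    [IsFiniteMeasure H] : Integrable (gainKernel A l l') H := by
  obtain ⟨δ, hδ, h⟩ := exists_le_quadForm hA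
  exact Integrable.of_bound (continuous_gainKernel hA.posSemidef l l').aestronglyMeasurable δ⁻¹
    (ae_of_all _ (norm_gainKernel_le hA.posSemidef hδ h l l'))

variable {H : Measure (Fin L → ℂ)} [IsProbabilityMeasure H]

lemma sum_gainKernel (hA : A.PosSemidef) (x z : Fin L → ℂ) :
    ∑ l, ∑ l', star (x l) * gainKernel A l l' z * x l'
      = ((‖star z ⬝ᵥ x‖ ^ 2 / (1 + quadForm A z) : ℝ) : ℂ) := by
  have h1 : ((‖star z ⬝ᵥ x‖ ^ 2 : ℝ) : ℂ) = (star x ⬝ᵥ z) * (star z ⬝ᵥ x) := by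
    rw [star_dotProduct_comm x z, RCLike.star_def, Complex.conj_mul']; push_cast; rfl
  rw [Complex.ofReal_div, h1, ← gainKernel_denom hA]
  simp only [gainKernel, dotProduct, Pi.star_apply, Finset.sum_mul_sum, Finset.sum_div]
  refine Finset.sum_congr rfl fun l _ => Finset.sum_congr rfl fun l' _ => by ring

lemma integrable_quadForm_kernel (hA : A.PosDef) (x : Fin L → ℂ) :
    Integrable (fun z => ‖star z ⬝ᵥ x‖ ^ 2 / (1 + quadForm A z)) H := by
  have h : Integrable (fun z => ∑ l, ∑ l', star (x l) * gainKernel A l l' z * x l') H :=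
    integrable_finsetSum _ fun l _ => integrable_finsetSum _ fun l' _ =>
      ((integrable_gainKernel hA l l' H).const_mul _).mul_const _
  simp only [sum_gainKernel hA.posSemidef] at h
  have h' := h.re
  simp only [RCLike.re_eq_complex_re, Complex.ofReal_re] at h'
  exact h'

lemma quadForm_expectedMatrix (hA : A.PosDef) (x : Fin L → ℂ) :
    quadForm (expectedMatrix H A) x = ∫ z, ‖star z ⬝ᵥ x‖ ^ 2 / (1 + quadForm A z) ∂H := by
  have h : star x ⬝ᵥ (expectedMatrix H A *ᵥ x)
      = ∫ z, ((‖star z ⬝ᵥ x‖ ^ 2 / (1 + quadForm A z) : ℝ) : ℂ) ∂H := by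
    simp only [← sum_gainKernel hA.posSemidef]
    rw [integral_finsetSum _ fun l _ => integrable_finsetSum _ fun l' _ =>
      ((integrable_gainKernel hA l l' H).const_mul _).mul_const _]
    simp only [dotProduct, Matrix.mulVec, Finset.mul_sum, Pi.star_apply]
    refine Finset.sum_congr rfl fun l _ => ?_
    rw [integral_finsetSum _ fun l' _ =>
      ((integrable_gainKernel hA l l' H).const_mul _).mul_const _]
    refine Finset.sum_congr rfl fun l' _ => ?_
    rw [integral_mul_const, integral_const_mul, mul_assoc]
    rfl
  rw [quadForm, h, integral_complex_ofReal, Complex.ofReal_re]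

lemma expectedMatrix_posSemidef (hA : A.PosDef) : (expectedMatrix H A).PosSemidef := by
  refine posSemidef_of_quadForm ?_ fun x => ?_
  · ext l l'
    simp only [Matrix.conjTranspose_apply, expectedMatrix, Matrix.of_apply]
    rw [RCLike.star_def, ← integral_conj]
    refine integral_congr_ae (ae_of_all _ fun z => ?_)
    simp only [gainKernel_denom hA.posSemidef, map_div₀, map_mul, Complex.conj_ofReal,
      Complex.conj_conj]
    rw [mul_comm]
  · rw [quadForm_expectedMatrix hA]
    exact integral_nonneg fun z => div_nonneg (by positivity)
      (one_add_quadForm_pos hA.posSemidef z).le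

variable {c σ : ℝ}

lemma posDef_fixedPoint_rhs (hc : 0 ≤ c) (hσ : 0 < σ) (hA : A.PosDef) :
    ((c : ℂ) • expectedMatrix H A + ((σ : ℂ) ^ 2) • 1).PosDef :=
  posDef_add_smul_one ((expectedMatrix_posSemidef hA).smul (by exact_mod_cast hc)) hσ

lemma quadForm_fixedPoint_rhs (hA : A.PosDef) (x : Fin L → ℂ) :
    quadForm ((c : ℂ) • expectedMatrix H A + ((σ : ℂ) ^ 2) • 1) x =
      c * ∫ z, ‖star z ⬝ᵥ x‖ ^ 2 / (1 + quadForm A z) ∂H + σ ^ 2 * sqNorm x := by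
  rw [quadForm_add_smul_one, quadForm_ofReal_smul, quadForm_expectedMatrix hA]

/-- Take the least `t` with `B ≤ t A` and suppose `t > 1`. Since `1 + B(z) ≤ t (1 + A(z))`, the
expectation at `B` is at least `t⁻¹` times the one at `A`. The noise term `σ² I` is not divided by
`t`, so the right-hand sides satisfy `G ≥ ((1 + κ) / t) F` with some `κ > 0`. Inverting gives `B ≤
(t / (1 + κ)) A`, against minimality. -/
lemma quadForm_le_of_fixedPoint {B : Matrix (Fin L) (Fin L) ℂ} (hc : 0 ≤ c) (hσ : 0 < σ)
    (hA : A.PosDef) (hB : B.PosDef) (hfA : FixedPoint c σ H A) (hfB : FixedPoint c σ H B)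
    (x : Fin L → ℂ) : quadForm B x ≤ quadForm A x := by
  set F := (c : ℂ) • expectedMatrix H A + ((σ : ℂ) ^ 2) • 1 with hF
  set G := (c : ℂ) • expectedMatrix H B + ((σ : ℂ) ^ 2) • 1 with hG
  have hFP : F.PosDef := posDef_fixedPoint_rhs hc hσ hA
  have hGP : G.PosDef := posDef_fixedPoint_rhs hc hσ hB
  have hA' : A = F⁻¹ := hfA
  have hB' : B = G⁻¹ := hfB
  obtain ⟨δ, hδ, hδA⟩ := exists_le_quadForm hA
  set S : Set ℝ := {t | 0 ≤ t ∧ ∀ x, quadForm B x ≤ t * quadForm A x} with hS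
  have hne : S.Nonempty := by
    refine ⟨entrySum B / δ, div_nonneg (entrySum_nonneg B) hδ.le, fun x => ?_⟩
    refine (quadForm_le B x).trans ?_
    rw [div_mul_eq_mul_div, le_div_iff₀ hδ, mul_assoc]
    exact mul_le_mul_of_nonneg_left (by linarith [hδA x]) (entrySum_nonneg B)
  have hbdd : BddBelow S := ⟨0, fun t ht => ht.1⟩
  have hcl : IsClosed S := by
    rw [hS]
    have h : {t : ℝ | 0 ≤ t ∧ ∀ x, quadForm B x ≤ t * quadForm A x}
        = Set.Ici 0 ∩ ⋂ x, {t | quadForm B x ≤ t * quadForm A x} := by ext t; simp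
    rw [h]
    exact isClosed_Ici.inter
      (isClosed_iInter fun x => isClosed_le continuous_const (by fun_prop))
  set t := sInf S with ht
  have htS : t ∈ S := hcl.csInf_mem hne hbdd
  by_contra! hcon
  have hxA := quadForm_nonneg hA.posSemidef x
  have ht1 : 1 < t := by
    by_contra! h
    nlinarith [htS.2 x]
  -- Chosen so that `κ F ≤ (t - 1) σ² I`, which is the surplus contributed by the noise term.
  set κ := (t - 1) * σ ^ 2 / (entrySum F + 1) with hκ
  have hF0 := entrySum_nonneg F
  have hκ0 : 0 < κ := by
    have : 0 < t - 1 := by linarith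
    positivity
  have hGF : ∀ x, (1 + κ) / t * quadForm F x ≤ quadForm G x := by
    intro x
    have h1 : t⁻¹ * ∫ z, ‖star z ⬝ᵥ x‖ ^ 2 / (1 + quadForm A z) ∂H
        ≤ ∫ z, ‖star z ⬝ᵥ x‖ ^ 2 / (1 + quadForm B z) ∂H := by
      rw [← integral_const_mul]
      refine integral_mono ((integrable_quadForm_kernel hA x).const_mul _)
        (integrable_quadForm_kernel hB x) fun z => ?_
      have hp := one_add_quadForm_pos hA.posSemidef z
      have hp' := one_add_quadForm_pos hB.posSemidef z
      have h2 : 1 + quadForm B z ≤ t * (1 + quadForm A z) := by linarith [htS.2 z]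
      simp only
      rw [inv_mul_eq_div, div_div, mul_comm _ t]
      exact div_le_div_of_nonneg_left (by positivity) hp' h2
    have h2 : κ * quadForm F x ≤ (t - 1) * (σ ^ 2 * sqNorm x) := by
      have h3 : quadForm F x ≤ (entrySum F + 1) * sqNorm x := (quadForm_le F x).trans
        (mul_le_mul_of_nonneg_right (by linarith) (sqNorm_nonneg x))
      calc _ ≤ κ * ((entrySum F + 1) * sqNorm x) := by gcongr
        _ = _ := by rw [hκ]; field_simp
    have h3 : quadForm F x = c * ∫ z, ‖star z ⬝ᵥ x‖ ^ 2 / (1 + quadForm A z) ∂H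
        + σ ^ 2 * sqNorm x := quadForm_fixedPoint_rhs hA x
    have h4 : quadForm G x = c * ∫ z, ‖star z ⬝ᵥ x‖ ^ 2 / (1 + quadForm B z) ∂H
        + σ ^ 2 * sqNorm x := quadForm_fixedPoint_rhs hB x
    have h5 := mul_le_mul_of_nonneg_left h1 hc
    rw [div_mul_eq_mul_div, div_le_iff₀ (by linarith)]
    have h6 := mul_le_mul_of_nonneg_left h5 (by linarith : 0 ≤ t)
    have h7 : t * (c * (t⁻¹ * ∫ z, ‖star z ⬝ᵥ x‖ ^ 2 / (1 + quadForm A z) ∂H))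
        = c * ∫ z, ‖star z ⬝ᵥ x‖ ^ 2 / (1 + quadForm A z) ∂H := by field_simp
    rw [h7] at h6
    rw [h4]
    linarith
  have hs : 0 < (1 + κ) / t := by positivity
  have hmem : t / (1 + κ) ∈ S := by
    refine ⟨by positivity, fun x => ?_⟩
    have h := quadForm_inv_le hFP hGP hs hGF x
    rw [← hA', ← hB', div_mul_eq_mul_div, div_le_iff₀ (by linarith)] at h
    rw [div_mul_eq_mul_div, le_div_iff₀ (by linarith)]
    linarith
  have h1 : t ≤ t / (1 + κ) := csInf_le hbdd hmem
  rw [le_div_iff₀ (by linarith)] at h1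
  nlinarith

open scoped MatrixOrder in
lemma eq_of_fixedPoint {B : Matrix (Fin L) (Fin L) ℂ} (hc : 0 ≤ c) (hσ : 0 < σ)
    (hA : A.PosDef) (hB : B.PosDef) (hfA : FixedPoint c σ H A) (hfB : FixedPoint c σ H B) :
    B = A := by
  have key : ∀ {A B : Matrix (Fin L) (Fin L) ℂ}, A.PosDef → B.PosDef →
      FixedPoint c σ H A → FixedPoint c σ H B → B ≤ A := by
    intro A B hA hB hfA hfB
    rw [Matrix.le_iff]
    refine posSemidef_of_quadForm (hA.isHermitian.sub hB.isHermitian) fun x => ?_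
    have h := quadForm_le_of_fixedPoint hc hσ hA hB hfA hfB x
    have : quadForm (A - B) x = quadForm A x - quadForm B x := by
      simp [quadForm, Matrix.sub_mulVec]
    linarith
  exact le_antisymm (key hA hB hfA hfB) (key hB hA hfB hfA)

end FixedPointEquation

/-! ### Limit points of the block traces solve the equation. -/

section DeterministicLimit

lemma integral_empiricalMeasure {E F : Type*} [MeasurableSpace E] [MeasurableSingletonClass E]
    [NormedAddCommGroup F] [NormedSpace ℝ F] [CompleteSpace F] {n : ℕ} (x : Fin n → E)
    (f : E → F) : ∫ z, f z ∂(empiricalMeasure x) = (n : ℝ)⁻¹ • ∑ k, f (x k) := by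
  have hint : ∀ k ∈ Finset.univ, Integrable f (Measure.dirac (x k)) := fun k _ =>
    integrable_dirac (by simp)
  rw [empiricalMeasure, integral_smul_measure, integral_finsetSum_measure hint]
  simp [integral_dirac]

variable {L : ℕ}

lemma WeaklyConverges.tendsto_integral_complex {μ : ℕ → Measure (Fin L → ℂ)}
    {H : Measure (Fin L → ℂ)} (h : WeaklyConverges μ H) [∀ n, IsFiniteMeasure (μ n)]
    [IsFiniteMeasure H] {f : (Fin L → ℂ) → ℂ} (hf : Continuous f) {C : ℝ}
    (hC : ∀ z, ‖f z‖ ≤ C) :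
    Tendsto (fun n => ∫ z, f z ∂(μ n)) atTop (𝓝 (∫ z, f z ∂H)) := by
  have hint : ∀ (ρ : Measure (Fin L → ℂ)) [IsFiniteMeasure ρ], Integrable f ρ := fun ρ _ =>
    Integrable.of_bound hf.aestronglyMeasurable C (ae_of_all _ hC)
  have hre := h (BoundedContinuousFunction.ofNormedAddCommGroup (fun z => (f z).re)
    (Complex.continuous_re.comp hf) C fun z => (Complex.abs_re_le_norm _).trans (hC z))
  have him := h (BoundedContinuousFunction.ofNormedAddCommGroup (fun z => (f z).im)
    (Complex.continuous_im.comp hf) C fun z => (Complex.abs_im_le_norm _).trans (hC z))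
  simp only [BoundedContinuousFunction.coe_ofNormedAddCommGroup] at hre him
  have key : ∀ (ρ : Measure (Fin L → ℂ)) [IsFiniteMeasure ρ],
      ∫ z, f z ∂ρ = ((∫ z, (f z).re ∂ρ : ℝ) : ℂ) + ((∫ z, (f z).im ∂ρ : ℝ) : ℂ) * Complex.I :=
    fun ρ _ => (integral_re_add_im (hint ρ)).symm
  rw [key H]
  simp only [key (μ _)]
  exact ((Complex.continuous_ofReal.tendsto _).comp hre).add
    (((Complex.continuous_ofReal.tendsto _).comp him).mul_const _)

instance isFiniteMeasure_empiricalMeasure {E : Type*} [MeasurableSpace E] {n : ℕ} (x : Fin n → E) :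
    IsFiniteMeasure (empiricalMeasure x) := by
  rcases Nat.eq_zero_or_pos n with h | h
  -- For `n = 0` the scalar `n⁻¹` is `∞`, but it multiplies the empty sum, so the measure is zero.
  · subst h; simp only [empiricalMeasure, Finset.univ_eq_empty, Finset.sum_empty, smul_zero]
    infer_instance
  · have : (n : ℝ≥0∞)⁻¹ ≠ ∞ := by simpa using h.ne'
    exact Measure.smul_finite _ this

/-- The matrix entries of `A α α* / (1 + α* A α)` depend on `A` uniformly continuously. -/
lemma norm_div_sub_div_le {A M : Matrix (Fin L) (Fin L) ℂ} (hA : A.PosSemidef) {δ S : ℝ}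
    (hδ : 0 < δ) (hδA : ∀ x, δ * sqNorm x ≤ quadForm A x) (hS : entrySum (M - A) ≤ S)
    (hSδ : S ≤ δ / 2) (l l' : Fin L) (z : Fin L → ℂ) :
    ‖(M *ᵥ z) l * star (z l') / (1 + star z ⬝ᵥ (M *ᵥ z))
      - (A *ᵥ z) l * star (z l') / (1 + star z ⬝ᵥ (A *ᵥ z))‖
      ≤ (2 / δ + 2 * entrySum A / δ ^ 2) * S := by
  have hS0 : 0 ≤ S := (entrySum_nonneg _).trans hS
  have hz := sqNorm_nonneg z
  set w := sqNorm z with hw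
  set n₁ := (M *ᵥ z) l * star (z l') with hn₁
  set n₂ := (A *ᵥ z) l * star (z l') with hn₂
  set d₁ := 1 + star z ⬝ᵥ (M *ᵥ z) with hd₁
  set d₂ := 1 + star z ⬝ᵥ (A *ᵥ z) with hd₂
  have hn : ‖n₁ - n₂‖ ≤ S * w := by
    rw [hn₁, hn₂, ← sub_mul, ← Pi.sub_apply, ← Matrix.sub_mulVec, norm_mul, norm_star]
    exact (norm_mulVec_mul_norm_le _ _ _ _).trans (by gcongr)
  have hd : ‖d₂ - d₁‖ ≤ S * w := by
    rw [norm_sub_rev, hd₁, hd₂, add_sub_add_left_eq_sub, ← dotProduct_sub, ← Matrix.sub_mulVec]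
    exact (norm_star_dotProduct_mulVec_self_le _ _).trans (by gcongr)
  have hn2 : ‖n₂‖ ≤ entrySum A * w := by
    rw [hn₂, norm_mul, norm_star]; exact norm_mulVec_mul_norm_le _ _ _ _
  have hd2 : 1 + δ * w ≤ ‖d₂‖ := by
    rw [hd₂, gainKernel_denom hA, Complex.norm_real,
      Real.norm_of_nonneg (one_add_quadForm_pos hA z).le]
    linarith [hδA z]
  -- A perturbation of size at most `δ / 2` leaves half of the coercivity, so both denominators grow
  -- like `‖z‖²` and absorb the numerators.
  have hd1 : 1 + δ / 2 * w ≤ ‖d₁‖ := by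
    have h1 : ‖d₂‖ ≤ ‖d₁‖ + ‖d₂ - d₁‖ := by
      have := norm_add_le d₁ (d₂ - d₁); simpa using this
    nlinarith [mul_le_mul_of_nonneg_right hSδ hz]
  have hd1p : 0 < ‖d₁‖ := by nlinarith
  have hd2p : 0 < ‖d₂‖ := by nlinarith
  have hA0 := entrySum_nonneg A
  clear_value n₁ n₂ d₁ d₂
  have e : n₁ / d₁ - n₂ / d₂ = (n₁ - n₂) / d₁ + n₂ * (d₂ - d₁) / (d₁ * d₂) := by
    have := norm_pos_iff.1 hd1p
    have := norm_pos_iff.1 hd2p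
    field_simp; ring
  have b1 : ‖(n₁ - n₂) / d₁‖ ≤ 2 / δ * S := by
    rw [norm_div, div_le_iff₀ hd1p]
    calc _ ≤ S * w := hn
      _ = 2 / δ * S * (δ / 2 * w) := by field_simp
      _ ≤ _ := by gcongr; linarith
  have b2 : ‖n₂ * (d₂ - d₁) / (d₁ * d₂)‖ ≤ 2 * entrySum A / δ ^ 2 * S := by
    rw [norm_div, norm_mul, norm_mul, div_le_iff₀ (by positivity)]
    calc _ ≤ (entrySum A * w) * (S * w) := by gcongr
      _ = 2 * entrySum A / δ ^ 2 * S * ((δ / 2 * w) * (δ * w)) := by field_simp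
      _ ≤ _ := by
          gcongr
          · linarith
          · linarith
  rw [e, add_mul]
  exact (norm_add_le _ _).trans (add_le_add b1 b2)

variable {K : ℕ → ℕ} {c σ : ℝ} {H : Measure (Fin L → ℂ)} [IsProbabilityMeasure H]

/-- Tightness of the empirical measures. The function `min 1 (‖z‖² / (m + 1))` is bounded and
continuous and dominates the indicator of large gains. Its `H`-integral falls below `1 / (2 (c +
1))` for some `m`. Since eventually `K ≤ (c + 1) N`, at most `N / 2` users are exceptional. -/
lemma exists_eventually_card_le (hc : 0 ≤ c)
    (hK : Tendsto (fun N : ℕ => (K N : ℝ) / (N : ℝ)) atTop (𝓝 c))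
    {a : (N : ℕ) → Fin (K N) → Fin L → ℂ}
    (hw : WeaklyConverges (fun N => empiricalMeasure (a N)) H) :
    ∃ m : ℝ, 0 ≤ m ∧ ∀ᶠ N : ℕ in atTop,
      2 * (Finset.univ.filter fun k => m < sqNorm (a N k)).card ≤ N := by
  have hcont : Continuous (sqNorm : (Fin L → ℂ) → ℝ) := by unfold sqNorm; fun_prop
  let f : ℕ → (Fin L → ℂ) → ℝ := fun m z => min 1 (sqNorm z / (m + 1))
  have hf0 : ∀ m z, 0 ≤ f m z := fun m z =>
    le_min zero_le_one (div_nonneg (sqNorm_nonneg z) (by positivity))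
  have hf1 : ∀ m z, ‖f m z‖ ≤ 1 := fun m z => by
    rw [Real.norm_of_nonneg (hf0 m z)]; exact min_le_left _ _
  have hfc : ∀ m, Continuous (f m) := fun m => continuous_const.min (hcont.div_const _)
  have hlim : Tendsto (fun m => ∫ z, f m z ∂H) atTop (𝓝 (∫ _, (0 : ℝ) ∂H)) := by
    refine tendsto_integral_of_dominated_convergence (fun _ => 1)
      (fun m => (hfc m).aestronglyMeasurable) (integrable_const _)
      (fun m => ae_of_all _ (hf1 m)) (ae_of_all _ fun z => ?_)
    have h1 : Tendsto (fun m : ℕ => sqNorm z / ((m : ℝ) + 1)) atTop (𝓝 0) :=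
      tendsto_const_div_atTop_nhds_zero_nat (sqNorm z) |>.comp (tendsto_add_atTop_nat 1) |>.congr
        (by simp)
    have := (tendsto_const_nhds (x := (1 : ℝ))).min h1
    simpa using this
  rw [integral_zero] at hlim
  obtain ⟨m, hm⟩ := (hlim.eventually_lt_const
    (show (0 : ℝ) < (2 * (c + 1))⁻¹ by positivity)).exists
  refine ⟨m + 1, by positivity, ?_⟩
  have h1 := hw (BoundedContinuousFunction.ofNormedAddCommGroup (f m) (hfc m) 1 (hf1 m))
  simp only [BoundedContinuousFunction.coe_ofNormedAddCommGroup] at h1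
  filter_upwards [h1.eventually_lt_const hm, hK.eventually_lt_const (lt_add_one c),
    eventually_gt_atTop 0] with N h2 h3 hN
  have hN' : (0 : ℝ) < N := by exact_mod_cast hN
  rw [integral_empiricalMeasure, smul_eq_mul] at h2
  rw [div_lt_iff₀ hN'] at h3
  set bad := Finset.univ.filter fun k => (m : ℝ) + 1 < sqNorm (a N k) with hbad
  have h4 : (bad.card : ℝ) ≤ ∑ k, f m (a N k) := by
    rw [Finset.card_eq_sum_ones, Nat.cast_sum]
    refine (Finset.sum_le_sum fun k hk => ?_).trans
      (Finset.sum_le_sum_of_subset_of_nonneg (Finset.subset_univ bad) fun k _ _ => hf0 m _)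
    have h5 : (m : ℝ) + 1 < sqNorm (a N k) := by simpa [hbad] using hk
    simp only [f, Nat.cast_one, le_min_iff, le_refl, true_and]
    rw [le_div_iff₀ (by positivity)]; linarith
  rcases Nat.eq_zero_or_pos (K N) with h0 | h0
  · have : bad.card ≤ 0 := by
      refine (Finset.card_le_univ bad).trans ?_
      simp [h0]
    omega
  · have hKp : (0 : ℝ) < K N := by exact_mod_cast h0
    rw [inv_mul_lt_iff₀ hKp] at h2
    have h6 : (bad.card : ℝ) ≤ (c + 1) * N * (2 * (c + 1))⁻¹ :=
      h4.trans (h2.le.trans (by gcongr))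
    have h7 : (c + 1) * N * (2 * (c + 1))⁻¹ = (N : ℝ) / 2 := by field_simp
    have h8 : (2 * bad.card : ℝ) ≤ N := by linarith
    exact_mod_cast h8

/-- The normalized block traces of the resolvent. -/
noncomputable def traceMatrix (σ : ℝ) {N K : ℕ} (a : Fin K → Fin L → ℂ) (s : Fin N → Fin K → ℂ) :
    Matrix (Fin L) (Fin L) ℂ :=
  blockTrace (totalMatrix a s + ((σ : ℂ) ^ 2) • 1)⁻¹

/-- Along the subsequence all user matrices tend to `A` uniformly in `k`. Hence the sum in
`blockTrace_resolvent_identity` differs by `o(1)` from the one with `A`, which is `K/N` times an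
integral of a bounded continuous function against the empirical measure. -/
lemma fixedPoint_of_tendsto (hc : 0 ≤ c) (hσ : 0 < σ)
    (hK : Tendsto (fun N : ℕ => (K N : ℝ) / (N : ℝ)) atTop (𝓝 c))
    {a : (N : ℕ) → Fin (K N) → Fin L → ℂ} {s : (N : ℕ) → Fin N → Fin (K N) → ℂ}
    (hw : WeaklyConverges (fun N => empiricalMeasure (a N)) H) {B : ℝ} (hB : 0 ≤ B)
    (hs : ∀ᶠ N : ℕ in atTop, ∀ k, sqNorm (fun i => s N i k) ≤ B * N)
    (hclose : ∀ ε > 0, ∀ᶠ N : ℕ in atTop, ∀ k l l',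
      ‖userForm σ (a N) (s N) k l l' - traceMatrix σ (a N) (s N) l l'‖ ≤ ε)
    {n : ℕ → ℕ} (hn : Tendsto n atTop atTop) {A : Matrix (Fin L) (Fin L) ℂ}
    (hA : Tendsto (fun j => traceMatrix σ (a (n j)) (s (n j))) atTop (𝓝 A)) :
    A.PosDef ∧ FixedPoint c σ H A := by
  have hAe : ∀ l l', Tendsto (fun j => traceMatrix σ (a (n j)) (s (n j)) l l') atTop
      (𝓝 (A l l')) := fun l l' => by
    have := tendsto_pi_nhds.1 (tendsto_pi_nhds.1 hA l) l'
    exact this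
  obtain ⟨m, hm, hcard⟩ := exists_eventually_card_le hc hK hw
  have hKn := hK.comp hn
  set q := σ ^ 2 + m * B * (c + 1) with hq
  have hq0 : 0 < q := by positivity
  -- A coercivity bound uniform in `j`; it survives the limit and makes `A` positive definite.
  have hlow : ∀ᶠ j in atTop, ∀ x, (4 * q)⁻¹ * sqNorm x
      ≤ quadForm (traceMatrix σ (a (n j)) (s (n j))) x := by
    filter_upwards [hn.eventually hcard, hn.eventually hs, hn.eventually (eventually_gt_atTop 0),
      hKn.eventually_lt_const (lt_add_one c)] with j h1 h2 h3 h4 x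
    refine le_trans ?_ (sqNorm_div_le_quadForm_blockTrace hσ hB hm h3 (a (n j)) (s (n j)) h2 h1 x)
    rw [inv_mul_eq_div]
    refine div_le_div_of_nonneg_left (sqNorm_nonneg x) (by positivity) ?_
    have : m * B * ((K (n j) : ℝ) / (n j : ℝ)) ≤ m * B * (c + 1) := by
      gcongr; exact h4.le
    linarith
  have hq4 : 0 < (4 * q)⁻¹ := by positivity
  set δ := (4 * q)⁻¹ with hδ
  have hquad : ∀ x, Tendsto (fun j => quadForm (traceMatrix σ (a (n j)) (s (n j))) x) atTop
      (𝓝 (quadForm A x)) := fun x => by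
    unfold quadForm
    refine (Complex.continuous_re.tendsto _).comp ?_
    simp only [dotProduct, Matrix.mulVec]
    exact tendsto_finsetSum _ fun l _ => (tendsto_finsetSum _ fun l' _ =>
      (hAe l l').mul_const _).const_mul _
  have hδA : ∀ x, δ * sqNorm x ≤ quadForm A x := fun x =>
    ge_of_tendsto (hquad x) (hlow.mono fun j h => h x)
  have hAH : A.IsHermitian := by
    ext l l'
    have h1 := (continuous_star.tendsto _).comp (hAe l' l)
    refine tendsto_nhds_unique (h1.congr' ?_) (hAe l l')
    filter_upwards [hn.eventually (eventually_gt_atTop 0)] with j hj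
    exact (blockTrace_posSemidef hj
      (posDef_add_smul_one (totalMatrix_posSemidef _ _) hσ).inv.posSemidef).isHermitian.apply l l'
  have hPD : A.PosDef := posDef_of_quadForm hAH fun x hx =>
    (mul_pos hq4 (sqNorm_pos hx)).trans_le (hδA x)
  refine ⟨hPD, ?_⟩
  have hcloseA : ∀ ε > 0, ∀ᶠ j in atTop, ∀ k,
      entrySum (userMatrix σ (a (n j)) (s (n j)) k - A) ≤ ε := by
    intro ε hε
    -- There are `L²` entries, each off by at most `2 ε'`; the `+ 1` covers `L = 0`.
    set ε' := ε / (2 * ((L : ℝ) ^ 2 + 1)) with hε'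
    have hε0 : 0 < ε' := by positivity
    have h1 : ∀ᶠ j in atTop, ∀ l l', ‖traceMatrix σ (a (n j)) (s (n j)) l l' - A l l'‖ < ε' := by
      rw [eventually_all]; intro l; rw [eventually_all]; intro l'
      have := Metric.tendsto_nhds.1 (hAe l l') ε' hε0
      simpa [dist_eq_norm] using this
    filter_upwards [h1, hn.eventually (hclose ε' hε0)] with j h2 h3 k
    have h4 : ∀ l l', ‖(userMatrix σ (a (n j)) (s (n j)) k - A) l l'‖ ≤ 2 * ε' := by
      intro l l'
      rw [Matrix.sub_apply]
      have e := norm_sub_le_norm_sub_add_norm_sub (userMatrix σ (a (n j)) (s (n j)) k l l')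
        (traceMatrix σ (a (n j)) (s (n j)) l l') (A l l')
      have := h3 k l l'
      have := h2 l l'
      rw [userMatrix, Matrix.of_apply] at *
      linarith
    refine (Finset.sum_le_sum fun l _ => Finset.sum_le_sum fun l' _ => h4 l l').trans ?_
    simp only [Finset.sum_const, Finset.card_univ, Fintype.card_fin, nsmul_eq_mul]
    rw [hε']; field_simp
    nlinarith
  have hlimit : ∀ l l', Tendsto (fun j => ((n j : ℂ))⁻¹ * ∑ k,
      (userMatrix σ (a (n j)) (s (n j)) k *ᵥ a (n j) k) l * star (a (n j) k l') /
          (1 + star (a (n j) k) ⬝ᵥ (userMatrix σ (a (n j)) (s (n j)) k *ᵥ a (n j) k))) atTop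
      (𝓝 ((c : ℂ) * (A * expectedMatrix H A) l l')) := by
    intro l l'
    let h : (Fin L → ℂ) → ℂ := fun z => (A *ᵥ z) l * star (z l') / (1 + star z ⬝ᵥ (A *ᵥ z))
    have hh : h = fun z => ∑ p, A l p * gainKernel A p l' z := by
      funext z
      simp only [h, gainKernel, Matrix.mulVec, dotProduct, Finset.sum_mul, Finset.sum_div]
      exact Finset.sum_congr rfl fun p _ => by ring
    have hint : ∫ z, h z ∂H = (A * expectedMatrix H A) l l' := by
      rw [hh, integral_finsetSum _ fun p _ => (integrable_gainKernel hPD p l' H).const_mul _,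
        Matrix.mul_apply]
      exact Finset.sum_congr rfl fun p _ => integral_const_mul _ _
    have hcont : Continuous h := by
      rw [hh]
      exact continuous_finsetSum _ fun p _ =>
        (continuous_gainKernel hPD.posSemidef p l').const_mul _
    have hbound : ∀ z, ‖h z‖ ≤ ∑ p, ‖A l p‖ * δ⁻¹ := fun z => by
      rw [hh]
      refine (norm_sum_le _ _).trans (Finset.sum_le_sum fun p _ => ?_)
      rw [norm_mul]
      gcongr
      exact norm_gainKernel_le hPD.posSemidef hq4 hδA p l' z
    have hmain : Tendsto (fun j => ((n j : ℂ))⁻¹ * ∑ k, h (a (n j) k)) atTop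
        (𝓝 ((c : ℂ) * (A * expectedMatrix H A) l l')) := by
      have h1 := (hw.tendsto_integral_complex hcont hbound).comp hn
      have h2 := ((Complex.continuous_ofReal.tendsto _).comp hKn).mul h1
      rw [hint] at h2
      refine h2.congr fun j => ?_
      simp only [Function.comp_apply, integral_empiricalMeasure, Complex.real_smul,
        Complex.ofReal_div, Complex.ofReal_natCast, Complex.ofReal_inv]
      rcases Nat.eq_zero_or_pos (K (n j)) with h0 | h0
      · have : IsEmpty (Fin (K (n j))) := by rw [h0]; infer_instance
        simp [h0]
      · have : (K (n j) : ℂ) ≠ 0 := by exact_mod_cast h0.ne'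
        field_simp
    have hdiff : Tendsto (fun j => ((n j : ℂ))⁻¹ * ∑ k,
      (userMatrix σ (a (n j)) (s (n j)) k *ᵥ a (n j) k) l * star (a (n j) k l') /
          (1 + star (a (n j) k) ⬝ᵥ (userMatrix σ (a (n j)) (s (n j)) k *ᵥ a (n j) k))
          - ((n j : ℂ))⁻¹ * ∑ k, h (a (n j) k)) atTop (𝓝 0) := by
      rw [Metric.tendsto_nhds]
      intro ε hε
      set D := (2 / δ + 2 * entrySum A / δ ^ 2) with hD
      have hD0 : 0 < D := by have := entrySum_nonneg A; positivity
      -- The first bound is the hypothesis of `norm_div_sub_div_le`; the second makes at most `(c +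
      -- 1) N` errors `D S`, divided by `N`, sum to at most `ε / 2`.
      set S := min (δ / 2) (ε / (2 * (D * (c + 1)))) with hS
      have hS0 : 0 < S := lt_min (by positivity) (by positivity)
      filter_upwards [hcloseA S hS0, hKn.eventually_lt_const (lt_add_one c),
        hn.eventually (eventually_gt_atTop 0)] with j h1 h2 h3
      rw [dist_zero_right, ← mul_sub, ← Finset.sum_sub_distrib, norm_mul, norm_inv,
        Complex.norm_natCast]
      have hnj : (0 : ℝ) < n j := by exact_mod_cast h3
      have h4 : ∀ k, ‖(userMatrix σ (a (n j)) (s (n j)) k *ᵥ a (n j) k) l * star (a (n j) k l') /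
          (1 + star (a (n j) k) ⬝ᵥ (userMatrix σ (a (n j)) (s (n j)) k *ᵥ a (n j) k))
          - h (a (n j) k)‖ ≤ D * S := fun k =>
        norm_div_sub_div_le hPD.posSemidef hq4 hδA (h1 k) (min_le_left _ _) l l' (a (n j) k)
      have h5 := (norm_sum_le Finset.univ _).trans (Finset.sum_le_sum fun k _ => h4 k)
      simp only [Finset.sum_const, Finset.card_univ, Fintype.card_fin, nsmul_eq_mul] at h5
      simp only [Function.comp_apply] at h2
      calc _ ≤ (n j : ℝ)⁻¹ * (K (n j) * (D * S)) := by gcongr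
        _ = (K (n j) / n j : ℝ) * (D * S) := by ring
        _ ≤ (c + 1) * (D * (ε / (2 * (D * (c + 1))))) := by
            gcongr
            exact min_le_right _ _
        _ = ε / 2 := by field_simp
        _ < ε := by linarith
    simpa using hdiff.add hmain
  have heq : ∀ l l', (σ : ℂ) ^ 2 * A l l' + (c : ℂ) * (A * expectedMatrix H A) l l'
      = (1 : Matrix (Fin L) (Fin L) ℂ) l l' := by
    intro l l'
    refine tendsto_nhds_unique (((hAe l l').const_mul _).add (hlimit l l')) ?_
    refine tendsto_const_nhds.congr' ?_
    filter_upwards [hn.eventually (eventually_gt_atTop 0)] with j hj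
    exact (blockTrace_resolvent_identity hσ hj (a (n j)) (s (n j)) l l').symm
  have hmul : A * ((c : ℂ) • expectedMatrix H A + ((σ : ℂ) ^ 2) • 1) = 1 := by
    ext l l'
    rw [← heq l l', mul_add, Matrix.mul_smul, Matrix.mul_smul, mul_one, Matrix.add_apply,
      Matrix.smul_apply, Matrix.smul_apply, smul_eq_mul, smul_eq_mul, add_comm]
  exact (Matrix.inv_eq_left_inv hmul).symm

/-- Convergence of the normalized block traces to the solution of the fixed point equation. -/
theorem exists_tendsto_traceMatrix (hc : 0 ≤ c) (hσ : 0 < σ)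
    (hK : Tendsto (fun N : ℕ => (K N : ℝ) / (N : ℝ)) atTop (𝓝 c))
    {a : (N : ℕ) → Fin (K N) → Fin L → ℂ} {s : (N : ℕ) → Fin N → Fin (K N) → ℂ}
    (hw : WeaklyConverges (fun N => empiricalMeasure (a N)) H) {B : ℝ} (hB : 0 ≤ B)
    (hs : ∀ᶠ N : ℕ in atTop, ∀ k, sqNorm (fun i => s N i k) ≤ B * N)
    (hclose : ∀ ε > 0, ∀ᶠ N : ℕ in atTop, ∀ k l l',
      ‖userForm σ (a N) (s N) k l l' - traceMatrix σ (a N) (s N) l l'‖ ≤ ε) :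
    ∃ A : Matrix (Fin L) (Fin L) ℂ, A.PosDef ∧ FixedPoint c σ H A ∧
      Tendsto (fun N => traceMatrix σ (a N) (s N)) atTop (𝓝 A) := by
  set S : Set (Fin L → Fin L → ℂ) :=
    Set.univ.pi fun _ => Set.univ.pi fun _ => Metric.closedBall 0 (σ⁻¹ ^ 2) with hS
  have hcomp : IsCompact S := isCompact_univ_pi fun _ => isCompact_univ_pi fun _ =>
    isCompact_closedBall _ _
  let x : ℕ → Fin L → Fin L → ℂ := fun N l l' => traceMatrix σ (a N) (s N) l l'
  have hmem : ∀ N, x N ∈ S := fun N => by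
    rw [hS, Set.mem_univ_pi]; intro l; rw [Set.mem_univ_pi]; intro l'
    rw [mem_closedBall_zero_iff]
    exact norm_blockTrace_resolvent_le hσ (a N) (s N) l l'
  -- Every subsequence has a further subsequence tending to some positive definite solution, and
  -- uniqueness makes the limit always the same.
  have key : ∀ n : ℕ → ℕ, Tendsto n atTop atTop → ∃ A : Matrix (Fin L) (Fin L) ℂ, A.PosDef ∧
      FixedPoint c σ H A ∧ ∃ φ : ℕ → ℕ,
      Tendsto (fun j => traceMatrix σ (a (n (φ j))) (s (n (φ j)))) atTop (𝓝 A) := by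
    intro n hn
    obtain ⟨A, -, φ, hφ, hA⟩ := hcomp.tendsto_subseq (x := fun j => x (n j)) fun j => hmem _
    have h := fixedPoint_of_tendsto hc hσ hK hw hB hs hclose (hn.comp hφ.tendsto_atTop)
      (A := A) hA
    exact ⟨A, h.1, h.2, φ, hA⟩
  obtain ⟨A, hA, hfA, -⟩ := key id tendsto_id
  refine ⟨A, hA, hfA, tendsto_of_subseq_tendsto fun n hn => ?_⟩
  obtain ⟨A', hA', hfA', φ, hφ⟩ := key n hn
  rw [eq_of_fixedPoint hc hσ hA hA' hfA hfA'] at hφ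
  exact ⟨φ, hφ⟩

end DeterministicLimit

/-! ### Exponential concentration of quadratic forms by decoupling. -/

section Concentration

variable {Ω : Type*} [MeasurableSpace Ω] {P : Measure Ω}

lemma lintegral_of_indepFun [IsFiniteMeasure P] {α β : Type*} [MeasurableSpace α]
    [MeasurableSpace β] {X : Ω → α} {Y : Ω → β} (hX : Measurable X) (hY : Measurable Y)
    (h : IndepFun X Y P) {F : α × β → ℝ≥0∞} (hF : Measurable F) :
    ∫⁻ ω, F (X ω, Y ω) ∂P = ∫⁻ ω', ∫⁻ ω, F (X ω, Y ω') ∂P ∂P := by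
  rw [← lintegral_map hF (hX.prodMk hY),
    h.map_prod_eq_prod_map_map hX.aemeasurable hY.aemeasurable, lintegral_prod_symm' _ hF,
    lintegral_map hF.lintegral_prod_left' hY]
  refine lintegral_congr fun ω' => ?_
  exact lintegral_map (hF.comp (measurable_id.prodMk measurable_const)) hX

/-- Conditioning on `Y`: a bound that holds for every frozen value of `Y` holds for the random one.
It is used to treat first the gains and then the other columns as constants. -/
lemma measure_le_of_indepFun [IsProbabilityMeasure P] {α β : Type*} [MeasurableSpace α]
    [MeasurableSpace β] {X : Ω → α} {Y : Ω → β} (hX : Measurable X) (hY : Measurable Y)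
    (h : IndepFun X Y P) {S : Set (α × β)} (hS : MeasurableSet S) {C : ℝ≥0∞}
    (hC : ∀ ω', P {ω | (X ω, Y ω') ∈ S} ≤ C) : P {ω | (X ω, Y ω) ∈ S} ≤ C := by
  have h1 := lintegral_of_indepFun hX hY h (F := S.indicator 1) (measurable_one.indicator hS)
  have h2 : ∀ (f : Ω → α × β), Measurable f →
      ∫⁻ ω, S.indicator (1 : α × β → ℝ≥0∞) (f ω) ∂P = P {ω | f ω ∈ S} := fun f hf => by
    have : (fun ω => S.indicator (1 : α × β → ℝ≥0∞) (f ω)) = (f ⁻¹' S).indicator 1 := rfl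
    rw [this, lintegral_indicator_one (hf hS)]; rfl
  rw [h2 _ (hX.prodMk hY)] at h1
  rw [h1]
  calc _ ≤ ∫⁻ _, C ∂P := lintegral_mono fun ω' => by
        rw [h2 _ (hX.prodMk measurable_const)]; exact hC ω'
    _ = C := by simp

/-- Two complementary groups of independent random variables are independent. -/
lemma indepFun_ite {ι : Type*} [Fintype ι] [DecidableEq ι] {u : ι → Ω → ℂ}
    (hu : ∀ i, Measurable (u i)) (h : iIndepFun u P) (I : Finset ι) :
    IndepFun (fun ω i => if i ∈ I then u i ω else 0) (fun ω i => if i ∈ I then 0 else u i ω) P := by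
  have h1 := h.indepFun_finset I Iᶜ disjoint_compl_right hu
  let φ : (I → ℂ) → ι → ℂ := fun x i => if h : i ∈ I then x ⟨i, h⟩ else 0
  let ψ : ((Iᶜ : Finset ι) → ℂ) → ι → ℂ :=
    fun x i => if h : i ∈ I then 0 else x ⟨i, Finset.mem_compl.2 h⟩
  have hφ : Measurable φ := by
    refine measurable_pi_lambda _ fun i => ?_
    by_cases hi : i ∈ I <;> simp only [φ, hi, dite_true, dite_false] <;> fun_prop
  have hψ : Measurable ψ := by
    refine measurable_pi_lambda _ fun i => ?_
    by_cases hi : i ∈ I <;> simp only [ψ, hi, dite_true, dite_false] <;> fun_prop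
  have h2 := h1.comp hφ hψ
  convert h2 using 1
  · funext ω i; by_cases hi : i ∈ I <;> simp [φ, hi]
  · funext ω i; by_cases hi : i ∈ I <;> simp [ψ, hi]

variable {ι : Type*} [Fintype ι]

/-- The probability that two distinct fair coins show `true` and `false` in this order; the weight
factorizes over the index set. -/
lemma sum_prod_half_mul [DecidableEq ι] {i j : ι} (hij : i ≠ j) :
    ∑ f : ι → Bool, ((1 / 2 : ℝ) ^ Fintype.card ι) * (if f i = true ∧ f j = false then 1 else 0)
      = 1 / 4 := by
  let g : ι → Bool → ℝ := fun k b =>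
    if k = i then (if b = true then 1 / 2 else 0)
    else if k = j then (if b = false then 1 / 2 else 0) else 1 / 2
  have h1 : ∏ k, ∑ b ∈ (Finset.univ : Finset Bool), g k b = 1 / 4 := by
    rw [Finset.prod_eq_mul i j hij]
    · simp [g, hij.symm]; norm_num
    · intro k _ hk
      simp [g, hk.1, hk.2]
    · simp
    · simp
  rw [Finset.prod_univ_sum, Fintype.piFinset_univ] at h1
  rw [← h1]
  refine Finset.sum_congr rfl fun f _ => ?_
  split_ifs with hf
  · rw [mul_one, ← Finset.card_univ, ← Finset.prod_const]
    refine Finset.prod_congr rfl fun k _ => ?_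
    by_cases hki : k = i
    · subst hki; simp [g, hf.1]
    · by_cases hkj : k = j
      · subst hkj; simp [g, hki, hf.2]
      · simp [g, hki, hkj]
  · rw [mul_zero]
    symm
    rw [not_and_or] at hf
    rcases hf with hf | hf
    · exact Finset.prod_eq_zero (Finset.mem_univ i) (by simp [g, hf])
    · exact Finset.prod_eq_zero (Finset.mem_univ j) (by simp [g, hf, hij.symm])

/-- Decoupling: the off-diagonal part of a double sum is an average over ordered splittings of the
index set into two parts. -/
lemma offDiag_eq_average [DecidableEq ι] (q : ι → ι → ℝ) :
    ∑ i : ι, ∑ j : ι, (if i = j then 0 else q i j) =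
      ∑ f : ι → Bool, ((1 / 2 : ℝ) ^ Fintype.card ι) *
        (4 * ∑ i : ι, ∑ j : ι, if f i = true ∧ f j = false then q i j else 0) := by
  simp only [Finset.mul_sum]
  rw [Finset.sum_comm (s := (Finset.univ : Finset (ι → Bool)))]
  refine Finset.sum_congr rfl fun i _ => ?_
  rw [Finset.sum_comm (s := (Finset.univ : Finset (ι → Bool)))]
  refine Finset.sum_congr rfl fun j _ => ?_
  by_cases hij : i = j
  · subst hij
    symm
    simp only [if_true]
    refine Finset.sum_eq_zero fun f _ => ?_
    cases f i <;> simp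
  · rw [if_neg hij]
    have h := sum_prod_half_mul hij
    calc q i j = (4 * q i j) * (1 / 4) := by ring
      _ = _ := by
        rw [← h, Finset.mul_sum]
        refine Finset.sum_congr rfl fun f _ => ?_
        split_ifs <;> ring

/-- Jensen's inequality for `exp`, applied to the average in `offDiag_eq_average`. -/
lemma exp_offDiag_le [DecidableEq ι] (q : ι → ι → ℝ) (t : ℝ) :
    Real.exp (t * ∑ i, ∑ j, (if i = j then 0 else q i j)) ≤
      ∑ f : ι → Bool, ((1 / 2 : ℝ) ^ Fintype.card ι) *
        Real.exp (4 * t * ∑ i, ∑ j, if f i = true ∧ f j = false then q i j else 0) := by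
  have hw : ∑ _f : ι → Bool, ((1 / 2 : ℝ) ^ Fintype.card ι) = 1 := by
    simp [Finset.card_univ]
  have h := convexOn_exp.map_sum_le (t := Finset.univ)
    (w := fun _ : ι → Bool => (1 / 2 : ℝ) ^ Fintype.card ι)
    (p := fun f => 4 * t * ∑ i, ∑ j, if f i = true ∧ f j = false then q i j else 0)
    (fun _ _ => by positivity) hw (fun _ _ => Set.mem_univ _)
  simp only [smul_eq_mul] at h
  rw [offDiag_eq_average q, Finset.mul_sum]
  refine le_of_eq_of_le ?_ h
  congr 1
  exact Finset.sum_congr rfl fun f _ => by ring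

/-- A finite family of bounded independent centered complex random variables with common
variance `τ`. -/
structure IsBoundedCentered (u : ι → Ω → ℂ) (b τ : ℝ) (P : Measure Ω) : Prop where
  measurable : ∀ i, Measurable (u i)
  indep : iIndepFun u P
  bound : ∀ i ω, ‖u i ω‖ ≤ b
  mean : ∀ i, ∫ ω, u i ω ∂P = 0
  var : ∀ i, ∫ ω, ‖u i ω‖ ^ 2 ∂P = τ

variable {u : ι → Ω → ℂ} {b τ : ℝ} [IsProbabilityMeasure P]

/-- Each summand is centered with values in `[-b ‖w i‖, b ‖w i‖]`; Hoeffding's lemma and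
independence add the variance proxies `(b ‖w i‖)²`. -/
lemma IsBoundedCentered.mgf_linear_le (h : IsBoundedCentered u b τ P) (hb : 0 ≤ b)
    (w : ι → ℂ) (t : ℝ) :
    Integrable (fun ω => Real.exp (t * ∑ i, (star (u i ω) * w i).re)) P ∧
    ∫ ω, Real.exp (t * ∑ i, (star (u i ω) * w i).re) ∂P
      ≤ Real.exp (b ^ 2 * sqNorm w * t ^ 2 / 2) := by
  have hsub : ∀ i ∈ Finset.univ, HasSubgaussianMGF (fun ω => (star (u i ω) * w i).re)
      (Real.toNNReal (b * ‖w i‖) ^ 2) P := by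
    intro i _
    have hm : Measurable fun ω => (star (u i ω) * w i).re :=
      Complex.measurable_re.comp ((continuous_star.measurable.comp (h.measurable i)).mul_const _)
    have h1 := hasSubgaussianMGF_of_mem_Icc_of_integral_eq_zero (μ := P) (a := -(b * ‖w i‖))
      (b := b * ‖w i‖) hm.aemeasurable (ae_of_all _ fun ω => by
        rw [Set.mem_Icc, ← abs_le]
        refine (Complex.abs_re_le_norm _).trans ?_
        rw [norm_mul, norm_star]
        exact mul_le_mul_of_nonneg_right (h.bound i ω) (norm_nonneg _)) (by
        have h2 : ∫ ω, star (u i ω) * w i ∂P = 0 := by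
          rw [integral_mul_const, RCLike.star_def]
          have : ∫ ω, (starRingEnd ℂ) (u i ω) ∂P = 0 := by rw [integral_conj, h.mean i, map_zero]
          rw [this, zero_mul]
        have h3 : Integrable (fun ω => star (u i ω) * w i) P := by
          refine Integrable.mul_const ?_ _
          exact Integrable.of_bound (continuous_star.measurable.comp (h.measurable i)).aestronglyMeasurable b
            (ae_of_all _ fun ω => by rw [norm_star]; exact h.bound i ω)
        have := integral_re (𝕜 := ℂ) h3
        rw [h2] at this
        simpa using this)
    convert h1 using 2
    ext
    have hp := mul_nonneg hb (norm_nonneg (w i))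
    rw [Real.coe_toNNReal _ hp, NNReal.coe_div, coe_nnnorm,
      Real.norm_of_nonneg (by linarith), NNReal.coe_ofNat]
    ring
  have hind : iIndepFun (fun i ω => (star (u i ω) * w i).re) P :=
    h.indep.comp (fun i z => (star z * w i).re) fun i =>
      Complex.measurable_re.comp (continuous_star.measurable.mul_const _)
  have hs := HasSubgaussianMGF.sum_of_iIndepFun hind hsub
  refine ⟨hs.integrable_exp_mul t, (hs.mgf_le t).trans (le_of_eq ?_)⟩
  congr 3
  rw [NNReal.coe_sum, sqNorm, Finset.mul_sum]
  refine Finset.sum_congr rfl fun i _ => ?_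
  rw [NNReal.coe_pow, Real.coe_toNNReal _ (mul_nonneg hb (norm_nonneg (w i))), mul_pow]

variable [DecidableEq ι] {D : Matrix ι ι ℂ} {d : ℝ}

/-- For a fixed splitting, the variables in one part are independent of those in the other. Once the
second group is frozen, the form is linear in the first, with coefficient vector of squared norm at
most `d² b² n`. The linear bound at `4 t` gives the exponent `b² · d² b² n · (4 t)² / 2 = 8 t² b⁴ d²
n`, uniformly over splittings. -/
lemma IsBoundedCentered.lintegral_exp_offDiag_le (h : IsBoundedCentered u b τ P) (hb : 0 ≤ b)
    (hD : ∀ x, sqNorm (D *ᵥ x) ≤ d ^ 2 * sqNorm x) (t : ℝ) :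
    ∫⁻ ω, ENNReal.ofReal (Real.exp (t * ∑ i, ∑ j,
      (if i = j then 0 else (star (u i ω) * D i j * u j ω).re))) ∂P
      ≤ ENNReal.ofReal (Real.exp (8 * t ^ 2 * b ^ 4 * d ^ 2 * Fintype.card ι)) := by
  have hsplit : ∀ f : ι → Bool, ∫⁻ ω, ENNReal.ofReal (Real.exp (4 * t * ∑ i, ∑ j,
      if f i = true ∧ f j = false then (star (u i ω) * D i j * u j ω).re else 0)) ∂P
      ≤ ENNReal.ofReal (Real.exp (8 * t ^ 2 * b ^ 4 * d ^ 2 * Fintype.card ι)) := by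
    intro f
    set I : Finset ι := Finset.univ.filter fun i => f i = true with hI
    let X : Ω → ι → ℂ := fun ω i => if i ∈ I then u i ω else 0
    let Y : Ω → ι → ℂ := fun ω i => if i ∈ I then 0 else u i ω
    have hXm : Measurable X := measurable_pi_lambda _ fun i => by
      by_cases hi : i ∈ I <;> simp only [X, hi, if_true, if_false]
      exacts [h.measurable i, measurable_const]
    have hYm : Measurable Y := measurable_pi_lambda _ fun i => by
      by_cases hi : i ∈ I <;> simp only [Y, hi, if_true, if_false]
      exacts [measurable_const, h.measurable i]
    have hXY : IndepFun X Y P := indepFun_ite h.measurable h.indep I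
    let F : (ι → ℂ) × (ι → ℂ) → ℝ≥0∞ := fun p =>
      ENNReal.ofReal (Real.exp (4 * t * ∑ i, (star (p.1 i) * (D *ᵥ p.2) i).re))
    have hF : Measurable F := by
      refine ENNReal.measurable_ofReal.comp (Continuous.measurable ?_)
      simp only [Matrix.mulVec, dotProduct]
      fun_prop
    have hFX : ∀ ω, ENNReal.ofReal (Real.exp (4 * t * ∑ i, ∑ j,
        if f i = true ∧ f j = false then (star (u i ω) * D i j * u j ω).re else 0))
        = F (X ω, Y ω) := by
      intro ω
      simp only [F]
      congr 3
      refine Finset.sum_congr rfl fun i _ => ?_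
      rw [Matrix.mulVec, dotProduct, Finset.mul_sum, Complex.re_sum]
      refine Finset.sum_congr rfl fun j _ => ?_
      cases hi : f i <;> cases hj : f j <;> simp [X, Y, hI, hi, hj, mul_assoc]
    rw [lintegral_congr hFX, lintegral_of_indepFun hXm hYm hXY hF]
    have hin : ∀ ω', ∫⁻ ω, F (X ω, Y ω') ∂P
        ≤ ENNReal.ofReal (Real.exp (8 * t ^ 2 * b ^ 4 * d ^ 2 * Fintype.card ι)) := by
      intro ω'
      let w : ι → ℂ := fun i => if i ∈ I then (D *ᵥ Y ω') i else 0
      have hw : sqNorm w ≤ d ^ 2 * (b ^ 2 * Fintype.card ι) := by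
        calc sqNorm w ≤ sqNorm (D *ᵥ Y ω') := by
              refine Finset.sum_le_sum fun i _ => ?_
              by_cases hi : i ∈ I <;> simp only [w, hi, if_true, if_false]
              · exact le_rfl
              · rw [norm_zero, zero_pow two_ne_zero]; positivity
          _ ≤ d ^ 2 * sqNorm (Y ω') := hD _
          _ ≤ _ := by
              gcongr
              calc sqNorm (Y ω') ≤ ∑ _i : ι, b ^ 2 := by
                    refine Finset.sum_le_sum fun i _ => ?_
                    by_cases hi : i ∈ I <;> simp only [Y, hi, if_true, if_false]
                    · rw [norm_zero, zero_pow two_ne_zero]; positivity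
                    · exact pow_le_pow_left₀ (norm_nonneg _) (h.bound i ω') 2
                _ = _ := by simp [mul_comm]
      have h1 := h.mgf_linear_le hb w (4 * t)
      have h2 : ∀ ω, F (X ω, Y ω')
          = ENNReal.ofReal (Real.exp (4 * t * ∑ i, (star (u i ω) * w i).re)) := by
        intro ω
        simp only [F]
        congr 3
        refine Finset.sum_congr rfl fun i _ => ?_
        by_cases hi : i ∈ I <;> simp [X, w, hi]
      rw [lintegral_congr h2, ← ofReal_integral_eq_lintegral_ofReal h1.1
        (ae_of_all _ fun ω => (Real.exp_pos _).le)]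
      refine ENNReal.ofReal_le_ofReal (h1.2.trans (Real.exp_le_exp.2 ?_))
      have := mul_le_mul_of_nonneg_left hw (by positivity : 0 ≤ b ^ 2 * (4 * t) ^ 2 / 2)
      linarith
    calc _ ≤ ∫⁻ _, ENNReal.ofReal (Real.exp (8 * t ^ 2 * b ^ 4 * d ^ 2 * Fintype.card ι)) ∂P :=
          lintegral_mono hin
      _ = _ := by simp
  have hmeas : ∀ f : ι → Bool, Measurable fun ω => ENNReal.ofReal (Real.exp (4 * t * ∑ i, ∑ j,
      if f i = true ∧ f j = false then (star (u i ω) * D i j * u j ω).re else 0)) := by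
    intro f
    refine ENNReal.measurable_ofReal.comp (Real.measurable_exp.comp (Measurable.const_mul ?_ _))
    refine Finset.measurable_sum _ fun i _ => Finset.measurable_sum _ fun j _ => ?_
    split_ifs
    · exact Complex.measurable_re.comp
        (((continuous_star.measurable.comp (h.measurable i)).mul_const _).mul (h.measurable j))
    · exact measurable_const
  calc _ ≤ ∫⁻ ω, ∑ f : ι → Bool, ENNReal.ofReal ((1 / 2 : ℝ) ^ Fintype.card ι) *
        ENNReal.ofReal (Real.exp (4 * t * ∑ i, ∑ j,
          if f i = true ∧ f j = false then (star (u i ω) * D i j * u j ω).re else 0)) ∂P := by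
        refine lintegral_mono fun ω => ?_
        refine (ENNReal.ofReal_le_ofReal (exp_offDiag_le _ t)).trans (le_of_eq ?_)
        rw [ENNReal.ofReal_sum_of_nonneg fun f _ => by positivity]
        exact Finset.sum_congr rfl fun f _ => ENNReal.ofReal_mul (by positivity)
    _ = ∑ f : ι → Bool, ENNReal.ofReal ((1 / 2 : ℝ) ^ Fintype.card ι) *
        ∫⁻ ω, ENNReal.ofReal (Real.exp (4 * t * ∑ i, ∑ j,
          if f i = true ∧ f j = false then (star (u i ω) * D i j * u j ω).re else 0)) ∂P := by
        rw [lintegral_finsetSum _ fun f _ => (hmeas f).const_mul _]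
        exact Finset.sum_congr rfl fun f _ => lintegral_const_mul _ (hmeas f)
    _ ≤ ∑ f : ι → Bool, ENNReal.ofReal ((1 / 2 : ℝ) ^ Fintype.card ι) *
        ENNReal.ofReal (Real.exp (8 * t ^ 2 * b ^ 4 * d ^ 2 * Fintype.card ι)) := by
        gcongr with f _
        exact hsplit f
    _ = _ := by
        rw [← Finset.sum_mul, ← ENNReal.ofReal_sum_of_nonneg fun f _ => by positivity]
        simp [Finset.card_univ]

/-- Upper tail of the off-diagonal part of a quadratic form. -/
lemma IsBoundedCentered.measure_offDiag_ge_le (h : IsBoundedCentered u b τ P) (hb : 0 < b)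
    (hd : 0 < d) (hD : ∀ x, sqNorm (D *ᵥ x) ≤ d ^ 2 * sqNorm x) {ε : ℝ} (hε : 0 < ε) :
    P {ω | ε * Fintype.card ι ≤ ∑ i, ∑ j,
      (if i = j then 0 else (star (u i ω) * D i j * u j ω).re)}
      ≤ ENNReal.ofReal (Real.exp (-(ε ^ 2 / (32 * b ^ 4 * d ^ 2)) * Fintype.card ι)) := by
  -- The minimizer of the Chernoff exponent `8 t² b⁴ d² - t ε`.
  set t := ε / (16 * b ^ 4 * d ^ 2) with ht
  have ht0 : 0 < t := by positivity
  set n : ℝ := (Fintype.card ι : ℝ) with hn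
  have hmeas : Measurable fun ω => ENNReal.ofReal (Real.exp (t * ∑ i, ∑ j,
      (if i = j then 0 else (star (u i ω) * D i j * u j ω).re))) := by
    refine ENNReal.measurable_ofReal.comp (Real.measurable_exp.comp (Measurable.const_mul ?_ _))
    refine Finset.measurable_sum _ fun i _ => Finset.measurable_sum _ fun j _ => ?_
    split_ifs
    · exact measurable_const
    · exact Complex.measurable_re.comp
        (((continuous_star.measurable.comp (h.measurable i)).mul_const _).mul (h.measurable j))
  have h1 := mul_meas_ge_le_lintegral₀ (μ := P) hmeas.aemeasurable
    (ENNReal.ofReal (Real.exp (t * (ε * n))))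
  have h2 := h1.trans (h.lintegral_exp_offDiag_le hb.le hD t)
  have h3 : P {ω | ε * n ≤ ∑ i, ∑ j, (if i = j then 0 else (star (u i ω) * D i j * u j ω).re)}
      ≤ P {ω | ENNReal.ofReal (Real.exp (t * (ε * n))) ≤ ENNReal.ofReal (Real.exp (t * ∑ i, ∑ j,
      (if i = j then 0 else (star (u i ω) * D i j * u j ω).re)))} := by
    refine measure_mono fun ω hω => ?_
    refine ENNReal.ofReal_le_ofReal (Real.exp_le_exp.2 ?_)
    exact mul_le_mul_of_nonneg_left hω ht0.le
  have h4 := (mul_le_mul_right h3 (ENNReal.ofReal (Real.exp (t * (ε * n))))).trans h2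
  rw [mul_comm, ← ENNReal.le_div_iff_mul_le (Or.inl (by simp [Real.exp_pos]))
    (Or.inl ENNReal.ofReal_ne_top), ← ENNReal.ofReal_div_of_pos (Real.exp_pos _),
    ← Real.exp_sub] at h4
  refine h4.trans (le_of_eq ?_)
  congr 2
  rw [ht]
  field_simp
  ring

lemma norm_diag_le (hd : 0 ≤ d) (hD : ∀ x, sqNorm (D *ᵥ x) ≤ d ^ 2 * sqNorm x) (i j : ι) :
    ‖D i j‖ ≤ d := by
  have h := (sq_norm_apply_le_sqNorm _ i).trans (hD (Pi.single j 1))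
  have h3 : sqNorm (Pi.single j 1 : ι → ℂ) = 1 := by
    simp [sqNorm, Pi.single_apply, apply_ite]
  rw [h3, mul_one, Matrix.mulVec_single_one] at h
  exact le_of_sq_le_sq h hd

/-- Upper tail of the diagonal part of a quadratic form. -/
lemma IsBoundedCentered.measure_diag_ge_le (h : IsBoundedCentered u b τ P) (hb : 0 < b)
    (hd : 0 < d) (hD : ∀ x, sqNorm (D *ᵥ x) ≤ d ^ 2 * sqNorm x) {ε : ℝ} (hε : 0 < ε) :
    P {ω | ε * Fintype.card ι ≤ ∑ i, (D i i).re * (‖u i ω‖ ^ 2 - τ)}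
      ≤ ENNReal.ofReal (Real.exp (-(ε ^ 2 / (32 * b ^ 4 * d ^ 2)) * Fintype.card ι)) := by
  have hu2 : ∀ i ω, ‖u i ω‖ ^ 2 ≤ b ^ 2 := fun i ω =>
    pow_le_pow_left₀ (norm_nonneg _) (h.bound i ω) 2
  have hint : ∀ i, Integrable (fun ω => ‖u i ω‖ ^ 2) P := fun i =>
    Integrable.of_bound ((h.measurable i).norm.pow_const 2).aestronglyMeasurable (b ^ 2)
      (ae_of_all _ fun ω => by rw [Real.norm_of_nonneg (by positivity)]; exact hu2 i ω)
  have hsub : ∀ i ∈ Finset.univ, HasSubgaussianMGF (fun ω => (D i i).re * (‖u i ω‖ ^ 2 - τ))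
      (Real.toNNReal (d * b ^ 2) ^ 2) P := by
    intro i _
    have hτ0 : 0 ≤ τ := by rw [← h.var i]; exact integral_nonneg fun ω => by positivity
    have hτ1 : τ ≤ b ^ 2 := by
      rw [← h.var i]
      refine (integral_mono (hint i) (integrable_const _) (hu2 i)).trans ?_
      simp
    have hm : Measurable fun ω => (D i i).re * (‖u i ω‖ ^ 2 - τ) :=
      (((h.measurable i).norm.pow_const 2).sub_const τ).const_mul _
    have h1 := hasSubgaussianMGF_of_mem_Icc_of_integral_eq_zero (μ := P) (a := -(d * b ^ 2))
      (b := d * b ^ 2) hm.aemeasurable (ae_of_all _ fun ω => by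
        rw [Set.mem_Icc, ← abs_le, abs_mul]
        refine mul_le_mul ((Complex.abs_re_le_norm _).trans (norm_diag_le hd.le hD i i)) ?_
          (abs_nonneg _) hd.le
        rw [abs_le]
        constructor <;> linarith [hu2 i ω, sq_nonneg ‖u i ω‖]) (by
        rw [integral_const_mul, integral_sub (hint i) (integrable_const _), h.var i]
        simp)
    convert h1 using 2
    ext
    have hp := mul_nonneg hd.le (sq_nonneg b)
    rw [Real.coe_toNNReal _ hp, NNReal.coe_div, coe_nnnorm,
      Real.norm_of_nonneg (by linarith), NNReal.coe_ofNat]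
    ring
  have hind : iIndepFun (fun i ω => (D i i).re * (‖u i ω‖ ^ 2 - τ)) P :=
    h.indep.comp (fun i z => (D i i).re * (‖z‖ ^ 2 - τ)) fun i => by fun_prop
  have hs := HasSubgaussianMGF.measure_sum_ge_le_of_iIndepFun hind hsub
    (ε := ε * Fintype.card ι) (by positivity)
  rw [← ofReal_measureReal]
  refine ENNReal.ofReal_le_ofReal (hs.trans (Real.exp_le_exp.2 ?_))
  rw [NNReal.coe_sum]
  simp only [NNReal.coe_pow, Real.coe_toNNReal _ (mul_nonneg hd.le (sq_nonneg b)),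
    Finset.sum_const, Finset.card_univ, nsmul_eq_mul]
  rcases Nat.eq_zero_or_pos (Fintype.card ι) with h0 | h0
  · simp [h0]
  · have hn : (0 : ℝ) < Fintype.card ι := by exact_mod_cast h0
    -- Hoeffding gives the constant `2`; it is weakened to `32` to match the off-diagonal bound.
    have e : -(ε * (Fintype.card ι : ℝ)) ^ 2 / (2 * (Fintype.card ι * (d * b ^ 2) ^ 2))
        = -(ε ^ 2 / (2 * b ^ 4 * d ^ 2)) * Fintype.card ι := by field_simp
    rw [e]
    refine mul_le_mul_of_nonneg_right (neg_le_neg ?_) hn.le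
    exact div_le_div_of_nonneg_left (by positivity) (by positivity)
      (by nlinarith [show 0 < b ^ 4 * d ^ 2 by positivity])

lemma re_quadratic_eq (x : ι → ℂ) (D : Matrix ι ι ℂ) (τ : ℝ) :
    (star x ⬝ᵥ (D *ᵥ x) - τ * D.trace).re = ∑ i, (D i i).re * (‖x i‖ ^ 2 - τ)
      + ∑ i, ∑ j, (if i = j then 0 else (star (x i) * D i j * x j).re) := by
  have h1 : ∀ i, (D i i).re * (‖x i‖ ^ 2 - τ) + ∑ j, (if i = j then 0 else
      (star (x i) * D i j * x j).re) = (∑ j, star (x i) * D i j * x j - τ * D i i).re := by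
    intro i
    have h2 : (star (x i) * D i i * x i).re = (D i i).re * ‖x i‖ ^ 2 := by
      have : star (x i) * D i i * x i = ((‖x i‖ ^ 2 : ℝ) : ℂ) * D i i := by
        rw [Complex.ofReal_pow, ← Complex.conj_mul', RCLike.star_def]; ring
      rw [this, Complex.re_ofReal_mul, mul_comm]
    rw [Complex.sub_re, Complex.re_sum, Complex.re_ofReal_mul,
      ← Finset.add_sum_erase _ _ (Finset.mem_univ i),
      ← Finset.add_sum_erase Finset.univ (fun j => (star (x i) * D i j * x j).re)
        (Finset.mem_univ i), h2]
    have h3 : ∑ j ∈ Finset.univ.erase i, (if i = j then 0 else (star (x i) * D i j * x j).re)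
        = ∑ j ∈ Finset.univ.erase i, (star (x i) * D i j * x j).re :=
      Finset.sum_congr rfl fun j hj => if_neg (Finset.ne_of_mem_erase hj).symm
    rw [h3]
    simp only [if_true]
    ring
  rw [← Finset.sum_add_distrib, Finset.sum_congr rfl fun i _ => h1 i, ← Complex.re_sum,
    Finset.sum_sub_distrib]
  congr 2
  · simp only [dotProduct, Matrix.mulVec, Finset.mul_sum, Pi.star_apply]
    exact Finset.sum_congr rfl fun i _ => Finset.sum_congr rfl fun j _ => by ring
  · rw [Matrix.trace, Finset.mul_sum]; rfl

lemma IsBoundedCentered.measure_re_ge_le (h : IsBoundedCentered u b τ P) (hb : 0 < b)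
    (hd : 0 < d) (hD : ∀ x, sqNorm (D *ᵥ x) ≤ d ^ 2 * sqNorm x) {ε : ℝ} (hε : 0 < ε) :
    P {ω | 2 * ε * Fintype.card ι ≤
      (star (fun i => u i ω) ⬝ᵥ (D *ᵥ fun i => u i ω) - τ * D.trace).re}
      ≤ 2 * ENNReal.ofReal (Real.exp (-(ε ^ 2 / (32 * b ^ 4 * d ^ 2)) * Fintype.card ι)) := by
  rw [two_mul (ENNReal.ofReal _)]
  refine le_trans (measure_mono fun ω hω => ?_) ((measure_union_le _ _).trans
    (add_le_add (h.measure_diag_ge_le hb hd hD hε) (h.measure_offDiag_ge_le hb hd hD hε)))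
  simp only [Set.mem_ofPred_eq, Set.mem_union, re_quadratic_eq] at hω ⊢
  by_contra! hcon
  linarith [hcon.1, hcon.2]

/-- Exponential concentration of the quadratic form of a bounded centered random vector. -/
theorem IsBoundedCentered.measure_norm_quadratic_ge_le (h : IsBoundedCentered u b τ P)
    (hb : 0 < b) (hd : 0 < d) (hD : ∀ x, sqNorm (D *ᵥ x) ≤ d ^ 2 * sqNorm x) {ε : ℝ}
    (hε : 0 < ε) :
    P {ω | 4 * ε * Fintype.card ι ≤
      ‖star (fun i => u i ω) ⬝ᵥ (D *ᵥ fun i => u i ω) - τ * D.trace‖}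
      ≤ 8 * ENNReal.ofReal (Real.exp (-(ε ^ 2 / (32 * b ^ 4 * d ^ 2)) * Fintype.card ι)) := by
  -- The one-sided bound applied to `c D` for `c = ±1, ±i` controls real and imaginary parts from
  -- both sides; two terms for each of four directions give the factor `8`.
  have key : ∀ c : ℂ, ‖c‖ = 1 → P {ω | 2 * ε * Fintype.card ι ≤
      (c * (star (fun i => u i ω) ⬝ᵥ (D *ᵥ fun i => u i ω) - τ * D.trace)).re}
      ≤ 2 * ENNReal.ofReal (Real.exp (-(ε ^ 2 / (32 * b ^ 4 * d ^ 2)) * Fintype.card ι)) := by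
    intro c hc
    have h1 := h.measure_re_ge_le (D := c • D) hb hd
      (fun x => by rw [Matrix.smul_mulVec, sqNorm_smul, hc, one_pow, one_mul]; exact hD x) hε
    have h2 : ∀ x : ι → ℂ, star x ⬝ᵥ ((c • D) *ᵥ x) - τ * (c • D).trace
        = c * (star x ⬝ᵥ (D *ᵥ x) - τ * D.trace) := fun x => by
      rw [Matrix.smul_mulVec, dotProduct_smul, Matrix.trace_smul, smul_eq_mul, smul_eq_mul]; ring
    simpa only [h2] using h1
  have h8 : ∀ E : ℝ≥0∞, 8 * E = (2 * E + 2 * E) + (2 * E + 2 * E) := fun E => by ring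
  rw [h8]
  refine le_trans (measure_mono fun ω hω => ?_) ((measure_union_le _ _).trans (add_le_add
    ((measure_union_le _ _).trans (add_le_add (key 1 (by simp)) (key (-1) (by simp))))
    ((measure_union_le _ _).trans (add_le_add (key Complex.I (by simp))
      (key (-Complex.I) (by simp))))))
  simp only [Set.mem_ofPred_eq, Set.mem_union] at hω ⊢
  set z := star (fun i => u i ω) ⬝ᵥ (D *ᵥ fun i => u i ω) - τ * D.trace
  by_contra! hcon
  have h1 := Complex.norm_le_abs_re_add_abs_im z
  have hr := hcon.1.1
  have hr' := hcon.1.2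
  have hi := hcon.2.1
  have hi' := hcon.2.2
  simp only [one_mul, neg_mul, Complex.neg_re, Complex.I_mul_re] at hr hr' hi hi'
  have h2 : |z.re| < 2 * ε * Fintype.card ι := abs_lt.2 ⟨by linarith, hr⟩
  have h3 : |z.im| < 2 * ε * Fintype.card ι := abs_lt.2 ⟨by linarith, by linarith⟩
  linarith

end Concentration

/-! ### Moment conditions, size of the entries, and tails of the columns. -/

section Truncation

variable {Ω : Type*} [MeasurableSpace Ω] {P : Measure Ω} {ν : Measure ℂ}

/-- `|z|²` if `|z| > M`, and `0` otherwise. -/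
noncomputable def tailSq (M : ℝ) (z : ℂ) : ℝ := if M < ‖z‖ then ‖z‖ ^ 2 else 0

/-- `|z|²` if `M < |z| ≤ r`, and `0` otherwise. -/
noncomputable def windowSq (M r : ℝ) (z : ℂ) : ℝ := if M < ‖z‖ ∧ ‖z‖ ≤ r then ‖z‖ ^ 2 else 0

lemma tailSq_nonneg (M : ℝ) (z : ℂ) : 0 ≤ tailSq M z := by
  unfold tailSq; split_ifs <;> positivity

lemma windowSq_nonneg (M r : ℝ) (z : ℂ) : 0 ≤ windowSq M r z := by
  unfold windowSq; split_ifs <;> positivity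

lemma tailSq_le (M : ℝ) (z : ℂ) : tailSq M z ≤ ‖z‖ ^ 2 := by
  unfold tailSq; split_ifs; exacts [le_rfl, by positivity]

lemma windowSq_le_tailSq (M r : ℝ) (z : ℂ) : windowSq M r z ≤ tailSq M z := by
  unfold windowSq tailSq
  by_cases h : M < ‖z‖ <;> by_cases h' : ‖z‖ ≤ r <;> simp [h, h']

lemma windowSq_le (M : ℝ) (r : ℝ) (z : ℂ) : windowSq M r z ≤ r ^ 2 := by
  unfold windowSq
  split_ifs with h
  · exact pow_le_pow_left₀ (norm_nonneg _) h.2 2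
  · positivity

lemma measurable_tailSq (M : ℝ) : Measurable (tailSq M) :=
  Measurable.ite (measurableSet_lt measurable_const measurable_norm)
    (measurable_norm.pow_const 2) measurable_const

lemma measurable_windowSq (M r : ℝ) : Measurable (windowSq M r) :=
  Measurable.ite ((measurableSet_lt measurable_const measurable_norm).inter
    (measurableSet_le measurable_norm measurable_const))
    (measurable_norm.pow_const 2) measurable_const

lemma IsStandardized.integrable_sq (hν : IsStandardized ν) :
    Integrable (fun z : ℂ => ‖z‖ ^ 2) ν := hν.memLp_two.integrable_norm_pow two_ne_zero

lemma IsStandardized.integrable_tailSq (hν : IsStandardized ν) (M : ℝ) :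
    Integrable (tailSq M) ν :=
  hν.integrable_sq.mono' (measurable_tailSq M).aestronglyMeasurable (ae_of_all _ fun z => by
    rw [Real.norm_of_nonneg (tailSq_nonneg M z)]; exact tailSq_le M z)

lemma IsStandardized.exists_integral_tailSq_le (hν : IsStandardized ν) {ε : ℝ} (hε : 0 < ε) :
    ∃ M : ℝ, 1 ≤ M ∧ ∫ z, tailSq M z ∂ν ≤ ε := by
  have hlim : Tendsto (fun m : ℕ => ∫ z, tailSq m z ∂ν) atTop (𝓝 (∫ _, (0 : ℝ) ∂ν)) := by
    refine tendsto_integral_of_dominated_convergence (fun z => ‖z‖ ^ 2)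
      (fun m => (measurable_tailSq m).aestronglyMeasurable) hν.integrable_sq
      (fun m => ae_of_all _ fun z => by
        rw [Real.norm_of_nonneg (tailSq_nonneg m z)]; exact tailSq_le m z)
      (ae_of_all _ fun z => ?_)
    refine tendsto_const_nhds.congr' ?_
    filter_upwards [tendsto_natCast_atTop_atTop.eventually_ge_atTop ‖z‖] with m hm
    rw [tailSq, if_neg (not_lt.2 hm)]
  rw [integral_zero] at hlim
  obtain ⟨m, h1, h2⟩ := ((hlim.eventually_lt_const hε).and (eventually_ge_atTop 1)).exists
  exact ⟨m, by exact_mod_cast h2, h1.le⟩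

lemma exp_le_one_add_add_sq_mul {x : ℝ} (hx : 0 ≤ x) :
    Real.exp x ≤ 1 + x + x ^ 2 * Real.exp x := by
  have h1 : Real.exp x ≤ 1 + x * Real.exp x := by
    have h := Real.add_one_le_exp (-x)
    have h2 := mul_le_mul_of_nonneg_right h (Real.exp_pos x).le
    rw [← Real.exp_add, neg_add_cancel, Real.exp_zero] at h2
    linarith
  nlinarith

lemma integrable_exp_windowSq [IsFiniteMeasure ν] (M r t : ℝ) (ht : 0 ≤ t) :
    Integrable (fun z => Real.exp (t * windowSq M r z)) ν :=
  Integrable.of_bound (Real.measurable_exp.comp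
    ((measurable_windowSq M r).const_mul t)).aestronglyMeasurable (Real.exp (t * r ^ 2))
    (ae_of_all _ fun z => by
      rw [Real.norm_of_nonneg (Real.exp_pos _).le, Real.exp_le_exp]
      exact mul_le_mul_of_nonneg_left (windowSq_le M r z) ht)

/-- Apply `eˣ ≤ 1 + x + x² eˣ` at `x = t · windowSq`. The window caps the last exponential at `exp
(t r²)`, so a fourth moment suffices. -/
lemma integral_exp_windowSq_le (hν : IsStandardized ν)
    (h4 : Integrable (fun z : ℂ => ‖z‖ ^ 4) ν) (M r : ℝ) {t : ℝ} (ht : 0 ≤ t) :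
    ∫ z, Real.exp (t * windowSq M r z) ∂ν ≤ Real.exp (t * ∫ z, tailSq M z ∂ν
      + t ^ 2 * Real.exp (t * r ^ 2) * ∫ z, ‖z‖ ^ 4 ∂ν) := by
  have := hν.isProbabilityMeasure
  have hpt : ∀ z, Real.exp (t * windowSq M r z)
      ≤ 1 + (t * tailSq M z + t ^ 2 * Real.exp (t * r ^ 2) * ‖z‖ ^ 4) := by
    intro z
    have hw := windowSq_nonneg M r z
    have hwt := windowSq_le_tailSq M r z
    have h1 := exp_le_one_add_add_sq_mul (mul_nonneg ht hw)
    have h2 : (t * windowSq M r z) ^ 2 * Real.exp (t * windowSq M r z)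
        ≤ t ^ 2 * Real.exp (t * r ^ 2) * ‖z‖ ^ 4 := by
      calc _ = t ^ 2 * Real.exp (t * windowSq M r z) * windowSq M r z ^ 2 := by ring
        _ ≤ t ^ 2 * Real.exp (t * r ^ 2) * (‖z‖ ^ 2) ^ 2 := by
            gcongr
            · exact windowSq_le M r z
            · exact hwt.trans (tailSq_le M z)
        _ = _ := by ring
    have h3 := mul_le_mul_of_nonneg_left hwt ht
    linarith
  have hi : Integrable
      (fun z => t * tailSq M z + t ^ 2 * Real.exp (t * r ^ 2) * ‖z‖ ^ 4) ν :=
    ((hν.integrable_tailSq M).const_mul t).add (h4.const_mul (t ^ 2 * Real.exp (t * r ^ 2)))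
  refine (integral_mono (integrable_exp_windowSq M r t ht) ((integrable_const 1).add hi) hpt).trans
    ?_
  have e : ∫ z, 1 + (t * tailSq M z + t ^ 2 * Real.exp (t * r ^ 2) * ‖z‖ ^ 4) ∂ν
      = 1 + (t * ∫ z, tailSq M z ∂ν + t ^ 2 * Real.exp (t * r ^ 2) * ∫ z, ‖z‖ ^ 4 ∂ν) := by
    rw [integral_add (integrable_const 1) hi, integral_add ((hν.integrable_tailSq M).const_mul t)
      (h4.const_mul _), integral_const_mul, integral_const_mul]
    simp
  refine (le_of_eq e).trans ?_
  rw [add_comm 1]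
  exact Real.add_one_le_exp _

lemma IsIID.integral_comp {ι : Type*} {u : ι → Ω → ℂ} (h : IsIID u ν P) (i : ι) {E : Type*}
    [NormedAddCommGroup E] [NormedSpace ℝ E] {f : ℂ → E} (hf : AEStronglyMeasurable f ν) :
    ∫ ω, f (u i ω) ∂P = ∫ z, f z ∂ν := by
  rw [← h.law i] at hf ⊢
  exact (integral_map (h.measurable i).aemeasurable hf).symm

/-- Chernoff's bound for the sum of the squares in a window whose upper end grows like the square
root of the number of variables. -/
lemma measure_sum_windowSq_ge_le [IsProbabilityMeasure P] (hν : IsStandardized ν)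
    (h4 : Integrable (fun z : ℂ => ‖z‖ ^ 4) ν) {ε M : ℝ} (hε : 0 < ε)
    (hM : ∫ z, tailSq M z ∂ν ≤ ε / 2) : ∃ n₀ : ℕ, ∀ (ι : Type) [Fintype ι] (u : ι → Ω → ℂ),
      IsIID u ν P → n₀ ≤ Fintype.card ι →
      P {ω | ε * Fintype.card ι ≤
        ∑ i, windowSq M (√(ε / 12) * √(Fintype.card ι : ℝ)) (u i ω)}
        ≤ ENNReal.ofReal (Real.exp 1 / (Fintype.card ι : ℝ) ^ 3) := by
  have := hν.isProbabilityMeasure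
  set m4 := ∫ z, ‖z‖ ^ 4 ∂ν with hm4
  have hm40 : 0 ≤ m4 := integral_nonneg fun z => by positivity
  -- This is the quadratic term of the log-Laplace transform at the `t` chosen below, of order `(log
  -- n)² / √n`.
  have hlim : Tendsto (fun n : ℕ => (6 / ε) ^ 2 * m4 *
      (Real.log n ^ (2 : ℝ) / (n : ℝ) ^ (1 / 2 : ℝ))) atTop (𝓝 ((6 / ε) ^ 2 * m4 * 0)) :=
    (((isLittleO_log_rpow_rpow_atTop 2 (by norm_num : (0 : ℝ) < 1 / 2)).tendsto_div_nhds_zero).comp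
      tendsto_natCast_atTop_atTop).const_mul _
  rw [mul_zero] at hlim
  obtain ⟨n₀, hn₀⟩ := eventually_atTop.1 (hlim.eventually_lt_const zero_lt_one)
  refine ⟨max n₀ 1, fun ι _ u hu hcard => ?_⟩
  set n := Fintype.card ι with hn
  have hn1 : 1 ≤ n := (le_max_right _ _).trans hcard
  have hnpos : (0 : ℝ) < n := by exact_mod_cast hn1
  have hlog : 0 ≤ Real.log n := Real.log_nonneg (by exact_mod_cast hn1)
  have hsmall := (hn₀ n ((le_max_left _ _).trans hcard)).le
  set r := √(ε / 12) * √(n : ℝ) with hr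
  have hr2 : r ^ 2 = ε / 12 * n := by
    rw [hr, mul_pow, Real.sq_sqrt (by positivity), Real.sq_sqrt (by positivity)]
  -- With `r² = ε n / 12` this makes `exp (t r²) = √n`. Chernoff's factor is `n⁻⁶` and the Laplace
  -- transform at most `e n³`, which leaves `e n⁻³`, still summable after a union over `O(n)`
  -- columns.
  set t := 6 / ε * Real.log n / n with ht
  have ht0 : 0 ≤ t := by positivity
  have htr : Real.exp (t * r ^ 2) = √(n : ℝ) := by
    have e : t * r ^ 2 = 1 / 2 * Real.log n := by rw [hr2, ht]; field_simp; ring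
    rw [e, Real.sqrt_eq_rpow, Real.rpow_def_of_pos hnpos, mul_comm]
  have hmeas : ∀ i, Measurable fun ω => windowSq M r (u i ω) := fun i =>
    (measurable_windowSq M r).comp (hu.measurable i)
  have hind : iIndepFun (fun i ω => windowSq M r (u i ω)) P :=
    hu.indep.comp (fun _ => windowSq M r) fun _ => measurable_windowSq M r
  have hmgf1 : ∀ i, mgf (fun ω => windowSq M r (u i ω)) P t
      ≤ Real.exp (t * (ε / 2) + t ^ 2 * √(n : ℝ) * m4) := by
    intro i
    have e := hu.integral_comp i
      (integrable_exp_windowSq (ν := ν) M r t ht0).aestronglyMeasurable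
    rw [mgf, e]
    refine (integral_exp_windowSq_le hν h4 M r ht0).trans (Real.exp_le_exp.2 ?_)
    rw [htr]
    linarith [mul_le_mul_of_nonneg_left hM ht0]
  have hmgf : mgf (∑ i, fun ω => windowSq M r (u i ω)) P t ≤ Real.exp (3 * Real.log n + 1) := by
    rw [hind.mgf_sum hmeas]
    refine (Finset.prod_le_prod (fun i _ => mgf_nonneg) fun i _ => hmgf1 i).trans ?_
    rw [Finset.prod_const, Finset.card_univ, ← hn, ← Real.exp_nat_mul, Real.exp_le_exp]
    have e1 : (n : ℝ) * (t * (ε / 2)) = 3 * Real.log n := by rw [ht]; field_simp; ring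
    have e2 : (n : ℝ) * (t ^ 2 * √(n : ℝ) * m4)
        = (6 / ε) ^ 2 * m4 * (Real.log n ^ (2 : ℝ) / (n : ℝ) ^ (1 / 2 : ℝ)) := by
      rw [ht, ← Real.sqrt_eq_rpow, Real.rpow_two]
      have hs : √(n : ℝ) ^ 2 = n := Real.sq_sqrt hnpos.le
      have hs0 : 0 < √(n : ℝ) := Real.sqrt_pos.2 hnpos
      field_simp
      rw [hs]; ring
    rw [mul_add, e1, e2]
    linarith
  have hint : Integrable (fun ω => Real.exp (t * (∑ i, fun ω => windowSq M r (u i ω)) ω)) P := by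
    simp only [Finset.sum_apply]
    refine Integrable.of_bound (Real.measurable_exp.comp (Measurable.const_mul
      (Finset.measurable_sum _ fun i _ => hmeas i) t)).aestronglyMeasurable
      (Real.exp (t * (n * r ^ 2))) (ae_of_all _ fun ω => ?_)
    rw [Real.norm_of_nonneg (Real.exp_pos _).le, Real.exp_le_exp]
    refine mul_le_mul_of_nonneg_left ?_ ht0
    refine (Finset.sum_le_sum fun i _ => windowSq_le M r (u i ω)).trans ?_
    simp [← hn]
  have h := measure_ge_le_exp_mul_mgf (μ := P) (ε * n) ht0 hint
  rw [← ofReal_measureReal]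
  refine ENNReal.ofReal_le_ofReal ?_
  simp only [Finset.sum_apply] at h
  refine h.trans ((mul_le_mul_of_nonneg_left hmgf (Real.exp_pos _).le).trans (le_of_eq ?_))
  have e3 : -t * (ε * n) = -(6 * Real.log n) := by rw [ht]; field_simp
  have e4 : (n : ℝ) ^ 3 = Real.exp (3 * Real.log n) := by
    rw [show (3 : ℝ) * Real.log n = ((3 : ℕ) : ℝ) * Real.log n by norm_num, Real.exp_nat_mul,
      Real.exp_log hnpos]
  rw [e3, ← Real.exp_add, e4, ← Real.exp_sub]
  congr 1
  ring

lemma ae_eventually_notMem_of_le [IsProbabilityMeasure P] {S : ℕ → Set Ω} {f : ℕ → ℝ}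
    (hf : Summable f) (hf0 : ∀ n, 0 ≤ f n)
    (h : ∀ᶠ n in atTop, P (S n) ≤ ENNReal.ofReal (f n)) :
    ∀ᵐ ω ∂P, ∀ᶠ n in atTop, ω ∉ S n := by
  obtain ⟨n₀, hn₀⟩ := eventually_atTop.1 h
  have h1 : ∑' n, P (if n₀ ≤ n then S n else ∅) ≠ ∞ := by
    refine ne_top_of_le_ne_top ?_ (ENNReal.tsum_le_tsum (g := fun n => ENNReal.ofReal (f n)) ?_)
    · rw [← ENNReal.ofReal_tsum_of_nonneg hf0 hf]; exact ENNReal.ofReal_ne_top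
    · intro n
      by_cases hn : n₀ ≤ n
      · rw [if_pos hn]; exact hn₀ n hn
      · rw [if_neg hn]; simp
  filter_upwards [ae_eventually_notMem h1] with ω hω
  filter_upwards [hω, eventually_ge_atTop n₀] with n h2 h3
  rwa [if_pos h3] at h2

/-- Tonelli: the sum of tail probabilities is the integral of a pointwise weighted count of the
levels below `f z`, which the callers bound by a moment. -/
lemma tsum_measure_lt_le {ι : Type*} [Countable ι] {w : ι → ℝ≥0∞} {g : ι → ℝ} {f : ℂ → ℝ}
    {F : ℂ → ℝ≥0∞} (hf : Measurable f)
    (h : ∀ z, ∑' i, (if g i < f z then w i else 0) ≤ F z) :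
    ∑' i, w i * ν {z | g i < f z} ≤ ∫⁻ z, F z ∂ν := by
  have hm : ∀ i, MeasurableSet {z | g i < f z} := fun i => measurableSet_lt measurable_const hf
  calc ∑' i, w i * ν {z | g i < f z}
      = ∑' i, ∫⁻ z, ({z | g i < f z}.indicator (fun _ => w i)) z ∂ν := by
        congr 1; funext i; rw [lintegral_indicator_const (hm i)]
    _ = ∫⁻ z, ∑' i, ({z | g i < f z}.indicator (fun _ => w i)) z ∂ν := by
        rw [lintegral_tsum fun i => (measurable_const.indicator (hm i)).aemeasurable]
    _ ≤ _ := lintegral_mono fun z => by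
        refine le_trans (le_of_eq ?_) (h z)
        congr 1

variable {K : ℕ → ℕ} {c : ℝ}

/-- All the entries of the arrays are eventually at most `η √N`. -/
def EntriesSmall (s : (N : ℕ) → Fin N → Fin (K N) → Ω → ℂ) (P : Measure Ω) : Prop :=
  ∀ η > 0, ∀ᵐ ω ∂P, ∀ᶠ N : ℕ in atTop, ∀ i k, ‖s N i k ω‖ ≤ η * √(N : ℝ)

lemma IsIID.measure_lt {ι : Type*} {u : ι → Ω → ℂ} (h : IsIID u ν P) (i : ι) (r : ℝ) :
    P {ω | r < ‖u i ω‖} = ν {z | r < ‖z‖} := by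
  rw [← h.law i, Measure.map_apply (h.measurable i)
    (measurableSet_lt measurable_const measurable_norm)]
  rfl

lemma lt_mul_sqrt_iff {η x r : ℝ} (hη : 0 < η) (hx : 0 ≤ x) (hr : 0 ≤ r) :
    η * √r < x ↔ r < (x / η) ^ 2 := by
  rw [mul_comm, ← lt_div_iff₀ hη, Real.sqrt_lt hr (by positivity)]

/-- Without any link between different `N`, the union runs over all `N K = O(N²)` entries for each
`N`. Finiteness of `∑ N² P(|s| > η √N)` follows from the sixth moment. -/
lemma entriesSmall_of_rowwiseIID [IsProbabilityMeasure P]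
    (hK : Tendsto (fun N : ℕ => (K N : ℝ) / (N : ℝ)) atTop (𝓝 c)) (hc : 0 ≤ c)
    {s : (N : ℕ) → Fin N → Fin (K N) → Ω → ℂ} (hs : RowwiseIID s ν P)
    (h6 : Integrable (fun z : ℂ => ‖z‖ ^ 6) ν) : EntriesSmall s P := by
  intro η hη
  have hsum : ∑' N : ℕ, ENNReal.ofReal ((N : ℝ) ^ 2) * ν {z | (N : ℝ) < (‖z‖ / η) ^ 2} ≠ ∞ := by
    refine ne_top_of_le_ne_top (b := ∫⁻ z, ENNReal.ofReal ((η⁻¹) ^ 6 * ‖z‖ ^ 6) ∂ν) ?_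
      (tsum_measure_lt_le (by fun_prop) fun z => ?_)
    · exact (h6.const_mul _).lintegral_lt_top.ne
    · set y := (‖z‖ / η) ^ 2 with hy
      have hy0 : 0 ≤ y := by positivity
      rw [tsum_eq_sum (s := Finset.Icc 1 ⌊y⌋₊)]
      · calc _ ≤ ∑ _N ∈ Finset.Icc 1 ⌊y⌋₊, ENNReal.ofReal (y ^ 2) := by
              refine Finset.sum_le_sum fun N _ => ?_
              split_ifs with h
              · refine ENNReal.ofReal_le_ofReal ?_
                exact pow_le_pow_left₀ (Nat.cast_nonneg N) h.le 2
              · exact zero_le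
          _ = ENNReal.ofReal (⌊y⌋₊ * y ^ 2) := by
              rw [Finset.sum_const, Nat.card_Icc, Nat.add_sub_cancel, nsmul_eq_mul,
                ENNReal.ofReal_mul (Nat.cast_nonneg _), ENNReal.ofReal_natCast]
          _ ≤ _ := by
              refine ENNReal.ofReal_le_ofReal ?_
              calc _ ≤ y * y ^ 2 := by gcongr; exact Nat.floor_le hy0
                _ = _ := by rw [hy]; field_simp
      · intro N hN
        rw [Finset.mem_Icc, not_and_or] at hN
        rcases hN with hN | hN
        · have : N = 0 := by omega
          subst this; simp
        · rw [if_neg]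
          rw [not_lt]
          exact (Nat.lt_of_floor_lt (not_le.1 hN)).le
  have hb : ∀ᶠ N : ℕ in atTop, P {ω | ¬ ∀ i k, ‖s N i k ω‖ ≤ η * √(N : ℝ)} ≤
      ENNReal.ofReal (c + 1) *
        (ENNReal.ofReal ((N : ℝ) ^ 2) * ν {z | (N : ℝ) < (‖z‖ / η) ^ 2}) := by
    filter_upwards [hK.eventually_lt_const (lt_add_one c), eventually_gt_atTop 0] with N h1 h2
    have hN : (0 : ℝ) < N := by exact_mod_cast h2
    rw [div_lt_iff₀ hN] at h1
    have e : {ω | ¬ ∀ i k, ‖s N i k ω‖ ≤ η * √(N : ℝ)}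
        = ⋃ p ∈ (Finset.univ : Finset (Fin N × Fin (K N))),
          {ω | η * √(N : ℝ) < ‖s N p.1 p.2 ω‖} := by
      ext ω; simp
    rw [e]
    refine (measure_biUnion_finset_le _ _).trans ?_
    have h3 : ∀ p : Fin N × Fin (K N), P {ω | η * √(N : ℝ) < ‖s N p.1 p.2 ω‖}
        = ν {z | (N : ℝ) < (‖z‖ / η) ^ 2} := fun p => by
      rw [(hs N).measure_lt p]
      congr 1; ext z
      exact lt_mul_sqrt_iff hη (norm_nonneg z) hN.le
    rw [Finset.sum_congr rfl fun p _ => h3 p, Finset.sum_const, nsmul_eq_mul, ← mul_assoc]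
    gcongr
    rw [← ENNReal.ofReal_mul (by positivity), ← ENNReal.ofReal_natCast]
    refine ENNReal.ofReal_le_ofReal ?_
    simp only [Finset.card_univ, Fintype.card_prod, Fintype.card_fin, Nat.cast_mul]
    nlinarith
  obtain ⟨n₀, hn₀⟩ := eventually_atTop.1 hb
  have h1 : ∑' N, P (if n₀ ≤ N then {ω | ¬ ∀ i k, ‖s N i k ω‖ ≤ η * √(N : ℝ)} else ∅) ≠ ∞ := by
    refine ne_top_of_le_ne_top (b := ENNReal.ofReal (c + 1) *
      ∑' N : ℕ, ENNReal.ofReal ((N : ℝ) ^ 2) * ν {z | (N : ℝ) < (‖z‖ / η) ^ 2})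
      (ENNReal.mul_ne_top ENNReal.ofReal_ne_top hsum) ?_
    rw [← ENNReal.tsum_mul_left]
    refine ENNReal.tsum_le_tsum fun N => ?_
    by_cases hn : n₀ ≤ N
    · rw [if_pos hn]; exact hn₀ N hn
    · rw [if_neg hn]; simp
  filter_upwards [ae_eventually_notMem h1] with ω hω
  filter_upwards [hω, eventually_ge_atTop n₀] with N h2 h3
  rw [if_pos h3] at h2
  simpa using h2

/-- Borel–Cantelli over the entries of the single array, entry `(i, k)` being compared with `√(max i
k + 1)`. At most `y²` index pairs have `max i k + 1 ≤ y`, so the fourth moment suffices. The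
finitely many exceptional entries are bounded, hence eventually below `η' √N`. -/
lemma entriesSmall_of_fromDoubleArray [IsProbabilityMeasure P]
    (hK : Tendsto (fun N : ℕ => (K N : ℝ) / (N : ℝ)) atTop (𝓝 c)) (hc : 0 ≤ c)
    {s : (N : ℕ) → Fin N → Fin (K N) → Ω → ℂ} (hs : FromDoubleArray s ν P)
    (h4 : Integrable (fun z : ℂ => ‖z‖ ^ 4) ν) : EntriesSmall s P := by
  intro η' hη'
  obtain ⟨x, hx, hsx⟩ := hs
  -- For entries of the `N`-th array `max i k + 1 ≤ (c + 1) N`, so this rescaling produces the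
  -- threshold `η' √N`.
  set η := η' / √(c + 1) with hη_def
  have hc1 : 0 < √(c + 1) := Real.sqrt_pos.2 (by linarith)
  have hη : 0 < η := by positivity
  have hsum : ∑' p : ℕ × ℕ, P {ω | η * √((max p.1 p.2 : ℕ) + 1 : ℝ) < ‖x p.1 p.2 ω‖} ≠ ∞ := by
    have h1 : ∀ p : ℕ × ℕ, P {ω | η * √((max p.1 p.2 : ℕ) + 1 : ℝ) < ‖x p.1 p.2 ω‖}
        = 1 * ν {z | ((max p.1 p.2 : ℕ) + 1 : ℝ) < (‖z‖ / η) ^ 2} := fun p => by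
      rw [hx.measure_lt p, one_mul]
      congr 1; ext z
      exact lt_mul_sqrt_iff hη (norm_nonneg z) (by positivity)
    rw [tsum_congr h1]
    refine ne_top_of_le_ne_top (b := ∫⁻ z, ENNReal.ofReal ((η⁻¹) ^ 4 * ‖z‖ ^ 4) ∂ν) ?_
      (tsum_measure_lt_le (w := fun _ => 1) (by fun_prop) fun z => ?_)
    · exact (h4.const_mul _).lintegral_lt_top.ne
    · set y := (‖z‖ / η) ^ 2 with hy
      have hy0 : 0 ≤ y := by positivity
      rw [tsum_eq_sum (s := Finset.range ⌊y⌋₊ ×ˢ Finset.range ⌊y⌋₊)]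
      · calc _ ≤ ∑ _p ∈ Finset.range ⌊y⌋₊ ×ˢ Finset.range ⌊y⌋₊, (1 : ℝ≥0∞) := by
              refine Finset.sum_le_sum fun p _ => ?_
              split_ifs
              · exact le_rfl
              · exact zero_le
          _ = ENNReal.ofReal ((⌊y⌋₊ : ℝ) * ⌊y⌋₊) := by
              rw [Finset.sum_const, Finset.card_product, Finset.card_range, nsmul_eq_mul, mul_one,
                ← Nat.cast_mul, ENNReal.ofReal_natCast]
          _ ≤ _ := by
              refine ENNReal.ofReal_le_ofReal ?_
              calc _ ≤ y * y := by gcongr <;> exact Nat.floor_le hy0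
                _ = _ := by rw [hy]; field_simp
      · intro p hp
        rw [if_neg]
        intro hlt
        refine hp ?_
        have hmax : max p.1 p.2 + 1 ≤ ⌊y⌋₊ := Nat.le_floor (by push_cast at hlt ⊢; exact hlt.le)
        rw [Finset.mem_product, Finset.mem_range, Finset.mem_range]
        constructor
        · exact (Nat.lt_succ_of_le (le_max_left _ _)).trans_le hmax
        · exact (Nat.lt_succ_of_le (le_max_right _ _)).trans_le hmax
  filter_upwards [ae_finite_setOfPred_mem hsum] with ω hω
  obtain ⟨B, hB⟩ := (hω.image fun p => ‖x p.1 p.2 ω‖).bddAbove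
  have hlim : Tendsto (fun N : ℕ => η' * √(N : ℝ)) atTop atTop :=
    (Real.tendsto_sqrt_atTop.comp tendsto_natCast_atTop_atTop).const_mul_atTop hη'
  filter_upwards [hlim.eventually_ge_atTop B, hK.eventually_lt_const (lt_add_one c),
    eventually_gt_atTop 0] with N h1 h2 h3 i k
  have hN : (0 : ℝ) < N := by exact_mod_cast h3
  rw [div_lt_iff₀ hN] at h2
  rw [hsx]
  by_cases hmem : η * √((max (i : ℕ) (k : ℕ) : ℕ) + 1 : ℝ) < ‖x i k ω‖
  · exact (hB ⟨((i : ℕ), (k : ℕ)), hmem, rfl⟩).trans h1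
  · refine (not_lt.1 hmem).trans ?_
    have h5 : ((max (i : ℕ) (k : ℕ) : ℕ) + 1 : ℝ) ≤ (c + 1) * N := by
      have hi : ((i : ℕ) + 1 : ℝ) ≤ N := by exact_mod_cast i.2
      have hk : ((k : ℕ) + 1 : ℝ) ≤ K N := by exact_mod_cast k.2
      rcases le_total (i : ℕ) (k : ℕ) with h | h
      · rw [max_eq_right h]; linarith
      · rw [max_eq_left h]; nlinarith
    calc η * √((max (i : ℕ) (k : ℕ) : ℕ) + 1 : ℝ) ≤ η * √((c + 1) * N) := by gcongr
      _ = η' * √(N : ℝ) := by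
          rw [Real.sqrt_mul (by linarith), hη_def]; field_simp

lemma FromDoubleArray.rowwiseIID {s : (N : ℕ) → Fin N → Fin (K N) → Ω → ℂ}
    (hs : FromDoubleArray s ν P) : RowwiseIID s ν P := by
  obtain ⟨x, hx, hsx⟩ := hs
  intro N
  simp only [hsx]
  exact ⟨fun p => hx.measurable (p.1, p.2),
    hx.indep.precomp (g := fun p : Fin N × Fin (K N) => ((p.1 : ℕ), (p.2 : ℕ)))
      fun p q h => by
        simp only [Prod.mk.injEq] at h
        exact Prod.ext (Fin.ext h.1) (Fin.ext h.2),
    fun p => hx.law (p.1, p.2)⟩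

lemma IsIID.column {N k : ℕ} {s : Fin N → Fin k → Ω → ℂ}
    (hs : IsIID (fun p : Fin N × Fin k => s p.1 p.2) ν P) (j : Fin k) :
    IsIID (fun i => s i j) ν P :=
  ⟨fun i => hs.measurable (i, j), hs.indep.precomp (g := fun i : Fin N => (i, j))
    fun _ _ h => (Prod.ext_iff.1 h).1, fun i => hs.law (i, j)⟩

/-- The truncated tails of all columns are uniformly small. -/
lemma ae_eventually_sum_tailSq_le [IsProbabilityMeasure P] (hν : IsStandardized ν)
    (h4 : Integrable (fun z : ℂ => ‖z‖ ^ 4) ν)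
    (hK : Tendsto (fun N : ℕ => (K N : ℝ) / (N : ℝ)) atTop (𝓝 c)) (hc : 0 ≤ c)
    {s : (N : ℕ) → Fin N → Fin (K N) → Ω → ℂ} (hs : RowwiseIID s ν P) (hsmall : EntriesSmall s P)
    {ε M : ℝ} (hε : 0 < ε) (hM : ∫ z, tailSq M z ∂ν ≤ ε / 2) :
    ∀ᵐ ω ∂P, ∀ᶠ N : ℕ in atTop, ∀ k, ∑ i, tailSq M (s N i k ω) ≤ ε * N := by
  obtain ⟨n₀, hn₀⟩ := measure_sum_windowSq_ge_le (P := P) hν h4 hε hM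
  have hsumm : Summable fun N : ℕ => (c + 1) * Real.exp 1 * (1 / (N : ℝ) ^ 2) :=
    (Real.summable_one_div_nat_pow.2 one_lt_two).mul_left _
  have h1 : ∀ᵐ ω ∂P, ∀ᶠ N : ℕ in atTop, ω ∉ ⋃ k ∈ (Finset.univ : Finset (Fin (K N))),
      {ω | ε * (N : ℝ) ≤ ∑ i, windowSq M (√(ε / 12) * √(N : ℝ)) (s N i k ω)} := by
    refine ae_eventually_notMem_of_le hsumm (fun N => by positivity) ?_
    filter_upwards [hK.eventually_lt_const (lt_add_one c), eventually_gt_atTop 0,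
      eventually_ge_atTop n₀] with N h1 h2 h3
    have hN : (0 : ℝ) < N := by exact_mod_cast h2
    rw [div_lt_iff₀ hN] at h1
    refine (measure_biUnion_finset_le _ _).trans ?_
    have h4 : ∀ k : Fin (K N), P {ω | ε * (N : ℝ) ≤
        ∑ i, windowSq M (√(ε / 12) * √(N : ℝ)) (s N i k ω)}
        ≤ ENNReal.ofReal (Real.exp 1 / (N : ℝ) ^ 3) := fun k => by
      have := hn₀ (Fin N) (fun i => s N i k) ((hs N).column k) (by simpa using h3)
      simpa using this
    refine (Finset.sum_le_sum fun k _ => h4 k).trans ?_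
    rw [Finset.sum_const, nsmul_eq_mul, ← ENNReal.ofReal_natCast,
      ← ENNReal.ofReal_mul (by positivity)]
    refine ENNReal.ofReal_le_ofReal ?_
    simp only [Finset.card_univ, Fintype.card_fin]
    calc (K N : ℝ) * (Real.exp 1 / (N : ℝ) ^ 3)
        ≤ ((c + 1) * N) * (Real.exp 1 / (N : ℝ) ^ 3) := by gcongr
      _ = _ := by field_simp
  -- With no entry above the upper end of the window, the window sum is the full tail sum.
  filter_upwards [h1, hsmall (√(ε / 12)) (Real.sqrt_pos.2 (by positivity))] with ω h2 h3
  filter_upwards [h2, h3] with N h4 h5 k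
  simp only [Finset.mem_univ, Set.iUnion_true, Set.mem_iUnion, Set.mem_ofPred_eq, not_exists,
    not_le] at h4
  refine le_of_eq_of_le ?_ (h4 k).le
  refine Finset.sum_congr rfl fun i _ => ?_
  simp only [tailSq, windowSq, h5 i k, and_true]

end Truncation

/-! ### Truncated columns and conditional concentration for each user. -/

section QuadraticForms

variable {Ω : Type*} [MeasurableSpace Ω] {P : Measure Ω} {ν : Measure ℂ}

/-- Truncation at level `M`. -/
noncomputable def cut (M : ℝ) (z : ℂ) : ℂ := if ‖z‖ ≤ M then z else 0

/-- Truncation at level `M`, centered with respect to `ν`. -/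
noncomputable def centeredCut (M : ℝ) (ν : Measure ℂ) (z : ℂ) : ℂ := cut M z - ∫ w, cut M w ∂ν

/-- The variance of the truncation at level `M`. -/
noncomputable def cutVar (M : ℝ) (ν : Measure ℂ) : ℝ := ∫ z, ‖centeredCut M ν z‖ ^ 2 ∂ν

lemma measurable_cut (M : ℝ) : Measurable (cut M) :=
  Measurable.ite (measurableSet_le measurable_norm measurable_const) measurable_id measurable_const

lemma measurable_centeredCut (M : ℝ) (ν : Measure ℂ) : Measurable (centeredCut M ν) :=
  (measurable_cut M).sub_const _

lemma norm_cut_le {M : ℝ} (hM : 0 ≤ M) (z : ℂ) : ‖cut M z‖ ≤ M := by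
  unfold cut; split_ifs with h
  · exact h
  · simpa using hM

lemma norm_cut_sq (M : ℝ) (z : ℂ) : ‖cut M z‖ ^ 2 = ‖z‖ ^ 2 - tailSq M z := by
  unfold cut tailSq
  by_cases h : ‖z‖ ≤ M
  · simp [h, not_lt.2 h]
  · simp [h, not_le.1 h]

lemma norm_sub_cut_sq (M : ℝ) (z : ℂ) : ‖z - cut M z‖ ^ 2 = tailSq M z := by
  unfold cut tailSq
  by_cases h : ‖z‖ ≤ M
  · simp [h, not_lt.2 h]
  · simp [h, not_le.1 h]

/-- For `M ≥ 1` a discarded value satisfies `‖z‖ ≤ ‖z‖²`, so the second-moment tail also controls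
the mean of the truncation. -/
lemma norm_sub_cut_le {M : ℝ} (hM : 1 ≤ M) (z : ℂ) : ‖z - cut M z‖ ≤ tailSq M z := by
  unfold cut tailSq
  by_cases h : ‖z‖ ≤ M
  · simp [h, not_lt.2 h]
  · have := not_le.1 h
    simp only [h, if_false, this, if_true, sub_zero]
    nlinarith

section

variable (hν : IsStandardized ν) {M : ℝ} (hM : 1 ≤ M)
include hν hM

lemma integrable_cut : Integrable (cut M) ν := by
  have := hν.isProbabilityMeasure
  exact Integrable.of_bound (measurable_cut M).aestronglyMeasurable M
    (ae_of_all _ (norm_cut_le (by linarith)))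

/-- As the law is centered, the mean of the kept part is minus the mean of the discarded part. -/
lemma norm_integral_cut_le_tail : ‖∫ z, cut M z ∂ν‖ ≤ ∫ z, tailSq M z ∂ν := by
  have := hν.isProbabilityMeasure
  have hint : Integrable (fun z : ℂ => z) ν := hν.memLp_two.integrable one_le_two
  have h1 : ∫ z, (z - cut M z) ∂ν = -∫ z, cut M z ∂ν := by
    rw [integral_sub hint (integrable_cut hν hM), hν.mean_zero, zero_sub]
  rw [← norm_neg, ← h1]
  exact norm_integral_le_of_norm_le (hν.integrable_tailSq M) (ae_of_all _ (norm_sub_cut_le hM))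

lemma norm_centeredCut_le (z : ℂ) : ‖centeredCut M ν z‖ ≤ 2 * M := by
  have := hν.isProbabilityMeasure
  have h1 : ‖∫ w, cut M w ∂ν‖ ≤ M := by
    have := norm_integral_le_of_norm_le_const (μ := ν)
      (ae_of_all _ (norm_cut_le (by linarith : 0 ≤ M)))
    simpa using this
  rw [centeredCut]
  linarith [norm_sub_le (cut M z) (∫ w, cut M w ∂ν), norm_cut_le (by linarith : 0 ≤ M) z]

lemma integral_centeredCut : ∫ z, centeredCut M ν z ∂ν = 0 := by
  have := hν.isProbabilityMeasure
  simp only [centeredCut]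
  rw [integral_sub (integrable_cut hν hM) (integrable_const _)]
  simp

lemma abs_one_sub_cutVar_le :
    |1 - cutVar M ν| ≤ ∫ z, tailSq M z ∂ν + (∫ z, tailSq M z ∂ν) ^ 2 := by
  have := hν.isProbabilityMeasure
  set m := ∫ w, cut M w ∂ν with hm
  have hc := integrable_cut hν hM
  have hre : Integrable (fun z => (star m * cut M z).re) ν := (hc.const_mul (star m)).re
  have hpt : ∀ z, ‖centeredCut M ν z‖ ^ 2
      = (‖z‖ ^ 2 - tailSq M z) - 2 * (star m * cut M z).re + ‖m‖ ^ 2 := by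
    intro z
    rw [← norm_cut_sq, centeredCut, ← hm, ← Complex.normSq_eq_norm_sq, ← Complex.normSq_eq_norm_sq,
      ← Complex.normSq_eq_norm_sq, Complex.normSq_sub, RCLike.star_def, mul_comm (cut M z)]
    ring
  -- Second moment of the kept part minus the squared modulus of its mean.
  have hval : cutVar M ν = 1 - ∫ z, tailSq M z ∂ν - ‖m‖ ^ 2 := by
    have h1 : ∫ z, (star m * cut M z).re ∂ν = ‖m‖ ^ 2 := by
      have h2 := integral_re (𝕜 := ℂ) (hc.const_mul (star m))
      rw [integral_const_mul, ← hm, RCLike.star_def, Complex.conj_mul', ← Complex.ofReal_pow] at h2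
      exact h2
    have hi1 := hν.integrable_sq.sub (hν.integrable_tailSq M)
    have hi2 := hi1.sub (hre.const_mul 2)
    have e1 := integral_add hi2 (integrable_const (‖m‖ ^ 2))
    have e2 := integral_sub hi1 (hre.const_mul 2)
    have e3 := integral_sub hν.integrable_sq (hν.integrable_tailSq M)
    simp only [Pi.sub_apply] at e1 e2 e3
    rw [cutVar]
    simp only [hpt]
    rw [e1, e2, e3, integral_const_mul, h1, hν.second_moment]
    simp only [integral_const, probReal_univ, one_smul]
    ring
  have hT := norm_integral_cut_le_tail hν hM
  rw [← hm] at hT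
  have hT0 : 0 ≤ ∫ z, tailSq M z ∂ν := integral_nonneg (tailSq_nonneg M)
  have hsq := pow_le_pow_left₀ (norm_nonneg m) hT 2
  rw [hval, abs_le]
  constructor
  · nlinarith [sq_nonneg ‖m‖]
  · linarith

lemma norm_sub_centeredCut_sq_le (z : ℂ) :
    ‖z - centeredCut M ν z‖ ^ 2 ≤ 2 * (tailSq M z + (∫ w, tailSq M w ∂ν) ^ 2) := by
  have e : z - centeredCut M ν z = (z - cut M z) + ∫ w, cut M w ∂ν := by rw [centeredCut]; ring
  have h1 := norm_add_le (z - cut M z) (∫ w, cut M w ∂ν)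
  rw [← e] at h1
  have h2 := pow_le_pow_left₀ (norm_nonneg _) (norm_integral_cut_le_tail hν hM) 2
  have h3 := norm_sub_cut_sq M z
  have h4 := pow_le_pow_left₀ (norm_nonneg _) h1 2
  nlinarith [sq_nonneg (‖z - cut M z‖ - ‖∫ w, cut M w ∂ν‖)]

lemma IsIID.isBoundedCentered {ι : Type*} {u : ι → Ω → ℂ} (hu : IsIID u ν P) :
    IsBoundedCentered (fun i ω => centeredCut M ν (u i ω)) (2 * M) (cutVar M ν) P where
  measurable i := (measurable_centeredCut M ν).comp (hu.measurable i)
  indep := hu.indep.comp (fun _ => centeredCut M ν) fun _ => measurable_centeredCut M ν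
  bound i ω := norm_centeredCut_le hν hM (u i ω)
  mean i := by
    rw [hu.integral_comp i (measurable_centeredCut M ν).aestronglyMeasurable,
      integral_centeredCut hν hM]
  var i := hu.integral_comp i
    ((measurable_centeredCut M ν).norm.pow_const 2).aestronglyMeasurable

end

section Deterministic

variable {ι : Type*} [Fintype ι] {D : Matrix ι ι ℂ} {d : ℝ}

lemma norm_star_dotProduct_mulVec_le (hd : 0 ≤ d) (hD : ∀ x, sqNorm (D *ᵥ x) ≤ d ^ 2 * sqNorm x)
    (x y : ι → ℂ) : ‖star x ⬝ᵥ (D *ᵥ y)‖ ≤ d * (√(sqNorm x) * √(sqNorm y)) := by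
  refine (norm_star_dotProduct_le x (D *ᵥ y)).trans ?_
  have : √(sqNorm (D *ᵥ y)) ≤ d * √(sqNorm y) := by
    rw [← Real.sqrt_sq hd, ← Real.sqrt_mul (sq_nonneg d)]
    exact Real.sqrt_le_sqrt (hD y)
  nlinarith [mul_le_mul_of_nonneg_left this (Real.sqrt_nonneg (sqNorm x))]

/-- A quadratic form changes little if its argument does. -/
lemma norm_quadratic_sub_le (hd : 0 ≤ d) (hD : ∀ x, sqNorm (D *ᵥ x) ≤ d ^ 2 * sqNorm x)
    {x u : ι → ℂ} {θ n : ℝ} (hn : 0 ≤ n) (hθ0 : 0 ≤ θ) (hθ : θ ≤ 1)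
    (hv : sqNorm (x - u) ≤ θ * n) (hu : sqNorm u ≤ 2 * n) :
    ‖star x ⬝ᵥ (D *ᵥ x) - star u ⬝ᵥ (D *ᵥ u)‖ ≤ 4 * √θ * d * n := by
  set v := x - u with hv_def
  have hx : x = u + v := by rw [hv_def]; abel
  have e : star x ⬝ᵥ (D *ᵥ x) - star u ⬝ᵥ (D *ᵥ u)
      = star u ⬝ᵥ (D *ᵥ v) + star v ⬝ᵥ (D *ᵥ u) + star v ⬝ᵥ (D *ᵥ v) := by
    rw [hx, star_add, Matrix.mulVec_add, add_dotProduct, dotProduct_add, dotProduct_add]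
    ring
  have h1 := norm_star_dotProduct_mulVec_le hd hD u v
  have h2 := norm_star_dotProduct_mulVec_le hd hD v u
  have h3 := norm_star_dotProduct_mulVec_le hd hD v v
  set p := √(sqNorm u) with hp
  set r := √(sqNorm v) with hr
  have hp0 : 0 ≤ p := Real.sqrt_nonneg _
  have hr0 : 0 ≤ r := Real.sqrt_nonneg _
  -- Here `3/2` stands in for `√2`: two cross terms and one square then add up to `(3/2 + 3/2 + 1)
  -- √θ = 4 √θ`.
  have hpb : p ≤ 3 / 2 * √n := by
    have : p ≤ √(9 / 4 * n) := Real.sqrt_le_sqrt (by linarith)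
    rw [Real.sqrt_mul (by norm_num), show (9 / 4 : ℝ) = (3 / 2) ^ 2 by norm_num,
      Real.sqrt_sq (by norm_num)] at this
    exact this
  have hrb : r ≤ √θ * √n := by
    rw [← Real.sqrt_mul hθ0]; exact Real.sqrt_le_sqrt hv
  have hsn : √n * √n = n := Real.mul_self_sqrt hn
  have hsθ : √θ * √θ ≤ √θ := by
    have : √θ ≤ 1 := by
      rw [← Real.sqrt_one]; exact Real.sqrt_le_sqrt hθ
    nlinarith [Real.sqrt_nonneg θ]
  have hpr : p * r ≤ 3 / 2 * √θ * n := by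
    calc p * r ≤ (3 / 2 * √n) * (√θ * √n) := by gcongr
      _ = 3 / 2 * √θ * (√n * √n) := by ring
      _ = _ := by rw [hsn]
  have hrr : r * r ≤ √θ * n := by
    calc r * r ≤ (√θ * √n) * (√θ * √n) := by gcongr
      _ = (√θ * √θ) * (√n * √n) := by ring
      _ ≤ _ := by rw [hsn]; gcongr
  rw [e]
  have h4 := norm_add₃_le (a := star u ⬝ᵥ (D *ᵥ v)) (b := star v ⬝ᵥ (D *ᵥ u))
    (c := star v ⬝ᵥ (D *ᵥ v))
  have h5 : d * (p * r) + d * (r * p) + d * (r * r) ≤ 4 * √θ * d * n := by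
    nlinarith [mul_le_mul_of_nonneg_left hpr hd, mul_le_mul_of_nonneg_left hrr hd]
  linarith

lemma norm_trace_le [DecidableEq ι] (hd : 0 ≤ d)
    (hD : ∀ x, sqNorm (D *ᵥ x) ≤ d ^ 2 * sqNorm x) : ‖D.trace‖ ≤ d * Fintype.card ι := by
  refine (norm_sum_le _ _).trans ((Finset.sum_le_sum fun i _ => norm_diag_le hd hD i i).trans ?_)
  simp [mul_comm]

end Deterministic

section Model

variable {L N K : ℕ}

/-- A block is the matrix restricted to inputs in block `l'` and read off in block `l`, so it
inherits the operator norm bound. -/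
lemma sqNorm_block_mulVec_le {R : Matrix (Fin L × Fin N) (Fin L × Fin N) ℂ} {d : ℝ}
    (hR : ∀ x, sqNorm (R *ᵥ x) ≤ d ^ 2 * sqNorm x) (l l' : Fin L) (y : Fin N → ℂ) :
    sqNorm (block R l l' *ᵥ y) ≤ d ^ 2 * sqNorm y := by
  have h1 := hR (stack (Pi.single l' 1) y)
  have h2 : sqNorm (Pi.single l' 1 : Fin L → ℂ) = 1 := by
    simp [sqNorm, Pi.single_apply, apply_ite]
  rw [sqNorm_stack, h2, one_mul] at h1
  refine le_trans ?_ h1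
  have h3 : ∀ i, (block R l l' *ᵥ y) i = (R *ᵥ stack (Pi.single l' 1) y) (l, i) := by
    intro i
    simp only [Matrix.mulVec, dotProduct, block, Matrix.of_apply, stack, Fintype.sum_prod_type]
    rw [Finset.sum_eq_single l' (fun m _ hm => by simp [hm]) (by simp)]
    simp
  rw [sqNorm, sqNorm, Fintype.sum_prod_type]
  simp only [h3]
  exact Finset.single_le_sum
    (f := fun m => ∑ i, ‖(R *ᵥ stack (Pi.single l' 1) y) (m, i)‖ ^ 2)
    (fun _ _ => by positivity) (Finset.mem_univ l)

/-- The block of the resolvent seen by user `k`. -/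
noncomputable def userBlock (σ : ℝ) (a : Fin K → Fin L → ℂ) (s : Fin N → Fin K → ℂ) (k : Fin K)
    (l l' : Fin L) : Matrix (Fin N) (Fin N) ℂ :=
  block (interference a s k + ((σ : ℂ) ^ 2) • 1)⁻¹ l l'

lemma sqNorm_userBlock_mulVec_le {σ : ℝ} (hσ : 0 < σ) (a : Fin K → Fin L → ℂ)
    (s : Fin N → Fin K → ℂ) (k : Fin K) (l l' : Fin L) (y : Fin N → ℂ) :
    sqNorm (userBlock σ a s k l l' *ᵥ y) ≤ (σ⁻¹ ^ 2) ^ 2 * sqNorm y :=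
  sqNorm_block_mulVec_le (sqNorm_resolvent_mulVec_le' (interference_posSemidef a s k) hσ) l l' y

/-- Needed for measurability: the inverse is adjugate over determinant, and the determinant never
vanishes because the matrix is positive definite. -/
lemma continuous_userBlock {σ : ℝ} (hσ : 0 < σ) (k : Fin K) (l l' : Fin L) :
    Continuous fun p : (Fin K → Fin L → ℂ) × (Fin N → Fin K → ℂ) =>
      userBlock σ p.1 p.2 k l l' := by
  have h1 : Continuous fun p : (Fin K → Fin L → ℂ) × (Fin N → Fin K → ℂ) =>
      interference p.1 p.2 k + ((σ : ℂ) ^ 2) • 1 := by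
    refine Continuous.add (continuous_matrix fun x y => ?_) continuous_const
    simp only [interference, Matrix.smul_apply, Matrix.sub_apply, Matrix.sum_apply,
      Matrix.vecMulVec_apply, stack, Pi.star_apply]
    fun_prop
  have h2 : Continuous fun p : (Fin K → Fin L → ℂ) × (Fin N → Fin K → ℂ) =>
      (interference p.1 p.2 k + ((σ : ℂ) ^ 2) • 1)⁻¹ := by
    simp only [Matrix.inv_def, Ring.inverse_eq_inv']
    refine Continuous.smul (h1.matrix_det.inv₀ fun p => ?_) h1.matrix_adjugate
    exact ((Matrix.isUnit_iff_isUnit_det _).1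
      (posDef_add_smul_one (interference_posSemidef p.1 p.2 k) hσ).isUnit).ne_zero
  refine continuous_matrix fun i j => ?_
  exact h2.matrix_elem (l, i) (l', j)

/-- The deviation of the quadratic form in the truncated column `y` from its mean. -/
noncomputable def deviation (σ M : ℝ) (ν : Measure ℂ) (k : Fin K) (l l' : Fin L)
    (a : Fin K → Fin L → ℂ) (s : Fin N → Fin K → ℂ) (y : Fin N → ℂ) : ℂ :=
  star (fun i => centeredCut M ν (y i)) ⬝ᵥ
    (userBlock σ a s k l l' *ᵥ fun i => centeredCut M ν (y i))
    - cutVar M ν * (userBlock σ a s k l l').trace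

lemma measurable_deviation {σ : ℝ} (hσ : 0 < σ) (M : ℝ) (ν : Measure ℂ) (k : Fin K)
    (l l' : Fin L) : Measurable fun p : ((Fin K → Fin L → ℂ) × (Fin N → Fin K → ℂ)) × (Fin N → ℂ) =>
      deviation σ M ν k l l' p.1.1 p.1.2 p.2 := by
  have h1 : ∀ i j, Measurable fun p : ((Fin K → Fin L → ℂ) × (Fin N → Fin K → ℂ)) × (Fin N → ℂ) =>
      userBlock σ p.1.1 p.1.2 k l l' i j := fun i j =>
    ((continuous_userBlock hσ k l l').matrix_elem i j).measurable.comp measurable_fst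
  have h2 : ∀ i, Measurable fun p : ((Fin K → Fin L → ℂ) × (Fin N → Fin K → ℂ)) × (Fin N → ℂ) =>
      centeredCut M ν (p.2 i) := fun i =>
    (measurable_centeredCut M ν).comp ((measurable_pi_apply i).comp measurable_snd)
  simp only [deviation, dotProduct, Matrix.mulVec, Matrix.trace, Matrix.diag_apply, Pi.star_apply]
  refine Measurable.sub (Finset.measurable_sum _ fun i _ => ?_)
    ((Finset.measurable_sum _ fun i _ => h1 i i).const_mul _)
  exact (continuous_star.measurable.comp (h2 i)).mul
    (Finset.measurable_sum _ fun j _ => (h1 i j).mul (h2 j))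

/-- `C_k` does not involve column `k`, so that column may be set to zero. This exhibits the
resolvent of user `k` as a function of the other columns alone, hence independent of `s_k`. -/
lemma interference_ite (a : Fin K → Fin L → ℂ) (s : Fin N → Fin K → ℂ) (k : Fin K) :
    interference a (fun i j => if j = k then 0 else s i j) k = interference a s k := by
  rw [interference_eq_sum_erase, interference_eq_sum_erase]
  congr 1
  refine Finset.sum_congr rfl fun j hj => ?_
  simp [Finset.ne_of_mem_erase hj]

/-- Freeze the other columns: the block becomes a deterministic matrix of norm at most `σ⁻²`, and
the concentration bound applies to the centered truncation of column `k`. -/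
lemma measure_deviation_ge_le_of_const [IsProbabilityMeasure P] (hν : IsStandardized ν) {M σ : ℝ}
    (hM : 1 ≤ M) (hσ : 0 < σ) {s : Fin N → Fin K → Ω → ℂ}
    (hs : IsIID (fun p : Fin N × Fin K => s p.1 p.2) ν P) (a : Fin K → Fin L → ℂ) (k : Fin K)
    (l l' : Fin L) {ε : ℝ} (hε : 0 < ε) :
    P {ω | 4 * ε * N ≤ ‖deviation σ M ν k l l' a (fun i j => s i j ω) (fun i => s i k ω)‖}
      ≤ 8 * ENNReal.ofReal
        (Real.exp (-(ε ^ 2 / (32 * (2 * M) ^ 4 * (σ⁻¹ ^ 2) ^ 2)) * N)) := by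
  have h1 := indepFun_ite hs.measurable hs.indep
    (Finset.univ.filter fun p : Fin N × Fin K => p.2 = k)
  let φ : (Fin N × Fin K → ℂ) → Fin N → ℂ := fun x i => x (i, k)
  let ψ : (Fin N × Fin K → ℂ) → Fin N → Fin K → ℂ := fun x i j => x (i, j)
  have hφ : Measurable φ := measurable_pi_lambda _ fun i => measurable_pi_apply _
  have hψ : Measurable ψ :=
    measurable_pi_lambda _ fun i => measurable_pi_lambda _ fun j => measurable_pi_apply _
  have h2 := h1.comp hφ hψ
  let X : Ω → Fin N → ℂ := fun ω i => s i k ω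
  let Y : Ω → Fin N → Fin K → ℂ := fun ω i j => if j = k then 0 else s i j ω
  have hX : Measurable X := measurable_pi_lambda _ fun i => hs.measurable (i, k)
  have hY : Measurable Y := measurable_pi_lambda _ fun i => measurable_pi_lambda _ fun j => by
    by_cases hj : j = k <;> simp only [Y, hj, if_true, if_false]
    exacts [measurable_const, hs.measurable (i, j)]
  have h3 : IndepFun X Y P := by
    convert h2 using 1
    · funext ω i; simp [X, φ]
    · funext ω i j; simp [Y, ψ]
  let S : Set ((Fin N → ℂ) × (Fin N → Fin K → ℂ)) :=
    {p | 4 * ε * N ≤ ‖deviation σ M ν k l l' a p.2 p.1‖}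
  have hS : MeasurableSet S := by
    refine measurableSet_le measurable_const ?_
    exact ((measurable_deviation hσ M ν k l l').comp
      ((measurable_const.prodMk measurable_snd).prodMk measurable_fst)).norm
  have h4 := measure_le_of_indepFun hX hY h3 hS (C := 8 * ENNReal.ofReal
        (Real.exp (-(ε ^ 2 / (32 * (2 * M) ^ 4 * (σ⁻¹ ^ 2) ^ 2)) * N))) fun ω' => by
    have h5 := ((hs.column k).isBoundedCentered hν hM).measure_norm_quadratic_ge_le
      (by linarith : 0 < 2 * M) (by positivity : 0 < σ⁻¹ ^ 2)
      (sqNorm_userBlock_mulVec_le hσ a (Y ω') k l l') hε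
    rw [Fintype.card_fin] at h5
    exact h5
  have h6 : ∀ ω, deviation σ M ν k l l' a (Y ω) (X ω)
      = deviation σ M ν k l l' a (fun i j => s i j ω) (fun i => s i k ω) := fun ω => by
    simp only [deviation, userBlock, Y, X]
    rw [interference_ite a (fun i j => s i j ω) k]
  simpa only [S, Set.mem_ofPred_eq, h6] using h4

lemma measurable_gain : Measurable fun p : ℝ × (Fin L → ℂ) => gain p.1 p.2 := by
  unfold gain
  exact (by fun_prop : Continuous fun p : ℝ × (Fin L → ℂ) =>
    (fun l => ((√p.1 : ℝ) : ℂ) * p.2 l : Fin L → ℂ)).measurable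

lemma measure_deviation_ge_le [IsProbabilityMeasure P] (hν : IsStandardized ν) {M σ : ℝ}
    (hM : 1 ≤ M) (hσ : 0 < σ) {s : Fin N → Fin K → Ω → ℂ}
    (hs : IsIID (fun p : Fin N × Fin K => s p.1 p.2) ν P) {T : Fin K → Ω → ℝ}
    {γ : Fin K → Fin L → Ω → ℂ} (hT : ∀ k, Measurable (T k)) (hγ : ∀ k l, Measurable (γ k l))
    (hind : IndepFun (fun ω (k : Fin K) => (T k ω, fun l : Fin L => γ k l ω))
      (fun ω (i : Fin N) (k : Fin K) => s i k ω) P) (k : Fin K)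
    (l l' : Fin L) {ε : ℝ} (hε : 0 < ε) :
    P {ω | 4 * ε * N ≤ ‖deviation σ M ν k l l' (fun j => gain (T j ω) fun m => γ j m ω)
        (fun i j => s i j ω) (fun i => s i k ω)‖}
      ≤ 8 * ENNReal.ofReal
        (Real.exp (-(ε ^ 2 / (32 * (2 * M) ^ 4 * (σ⁻¹ ^ 2) ^ 2)) * N)) := by
  have hX : Measurable fun ω (i : Fin N) (k : Fin K) => s i k ω :=
    measurable_pi_lambda _ fun i => measurable_pi_lambda _ fun j => hs.measurable (i, j)
  have hY : Measurable fun ω (k : Fin K) => (T k ω, fun l : Fin L => γ k l ω) :=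
    measurable_pi_lambda _ fun k => (hT k).prodMk (measurable_pi_lambda _ fun l => hγ k l)
  let S : Set ((Fin N → Fin K → ℂ) × (Fin K → ℝ × (Fin L → ℂ))) :=
    {p | 4 * ε * N ≤ ‖deviation σ M ν k l l' (fun j => gain (p.2 j).1 (p.2 j).2) p.1
      (fun i => p.1 i k)‖}
  have hS : MeasurableSet S := by
    refine measurableSet_le measurable_const ?_
    refine ((measurable_deviation hσ M ν k l l').comp
      (Measurable.prodMk (Measurable.prodMk ?_ measurable_fst) ?_)).norm
    · exact measurable_pi_lambda _ fun j => measurable_gain.comp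
        ((measurable_pi_apply j).comp measurable_snd)
    · exact measurable_pi_lambda _ fun i => (measurable_pi_apply k).comp
        ((measurable_pi_apply i).comp measurable_fst)
  have h := measure_le_of_indepFun hX hY hind.symm hS (C := 8 * ENNReal.ofReal
        (Real.exp (-(ε ^ 2 / (32 * (2 * M) ^ 4 * (σ⁻¹ ^ 2) ^ 2)) * N))) fun ω' => by
    simp only [S, Set.mem_ofPred_eq]
    exact measure_deviation_ge_le_of_const hν hM hσ hs
      (fun j => gain (T j ω') fun m => γ j m ω') k l l' hε
  simpa only [S, Set.mem_ofPred_eq] using h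

end Model

end QuadraticForms

/-! ### Almost sure uniform estimates over all users. -/

section Assembly

variable {Ω : Type*} [MeasurableSpace Ω] {P : Measure Ω} [IsProbabilityMeasure P] {ν : Measure ℂ}
  {L : ℕ} {K : ℕ → ℕ} {c σ : ℝ}

/-- Borel–Cantelli for exponentially unlikely events, uniformly over all users. -/
lemma ae_eventually_forall_notMem
    (hK : Tendsto (fun N : ℕ => (K N : ℝ) / (N : ℝ)) atTop (𝓝 c)) (hc : 0 ≤ c)
    {ι : Type*} [Fintype ι] {S : (N : ℕ) → Fin (K N) × ι → Set Ω} {κ : ℝ} (hκ : 0 < κ)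
    (h : ∀ N p, P (S N p) ≤ 8 * ENNReal.ofReal (Real.exp (-κ * N))) :
    ∀ᵐ ω ∂P, ∀ᶠ N : ℕ in atTop, ∀ p, ω ∉ S N p := by
  have hsumm : Summable fun N : ℕ =>
      (c + 1) * Fintype.card ι * 8 * ((N : ℝ) ^ 1 * Real.exp (-κ * N)) :=
    (Real.summable_pow_mul_exp_neg_nat_mul 1 hκ).mul_left _
  have h1 : ∀ᵐ ω ∂P, ∀ᶠ N : ℕ in atTop, ω ∉ ⋃ p ∈ (Finset.univ : Finset (Fin (K N) × ι)), S N p := by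
    refine ae_eventually_notMem_of_le hsumm (fun N => by positivity) ?_
    filter_upwards [hK.eventually_lt_const (lt_add_one c), eventually_gt_atTop 0] with N h1 h2
    have hN : (0 : ℝ) < N := by exact_mod_cast h2
    rw [div_lt_iff₀ hN] at h1
    refine (measure_biUnion_finset_le _ _).trans ((Finset.sum_le_sum fun p _ => h N p).trans ?_)
    have h8 : (8 : ℝ≥0∞) = ENNReal.ofReal 8 := by simp
    rw [Finset.sum_const, nsmul_eq_mul, ← ENNReal.ofReal_natCast, h8,
      ← ENNReal.ofReal_mul (by norm_num), ← ENNReal.ofReal_mul (by positivity)]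
    refine ENNReal.ofReal_le_ofReal ?_
    simp only [Finset.card_univ, Fintype.card_prod, Fintype.card_fin, Nat.cast_mul]
    calc (K N : ℝ) * Fintype.card ι * (8 * Real.exp (-κ * N))
        ≤ ((c + 1) * N) * Fintype.card ι * (8 * Real.exp (-κ * N)) := by gcongr
      _ = _ := by ring
  filter_upwards [h1] with ω h2
  filter_upwards [h2] with N h3
  simpa using h3

/-- Deterministic comparison of `s* D s` with the trace of `D`, through the truncation of `s`. -/
lemma norm_quadratic_sub_trace_le {N : ℕ} (hν : IsStandardized ν) {M ε ε₁ d : ℝ} (hM : 1 ≤ M)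
    (hd : 0 < d) (hε : 0 < ε) (hε₁ : ε₁ = min (1 / 4) ((ε / (20 * d)) ^ 2))
    (hT : ∫ z, tailSq M z ∂ν ≤ ε₁ / 2) {D : Matrix (Fin N) (Fin N) ℂ}
    (hD : ∀ x, sqNorm (D *ᵥ x) ≤ d ^ 2 * sqNorm x) {x : Fin N → ℂ}
    (htail : ∑ i, tailSq M (x i) ≤ ε₁ * N)
    (hdev : ‖star (fun i => centeredCut M ν (x i)) ⬝ᵥ (D *ᵥ fun i => centeredCut M ν (x i))
      - cutVar M ν * D.trace‖ ≤ 4 * (ε / 16) * N)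
    (hone : ‖star (fun i => centeredCut M ν (x i)) ⬝ᵥ
      ((1 : Matrix (Fin N) (Fin N) ℂ) *ᵥ fun i => centeredCut M ν (x i))
      - cutVar M ν * (1 : Matrix (Fin N) (Fin N) ℂ).trace‖ ≤ 4 * (1 / 8) * N) :
    ‖star x ⬝ᵥ (D *ᵥ x) - D.trace‖ ≤ ε * N := by
  have hN : (0 : ℝ) ≤ N := Nat.cast_nonneg N
  set u : Fin N → ℂ := fun i => centeredCut M ν (x i) with hu
  set t := ∫ z, tailSq M z ∂ν with ht
  have ht0 : 0 ≤ t := integral_nonneg (tailSq_nonneg M)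
  have hε₁4 : ε₁ ≤ 1 / 4 := hε₁ ▸ min_le_left _ _
  have hε₁0 : 0 < ε₁ := by rw [hε₁]; exact lt_min (by norm_num) (by positivity)
  have hε₁s : √ε₁ ≤ ε / (20 * d) := by
    rw [← Real.sqrt_sq (by positivity : 0 ≤ ε / (20 * d))]
    exact Real.sqrt_le_sqrt (hε₁ ▸ min_le_right _ _)
  have hε₁le : ε₁ ≤ √ε₁ := by
    have h1 : √ε₁ ≤ 1 := by rw [← Real.sqrt_one]; exact Real.sqrt_le_sqrt (by linarith)
    nlinarith [Real.mul_self_sqrt hε₁0.le, Real.sqrt_nonneg ε₁]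
  have hvar : |1 - cutVar M ν| ≤ ε₁ := by
    refine (abs_one_sub_cutVar_le hν hM).trans ?_
    rw [← ht]; nlinarith
  have hv : sqNorm (x - u) ≤ (4 * ε₁) * N := by
    have h1 : sqNorm (x - u) ≤ ∑ i, 2 * (tailSq M (x i) + t ^ 2) :=
      Finset.sum_le_sum fun i _ => norm_sub_centeredCut_sq_le hν hM (x i)
    rw [← Finset.mul_sum, Finset.sum_add_distrib] at h1
    simp only [Finset.sum_const, Finset.card_univ, Fintype.card_fin, nsmul_eq_mul] at h1
    have h2 : t ^ 2 ≤ ε₁ := by nlinarith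
    nlinarith [mul_le_mul_of_nonneg_left h2 hN]
  -- The case `D = 1` of concentration: `‖u‖² ≤ (cutVar + 1/2) N` with `cutVar ≤ 5/4`.
  have huN : sqNorm u ≤ 2 * N := by
    rw [Matrix.one_mulVec, star_dotProduct_self, Matrix.trace_one, Fintype.card_fin,
      ← Complex.ofReal_natCast, ← Complex.ofReal_mul, ← Complex.ofReal_sub, Complex.norm_real,
      Real.norm_eq_abs] at hone
    have h1 := (abs_le.1 hone).2
    have h2 : cutVar M ν ≤ 5 / 4 := by linarith [(abs_le.1 hvar).1]
    nlinarith [mul_le_mul_of_nonneg_right h2 hN]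
  have h1 := norm_quadratic_sub_le hd.le hD hN (by linarith) (by linarith) hv huN
  have h2 := norm_trace_le hd.le hD
  rw [Fintype.card_fin] at h2
  have h3 : ‖((cutVar M ν : ℂ) - 1) * D.trace‖ ≤ ε₁ * (d * N) := by
    rw [norm_mul]
    refine mul_le_mul ?_ h2 (norm_nonneg _) hε₁0.le
    rw [← Complex.ofReal_one, ← Complex.ofReal_sub, Complex.norm_real, Real.norm_eq_abs,
      abs_sub_comm]
    exact hvar
  -- Three errors: replacing `x` by its truncation (`2ε/5`), fluctuation (`ε/4`), and the variance
  -- defect (`ε/20`).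
  have e : star x ⬝ᵥ (D *ᵥ x) - D.trace = (star x ⬝ᵥ (D *ᵥ x) - star u ⬝ᵥ (D *ᵥ u))
      + (star u ⬝ᵥ (D *ᵥ u) - cutVar M ν * D.trace) + ((cutVar M ν : ℂ) - 1) * D.trace := by ring
  rw [e]
  have hs4 : √(4 * ε₁) = 2 * √ε₁ := by
    rw [Real.sqrt_mul (by norm_num), show (4 : ℝ) = 2 ^ 2 by norm_num,
      Real.sqrt_sq (by norm_num)]
  have hb1 : 4 * √(4 * ε₁) * d * N ≤ 2 / 5 * ε * N := by
    rw [hs4]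
    calc 4 * (2 * √ε₁) * d * N ≤ 4 * (2 * (ε / (20 * d))) * d * N := by gcongr
      _ = _ := by field_simp; ring
  have hb2 : ε₁ * (d * N) ≤ 1 / 20 * ε * N := by
    calc ε₁ * (d * N) ≤ (ε / (20 * d)) * (d * N) := by gcongr; exact hε₁le.trans hε₁s
      _ = _ := by field_simp
  refine norm_add₃_le.trans ?_
  have : 0 ≤ ε * N := by positivity
  linarith

variable {s : (N : ℕ) → Fin N → Fin (K N) → Ω → ℂ} {T : (N : ℕ) → Fin (K N) → Ω → ℝ}
  {γ : (N : ℕ) → Fin (K N) → Fin L → Ω → ℂ}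

/-- The quadratic forms of all users are uniformly close to the normalized block traces of their
resolvents. -/
theorem ae_eventually_norm_userForm_sub_le (hν : IsStandardized ν)
    (h4 : Integrable (fun z : ℂ => ‖z‖ ^ 4) ν) (hσ : 0 < σ)
    (hK : Tendsto (fun N : ℕ => (K N : ℝ) / (N : ℝ)) atTop (𝓝 c)) (hc : 0 ≤ c)
    (hs : RowwiseIID s ν P) (hsmall : EntriesSmall s P)
    (hT : ∀ N k, Measurable (T N k)) (hγ : ∀ N k l, Measurable (γ N k l))
    (hindep : ∀ N : ℕ,
      IndepFun (fun ω (k : Fin (K N)) => (T N k ω, fun l : Fin L => γ N k l ω))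
        (fun ω (i : Fin N) (k : Fin (K N)) => s N i k ω) P) {ε : ℝ} (hε : 0 < ε) :
    ∀ᵐ ω ∂P, ∀ᶠ N : ℕ in atTop, ∀ k l l',
      ‖userForm σ (fun j => gain (T N j ω) fun m => γ N j m ω) (fun i j => s N i j ω) k l l'
        - blockTrace (interference (fun j => gain (T N j ω) fun m => γ N j m ω)
          (fun i j => s N i j ω) k + ((σ : ℂ) ^ 2) • 1)⁻¹ l l'‖ ≤ ε := by
  set d := σ⁻¹ ^ 2 with hd_def
  have hd : 0 < d := by positivity
  set ε₁ := min (1 / 4) ((ε / (20 * d)) ^ 2) with hε₁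
  have hε₁0 : 0 < ε₁ := lt_min (by norm_num) (by positivity)
  obtain ⟨M, hM, hTail⟩ := hν.exists_integral_tailSq_le (half_pos hε₁0)
  have hM0 : 0 < M := by linarith
  have hA := ae_eventually_sum_tailSq_le hν h4 hK hc hs hsmall hε₁0 hTail
  have hB := ae_eventually_forall_notMem (P := P) hK hc (ι := Fin L × Fin L)
    (S := fun N p => {ω | 4 * (ε / 16) * N ≤ ‖deviation σ M ν p.1 p.2.1 p.2.2
      (fun j => gain (T N j ω) fun m => γ N j m ω) (fun i j => s N i j ω) (fun i => s N i p.1 ω)‖})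
    (κ := (ε / 16) ^ 2 / (32 * (2 * M) ^ 4 * (σ⁻¹ ^ 2) ^ 2)) (by positivity) fun N p =>
      measure_deviation_ge_le hν hM hσ (hs N) (hT N) (hγ N) (hindep N) p.1 p.2.1 p.2.2
        (by positivity)
  have hC := ae_eventually_forall_notMem (P := P) hK hc (ι := Unit)
    (S := fun N p => {ω | 4 * (1 / 8) * N ≤ ‖star (fun i => centeredCut M ν (s N i p.1 ω)) ⬝ᵥ
      ((1 : Matrix (Fin N) (Fin N) ℂ) *ᵥ fun i => centeredCut M ν (s N i p.1 ω))
      - cutVar M ν * (1 : Matrix (Fin N) (Fin N) ℂ).trace‖})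
    (κ := (1 / 8) ^ 2 / (32 * (2 * M) ^ 4 * 1 ^ 2)) (by positivity) fun N p => by
      have h := (((hs N).column p.1).isBoundedCentered hν hM).measure_norm_quadratic_ge_le
        (D := 1) (by linarith) one_pos (fun x => by rw [Matrix.one_mulVec]; linarith)
        (by norm_num : (0 : ℝ) < 1 / 8)
      rw [Fintype.card_fin] at h
      exact h
  filter_upwards [hA, hB, hC] with ω h1 h2 h3
  filter_upwards [h1, h2, h3, eventually_gt_atTop 0] with N h5 h6 h7 hN k l l'
  have hN' : (0 : ℝ) < N := by exact_mod_cast hN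
  have h8 := h6 (k, l, l')
  have h9 := h7 (k, ())
  simp only [not_le] at h8 h9
  have h10 := norm_quadratic_sub_trace_le hν hM hd hε hε₁ hTail
    (sqNorm_userBlock_mulVec_le hσ (fun j => gain (T N j ω) fun m => γ N j m ω)
      (fun i j => s N i j ω) k l l') (h5 k) h8.le h9.le
  have e : userForm σ (fun j => gain (T N j ω) fun m => γ N j m ω) (fun i j => s N i j ω) k l l'
      - blockTrace (interference (fun j => gain (T N j ω) fun m => γ N j m ω)
          (fun i j => s N i j ω) k + ((σ : ℂ) ^ 2) • 1)⁻¹ l l'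
      = (N : ℂ)⁻¹ * (star (fun i => s N i k ω) ⬝ᵥ (userBlock σ
          (fun j => gain (T N j ω) fun m => γ N j m ω) (fun i j => s N i j ω) k l l' *ᵥ
            fun i => s N i k ω)
        - (userBlock σ (fun j => gain (T N j ω) fun m => γ N j m ω)
          (fun i j => s N i j ω) k l l').trace) := by
    rw [mul_sub]; rfl
  rw [e, norm_mul, norm_inv, Complex.norm_natCast, inv_mul_le_iff₀ hN', mul_comm]
  exact h10

lemma ae_exists_sqNorm_column_le (hν : IsStandardized ν)
    (h4 : Integrable (fun z : ℂ => ‖z‖ ^ 4) ν)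
    (hK : Tendsto (fun N : ℕ => (K N : ℝ) / (N : ℝ)) atTop (𝓝 c)) (hc : 0 ≤ c)
    (hs : RowwiseIID s ν P) (hsmall : EntriesSmall s P) :
    ∃ B : ℝ, 0 ≤ B ∧ ∀ᵐ ω ∂P, ∀ᶠ N : ℕ in atTop, ∀ k,
      sqNorm (fun i => s N i k ω) ≤ B * N := by
  obtain ⟨M, hM, hTail⟩ := hν.exists_integral_tailSq_le (half_pos one_pos)
  refine ⟨M ^ 2 + 1, by positivity, ?_⟩
  filter_upwards [ae_eventually_sum_tailSq_le hν h4 hK hc hs hsmall one_pos hTail] with ω h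
  filter_upwards [h] with N h1 k
  have h2 : ∀ i, ‖s N i k ω‖ ^ 2 ≤ M ^ 2 + tailSq M (s N i k ω) := fun i => by
    have := pow_le_pow_left₀ (norm_nonneg _) (norm_cut_le (by linarith : 0 ≤ M) (s N i k ω)) 2
    rw [norm_cut_sq] at this
    linarith
  refine (Finset.sum_le_sum fun i _ => h2 i).trans ?_
  rw [Finset.sum_add_distrib]
  simp only [Finset.sum_const, Finset.card_univ, Fintype.card_fin, nsmul_eq_mul]
  linarith [h1 k]

lemma Integrable.norm_pow_four_of_six [IsFiniteMeasure ν]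
    (h6 : Integrable (fun z : ℂ => ‖z‖ ^ 6) ν) : Integrable (fun z : ℂ => ‖z‖ ^ 4) ν := by
  refine (h6.add (integrable_const 1)).mono' (by fun_prop) (ae_of_all _ fun z => ?_)
  rw [Real.norm_of_nonneg (by positivity), Pi.add_apply]
  nlinarith [sq_nonneg (‖z‖ ^ 2 - 1), sq_nonneg ‖z‖, sq_nonneg (‖z‖ ^ 2),
    mul_nonneg (sq_nonneg ‖z‖) (sq_nonneg (‖z‖ ^ 2 - 1))]

end Assembly

end CDMA

/-! ### The theorem. -/

theorem theorem7p1 {Ω : Type*} [MeasurableSpace Ω] (P : Measure Ω) [IsProbabilityMeasure P]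
    (L : ℕ) (K : ℕ → ℕ) (c σ : ℝ) (hc : 0 < c) (hσ : 0 < σ)
    (hK : Tendsto (fun N : ℕ => (K N : ℝ) / (N : ℝ)) atTop (𝓝 c))
    -- the signature sequences: `s N i k` is the `i`-th entry of the sequence of user `k`
    (s : (N : ℕ) → Fin N → Fin (K N) → Ω → ℂ)
    (ν : Measure ℂ) (hν : CDMA.IsStandardized ν)
    (hs : (CDMA.FromDoubleArray s ν P ∧ Integrable (fun z : ℂ => ‖z‖ ^ 4) ν) ∨
      (CDMA.RowwiseIID s ν P ∧ Integrable (fun z : ℂ => ‖z‖ ^ 6) ν))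
    -- the transmit powers and the fading gains
    (T : (N : ℕ) → Fin (K N) → Ω → ℝ) (γ : (N : ℕ) → Fin (K N) → Fin L → Ω → ℂ)
    (hT : ∀ N k, Measurable (T N k)) (hT_nonneg : ∀ N k ω, 0 ≤ T N k ω)
    (hγ : ∀ N k l, Measurable (γ N k l))
    (hindep : ∀ N : ℕ,
      IndepFun (fun ω (k : Fin (K N)) => (T N k ω, fun l : Fin L => γ N k l ω))
        (fun ω (i : Fin N) (k : Fin (K N)) => s N i k ω) P)
    (H : Measure (Fin L → ℂ)) [IsProbabilityMeasure H]
    (hH : ∀ᵐ ω ∂P, CDMA.WeaklyConverges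
      (fun N : ℕ => CDMA.empiricalMeasure
        (fun k : Fin (K N) => CDMA.gain (T N k ω) (fun l => γ N k l ω))) H) :
    ∃ A : Matrix (Fin L) (Fin L) ℂ,
      A.PosDef ∧ CDMA.FixedPoint c σ H A ∧
      (∀ B : Matrix (Fin L) (Fin L) ℂ, B.PosDef → CDMA.FixedPoint c σ H B → B = A) ∧
      ∀ l l' : Fin L, ∀ᵐ ω ∂P,
        Tendsto (fun N : ℕ => ⨆ k : Fin (K N),
          ‖CDMA.userForm σ (fun j => CDMA.gain (T N j ω) (fun m => γ N j m ω))
            (fun i j => s N i j ω) k l l' - A l l'‖) atTop (𝓝 0) := by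
  have := hν.isProbabilityMeasure
  have hiid : CDMA.RowwiseIID s ν P := hs.elim (fun h => h.1.rowwiseIID) fun h => h.1
  have h4 : Integrable (fun z : ℂ => ‖z‖ ^ 4) ν :=
    hs.elim (fun h => h.2) fun h => CDMA.Integrable.norm_pow_four_of_six h.2
  have hsmall : CDMA.EntriesSmall s P :=
    hs.elim (fun h => CDMA.entriesSmall_of_fromDoubleArray hK hc.le h.1 h.2)
      fun h => CDMA.entriesSmall_of_rowwiseIID hK hc.le h.1 h.2
  obtain ⟨B, hB0, hB⟩ := CDMA.ae_exists_sqNorm_column_le hν h4 hK hc.le hiid hsmall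
  -- Countably many tolerances, so that a single null set serves all of them.
  have hform : ∀ᵐ ω ∂P, ∀ m : ℕ, ∀ᶠ N : ℕ in atTop, ∀ k l l',
      ‖CDMA.userForm σ (fun j => CDMA.gain (T N j ω) fun m => γ N j m ω)
          (fun i j => s N i j ω) k l l'
        - CDMA.blockTrace (CDMA.interference (fun j => CDMA.gain (T N j ω) fun m => γ N j m ω)
          (fun i j => s N i j ω) k + ((σ : ℂ) ^ 2) • 1)⁻¹ l l'‖ ≤ 1 / ((m : ℝ) + 1) :=
    ae_all_iff.2 fun m => CDMA.ae_eventually_norm_userForm_sub_le hν h4 hσ hK hc.le hiid hsmall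
      hT hγ hindep (by positivity)
  have hclose : ∀ᵐ ω ∂P, ∀ ε > 0, ∀ᶠ N : ℕ in atTop, ∀ k l l',
      ‖CDMA.userForm σ (fun j => CDMA.gain (T N j ω) fun m => γ N j m ω)
          (fun i j => s N i j ω) k l l'
        - CDMA.traceMatrix σ (fun j => CDMA.gain (T N j ω) fun m => γ N j m ω)
          (fun i j => s N i j ω) l l'‖ ≤ ε := by
    filter_upwards [hform] with ω h ε hε
    obtain ⟨m, hm⟩ := exists_nat_one_div_lt (half_pos hε)
    have hlim : Tendsto (fun N : ℕ => (σ ^ 2)⁻¹ / (N : ℝ)) atTop (𝓝 0) :=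
      tendsto_const_div_atTop_nhds_zero_nat _
    filter_upwards [h m, hlim.eventually_lt_const (half_pos hε)] with N h1 h2 k l l'
    have h3 := CDMA.norm_blockTrace_sub_le hσ (fun j => CDMA.gain (T N j ω) fun m => γ N j m ω)
      (fun i j => s N i j ω) k l l'
    have h4 := norm_sub_le_norm_sub_add_norm_sub
      (CDMA.userForm σ (fun j => CDMA.gain (T N j ω) fun m => γ N j m ω)
        (fun i j => s N i j ω) k l l')
      (CDMA.blockTrace (CDMA.interference (fun j => CDMA.gain (T N j ω) fun m => γ N j m ω)
          (fun i j => s N i j ω) k + ((σ : ℂ) ^ 2) • 1)⁻¹ l l')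
      (CDMA.traceMatrix σ (fun j => CDMA.gain (T N j ω) fun m => γ N j m ω)
          (fun i j => s N i j ω) l l')
    have h5 := h1 k l l'
    rw [CDMA.traceMatrix] at h4 ⊢
    linarith
  have hconv : ∀ᵐ ω ∂P, ∃ A : Matrix (Fin L) (Fin L) ℂ, A.PosDef ∧ CDMA.FixedPoint c σ H A ∧
      Tendsto (fun N => CDMA.traceMatrix σ (fun j => CDMA.gain (T N j ω) fun m => γ N j m ω)
          (fun i j => s N i j ω)) atTop (𝓝 A) := by
    filter_upwards [hH, hB, hclose] with ω h1 h2 h3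
    exact CDMA.exists_tendsto_traceMatrix hc.le hσ hK h1 hB0 h2 h3
  -- A single outcome already produces a solution; uniqueness then identifies the limit at almost
  -- every other outcome with this nonrandom `A`.
  obtain ⟨ω₀, A, hA, hfA, -⟩ := hconv.exists
  have huniq : ∀ B : Matrix (Fin L) (Fin L) ℂ, B.PosDef → CDMA.FixedPoint c σ H B → B = A :=
    fun B hB hfB => CDMA.eq_of_fixedPoint hc.le hσ hA hB hfA hfB
  refine ⟨A, hA, hfA, huniq, fun l l' => ?_⟩
  filter_upwards [hconv, hclose] with ω ⟨A', hA', hfA', hlim⟩ h2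
  rw [huniq A' hA' hfA'] at hlim
  have hentry : Tendsto (fun N => CDMA.traceMatrix σ
      (fun j => CDMA.gain (T N j ω) fun m => γ N j m ω) (fun i j => s N i j ω) l l') atTop
      (𝓝 (A l l')) := tendsto_pi_nhds.1 (tendsto_pi_nhds.1 hlim l) l'
  rw [Metric.tendsto_nhds]
  intro ε hε
  filter_upwards [h2 (ε / 4) (by positivity),
    Metric.tendsto_nhds.1 hentry (ε / 4) (by positivity)] with N h3 h4
  rw [dist_eq_norm] at h4
  rw [dist_zero_right, Real.norm_of_nonneg (Real.iSup_nonneg fun k => norm_nonneg _)]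
  -- The bound on a real supremum must be nonnegative: if `K N = 0` the supremum is over the empty
  -- set and equals `0`.
  refine lt_of_le_of_lt (Real.iSup_le (a := ε / 2) (fun k => ?_) (by positivity)) (by linarith)
  have h5 := norm_sub_le_norm_sub_add_norm_sub
      (CDMA.userForm σ (fun j => CDMA.gain (T N j ω) fun m => γ N j m ω)
        (fun i j => s N i j ω) k l l')
      (CDMA.traceMatrix σ (fun j => CDMA.gain (T N j ω) fun m => γ N j m ω)
          (fun i j => s N i j ω) l l') (A l l')
  have h6 := h3 k l l'
  linarith
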